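/- **Setting.** Consider connected bipartite maps (ribbon graphs on oriented surfaces) all of whose vertices have degree 4; they are the Feynman graphs of the bipartite $U(N)\times O(D)$ multi-matrix model with tetrahedral interaction. A *rooted map* is such a map with one marked edge, the root; the map reduced to a single closed edge without vertices (the ring) is included. A *straight cycle* is a closed path which follows edges and leaves every vertex through the half-edge opposite to the one by which it entered. If $V,E,F,\phi$ are the numbers of vertices, edges, faces and straight cycles (with $V=E=0$, $F=2$, $\phi=1$ for the ring), the *genus* $g$ and the *grade* $l$ are given by $$2-2g = F-E+V,\qquad \frac{l}{2} = 1+g+E-\frac{3V}{2}-\phi .$$ *Melons.* An elementary melon consists of a white and a black vertex joined by three edges, none of them the root, which leave three successive half-edges of the white vertex and arrive at the black vertex in the reverse cyclic order. Melonic 2-point submaps are obtained from the elementary melon by repeatedly inserting elementary melons on edges or external half-edges. Replacing every melonic submap by an edge amounts to replacing elementary melons by edges until none is left. *Dipoles.* In a map without melons, a U-dipole (resp. O-dipole) is a pair of adjacent vertices joined by two edges, neither of them the root, which form a face of degree 2 (resp. a straight cycle of length 2). Its four external half-edges form two *sides*, each consisting of a white and a black half-edge: the pairs such that connecting the two half-edges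 of one pair produces an elementary melon. A dipole is *isolated* if it shares no vertex with another dipole. *Chains.* A chain is an isolated dipole, or a sequence of at least two dipoles glued side by side (a side of one is glued to a side of the next by two edges, neither of them the root). A maximal chain is a U-chain (resp. O-chain) if all its dipoles are U-dipoles (resp. O-dipoles), and a broken chain otherwise. *Schemes.* The scheme of a rooted map is obtained by replacing every melonic submap by an edge, and then every maximal chain by a *chain-vertex* with the same four external half-edges. A chain-vertex forgets the length of the chain; it keeps its label (U, O or B for broken), the colours of its four half-edges, their pairing into two sides, and the way in which the faces and the straight paths that enter the chain through one of them leave it through another. Schemes are considered up to isomorphism. **Theorem.** For all integers $h,l\ge 0$, the set $\mathbb{MS}_{h,l}$ of the schemes of all rooted maps of genus $h$ and grade $l$ is finite. -/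

import Mathlib

namespace MatrixModel

/-! ## Rooted bipartite tetravalent maps -/

/-- A connected rooted bipartite tetravalent combinatorial map (equivalently, a connected 2-point
map): a Feynman graph of the bipartite `U(N) × O(D)` model with tetrahedral interaction.

`Dart` is the set of half-edges, `rot` sends a half-edge to its counter-clockwise successor around
its vertex, `edge` exchanges the two half-edges of every edge.  The marked edge (the root) is
subdivided by a bivalent *root vertex* with half-edges `root` and `rot root`; these play the role of
the two free half-edges of the 2-point map, and `root`, counted as white, is glued to the black end
of the marked edge.  All other vertices are *ordinary*: they have degree 4 and are white or black.
The smallest map has no ordinary vertex: it is a bare propagator, closed into a ring. -/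
structure RootedMap : Type 1 where
  Dart : Type
  finite_dart : Finite Dart
  rot : Equiv.Perm Dart
  edge : Equiv.Perm Dart
  white : Dart → Prop
  root : Dart
  white_root : white root
  black_rot_root : ¬ white (rot root)
  rot_rot_root : rot (rot root) = root
  degree_four : ∀ d, d ≠ root → d ≠ rot root →
    rot (rot (rot (rot d))) = d ∧ rot (rot d) ≠ d
  white_rot : ∀ d, d ≠ root → d ≠ rot root → (white (rot d) ↔ white d)
  edge_edge : ∀ d, edge (edge d) = d
  white_edge : ∀ d, white (edge d) ↔ ¬ white d
  connected : ∀ x y, ∃ g ∈ Subgroup.closure {rot, edge}, g x = y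

namespace RootedMap

variable (M : RootedMap)

/-- The half-edge `d` is attached to an ordinary (degree 4) vertex. -/
def Ordinary (d : M.Dart) : Prop := d ≠ M.root ∧ d ≠ M.rot M.root

open Classical in
/-- The half-edge through which a straight path that enters a vertex through `d` leaves it: the
opposite one at an ordinary vertex, the other one at the root vertex. -/
noncomputable def opp (d : M.Dart) : M.Dart :=
  if M.Ordinary d then M.rot (M.rot d) else M.rot d

/-- Number of ordinary vertices (the root vertex only marks an edge, and is not counted). -/
noncomputable def numVertices : ℤ := (Nat.card (Quot fun x y => y = M.rot x) : ℤ) - 1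

/-- Number of edges of the map without its root vertex. -/
noncomputable def numEdges : ℤ := (Nat.card (Quot fun x y => y = M.edge x) : ℤ) - 1

/-- Number of faces. -/
noncomputable def numFaces : ℤ := (Nat.card (Quot fun x y => y = M.rot (M.edge x)) : ℤ)

/-- Number of (unoriented) straight cycles: follow edges, and cross every vertex. -/
noncomputable def numStraight : ℤ :=
  (Nat.card (Quot fun x y => y = M.edge x ∨ y = M.opp x) : ℤ)

/-- The genus `g`, given by `2 - 2 g = F - E + V`. -/
noncomputable def genus : ℚ := (2 - (M.numFaces - M.numEdges + M.numVertices)) / 2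

/-- The grade `l`, given by `l / 2 = 1 + g + E - 3 V / 2 - φ`. -/
noncomputable def grade : ℚ :=
  2 * (1 + M.genus + M.numEdges - 3 * M.numVertices / 2 - M.numStraight)

/-! ## Melons -/

/-- The half-edges `p`, `rot p`, `rot (rot p)` of a white vertex belong to three edges (none of
them the root) that go to one black vertex and arrive there in the reverse cyclic order: these two
vertices and three edges form an elementary melon.  Its two external half-edges are
`rot (rot (rot p))` and `rot (edge p)`. -/
def IsMelon (p : M.Dart) : Prop :=
  M.white p ∧ M.Ordinary p ∧ M.Ordinary (M.edge p) ∧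
    M.edge p = M.rot (M.edge (M.rot p)) ∧
    M.edge (M.rot p) = M.rot (M.edge (M.rot (M.rot p)))

/-- There is no melonic 2-point submap. -/
def MelonFree : Prop := ∀ p, ¬ M.IsMelon p

/-- `N` is obtained from `M` by replacing one elementary melon by an edge. -/
def MelonRemoval (M N : RootedMap) : Prop :=
  ∃ p, M.IsMelon p ∧ ∃ ι : N.Dart → M.Dart,
    Function.Injective ι ∧
    Set.range ι = {d | ¬ M.rot.SameCycle p d ∧ ¬ M.rot.SameCycle (M.edge p) d} ∧
    ι N.root = M.root ∧
    (∀ d, N.white d ↔ M.white (ι d)) ∧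
    (∀ d, ι (N.rot d) = M.rot (ι d)) ∧
    ∀ d,
      (M.edge (ι d) = M.rot (M.rot (M.rot p)) → ι (N.edge d) = M.edge (M.rot (M.edge p))) ∧
      (M.edge (ι d) = M.rot (M.edge p) → ι (N.edge d) = M.edge (M.rot (M.rot (M.rot p)))) ∧
      (M.edge (ι d) ≠ M.rot (M.rot (M.rot p)) → M.edge (ι d) ≠ M.rot (M.edge p) →
        ι (N.edge d) = M.edge (ι d))

/-- `N` is obtained from `M` by replacing every melonic 2-point submap by an edge.  Melonic submaps
are iterated insertions of elementary melons, so this means removing elementary melons for as long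
as there are any. -/
def MelonReduction (M N : RootedMap) : Prop :=
  Relation.ReflTransGen MelonRemoval M N ∧ N.MelonFree

/-! ## Dipoles -/

end RootedMap

/-- The two kinds of dipoles: faces of degree 2 and straight cycles of length 2. -/
inductive DipoleKind
  | U
  | O

namespace RootedMap

variable (M : RootedMap)

/-- The second internal half-edge at the white vertex of a dipole whose first one is `p`. -/
def partner : DipoleKind → M.Dart → M.Dart
  | .U, p => M.rot p
  | .O, p => M.rot (M.rot p)

/-- The two edges that start at the half-edges `p` and `partner k p` of a white vertex form a face
of degree 2 (`k = U`) or a straight cycle of length 2 (`k = O`). -/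
def IsDipoleAt : DipoleKind → M.Dart → Prop
  | .U, p => M.edge p = M.rot (M.edge (M.rot p))
  | .O, p => M.edge (M.rot (M.rot p)) = M.rot (M.rot (M.edge p))

/-- A dipole: a white and a black vertex, and two edges between them, neither of them the root,
that form a face of degree 2 or a straight cycle of length 2.  It is given by its kind and one of
its internal half-edges at the white vertex (either of the two for an O-dipole). -/
structure Dipole where
  kind : DipoleKind
  fst : M.Dart
  white_fst : M.white fst
  ordinary_fst : M.Ordinary fst
  ordinary_edge_fst : M.Ordinary (M.edge fst)
  isDipoleAt : M.IsDipoleAt kind fst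

variable {M}

namespace Dipole

/-- The second internal half-edge at the white vertex. -/
def snd (δ : M.Dipole) : M.Dart := M.partner δ.kind δ.fst

/-- The half-edges of the two internal edges. -/
def inner (δ : M.Dipole) : Set M.Dart := {δ.fst, δ.snd, M.edge δ.fst, M.edge δ.snd}

/-- Two descriptions of the same dipole. -/
def Same (δ ε : M.Dipole) : Prop := δ.kind = ε.kind ∧ δ.inner = ε.inner

/-- One side of the dipole: a white and a black external half-edge.  Closing a side of a dipole by
an edge gives the elementary melon. -/
def sideA (δ : M.Dipole) : Set M.Dart :=
  match δ.kind with
  | .U => {M.rot (M.rot δ.fst), M.rot (M.rot (M.edge δ.fst))}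
  | .O => {M.rot δ.fst, M.rot (M.edge δ.snd)}

/-- The other side of the dipole. -/
def sideB (δ : M.Dipole) : Set M.Dart :=
  match δ.kind with
  | .U => {M.rot (M.rot δ.snd), M.rot (M.rot (M.edge δ.snd))}
  | .O => {M.rot δ.snd, M.rot (M.edge δ.fst)}

def IsSide (δ : M.Dipole) (s : Set M.Dart) : Prop := s = δ.sideA ∨ s = δ.sideB

/-- All eight half-edges at the two vertices of the dipole. -/
def darts (δ : M.Dipole) : Set M.Dart := δ.inner ∪ δ.sideA ∪ δ.sideB

/-- A dipole is isolated if it is vertex-disjoint from all other dipoles. -/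
def Isolated (δ : M.Dipole) : Prop := ∀ ε : M.Dipole, ¬ δ.Same ε → Disjoint δ.darts ε.darts

/-- The side `s` of `δ` is glued, by two edges other than the root, to a side of another dipole
`ε`. -/
def GluedAlong (δ : M.Dipole) (s : Set M.Dart) (ε : M.Dipole) : Prop :=
  ¬ δ.Same ε ∧ δ.IsSide s ∧ ε.IsSide (M.edge '' s)

/-- Two dipoles are glued side by side. -/
def Glued (δ ε : M.Dipole) : Prop := ∃ s, δ.GluedAlong s ε

/-- The dipole belongs to a chain: it is isolated, or it is glued side by side to another dipole. -/
def InChain (δ : M.Dipole) : Prop := δ.Isolated ∨ ∃ ε, δ.Glued ε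

/-- The two dipoles belong to the same maximal sequence of dipoles glued side by side. -/
def SameChain : M.Dipole → M.Dipole → Prop :=
  Relation.ReflTransGen fun δ ε => δ.Same ε ∨ δ.Glued ε

end Dipole

variable (M)

/-- `d` is attached to a vertex of some chain. -/
def OnChain (d : M.Dart) : Prop := ∃ δ : M.Dipole, δ.InChain ∧ d ∈ δ.darts

/-- `d` is one of the four external half-edges of a maximal chain. -/
def IsLeg (d : M.Dart) : Prop :=
  ∃ δ : M.Dipole, δ.InChain ∧ ∃ s, δ.IsSide s ∧ d ∈ s ∧ ¬ ∃ ε, δ.GluedAlong s ε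

/-- The half-edges that remain when every maximal chain is replaced by a chain-vertex. -/
def Kept (d : M.Dart) : Prop := ¬ M.OnChain d ∨ M.IsLeg d

/-- Start from the half-edge `x` of a vertex, apply the vertex rule `f`, and as long as the
half-edge obtained is in the interior of a chain, follow its edge and apply `f` again; `y` is the
first half-edge obtained that is not in the interior of a chain. -/
inductive Traverse (f : M.Dart → M.Dart) : M.Dart → M.Dart → Prop
  | exit (x : M.Dart) : M.Kept (f x) → Traverse f x (f x)
  | pass (x y : M.Dart) : ¬ M.Kept (f x) → Traverse f (M.edge (f x)) y → Traverse f x y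

end RootedMap

/-! ## Schemes -/

/-- Labels of chain-vertices: U-chains, O-chains and broken chains. -/
inductive ChainLabel
  | U
  | O
  | B

/-- The data of a map with ordinary vertices, chain-vertices and a root vertex:
* its set of half-edges, with their colours; `root` is the white half-edge of the root vertex;
* `edge`: the two half-edges form an edge;
* `vertex`: the two half-edges are attached to the same vertex or chain-vertex;
* `label x c`: the half-edge `x` is attached to a chain-vertex labelled `c`;
* `side`: the two half-edges are on the same side of a chain-vertex;
* `corner x y`: a face that enters a vertex or chain-vertex through `x` leaves it through `y`;
  at an ordinary vertex, `y` is the counter-clockwise successor of `x`;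
* `straight x y`: a straight path that enters a vertex or chain-vertex through `x` leaves it
  through `y`; at an ordinary vertex, `y` is opposite to `x`. -/
structure MapWithChains : Type 1 where
  Dart : Type
  white : Dart → Prop
  root : Dart → Prop
  edge : Dart → Dart → Prop
  vertex : Dart → Dart → Prop
  label : Dart → ChainLabel → Prop
  side : Dart → Dart → Prop
  corner : Dart → Dart → Prop
  straight : Dart → Dart → Prop

/-- Isomorphism of maps with chain-vertices. -/
def MapWithChains.Iso (S T : MapWithChains) : Prop :=
  ∃ e : S.Dart ≃ T.Dart,
    (∀ x, S.white x ↔ T.white (e x)) ∧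
    (∀ x, S.root x ↔ T.root (e x)) ∧
    (∀ x y, S.edge x y ↔ T.edge (e x) (e y)) ∧
    (∀ x y, S.vertex x y ↔ T.vertex (e x) (e y)) ∧
    (∀ x c, S.label x c ↔ T.label (e x) c) ∧
    (∀ x y, S.side x y ↔ T.side (e x) (e y)) ∧
    (∀ x y, S.corner x y ↔ T.corner (e x) (e y)) ∧
    (∀ x y, S.straight x y ↔ T.straight (e x) (e y))

instance MapWithChains.setoid : Setoid MapWithChains where
  r := MapWithChains.Iso
  iseqv :=
    { refl := fun S => ⟨Equiv.refl _, by simp⟩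
      symm := by
        rintro S T ⟨e, h1, h2, h3, h4, h5, h6, h7, h8⟩
        exact ⟨e.symm, by simp [h1], by simp [h2], by simp [h3], by simp [h4], by simp [h5],
          by simp [h6], by simp [h7], by simp [h8]⟩
      trans := by
        rintro S T R ⟨e, h1, h2, h3, h4, h5, h6, h7, h8⟩ ⟨f, k1, k2, k3, k4, k5, k6, k7, k8⟩
        exact ⟨e.trans f, by simp [h1, k1], by simp [h2, k2], by simp [h3, k3],
          by simp [h4, k4], by simp [h5, k5], by simp [h6, k6], by simp [h7, k7],
          by simp [h8, k8]⟩ }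

namespace RootedMap

/-- The map with chain-vertices obtained from `M` (in which there is no melon left) by replacing
every maximal chain by a chain-vertex with the same external half-edges. -/
noncomputable def contractChains (M : RootedMap) : MapWithChains where
  Dart := {d : M.Dart // M.Kept d}
  white x := M.white x
  root x := (x : M.Dart) = M.root
  edge x y := M.edge x = y
  vertex x y := M.rot.SameCycle x y ∨
    ∃ δ ε : M.Dipole, δ.InChain ∧ δ.SameChain ε ∧ (x : M.Dart) ∈ δ.darts ∧ (y : M.Dart) ∈ ε.darts
  label x c := ∃ δ : M.Dipole, δ.InChain ∧ (x : M.Dart) ∈ δ.darts ∧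
    match c with
    | .U => ∀ ε, δ.SameChain ε → ε.kind = .U
    | .O => ∀ ε, δ.SameChain ε → ε.kind = .O
    | .B => (∃ ε, δ.SameChain ε ∧ ε.kind = .U) ∧ ∃ ε, δ.SameChain ε ∧ ε.kind = .O
  side x y := ∃ δ : M.Dipole, δ.InChain ∧ ∃ s, δ.IsSide s ∧ (x : M.Dart) ∈ s ∧ (y : M.Dart) ∈ s
  corner x y := M.Traverse M.rot x y
  straight x y := M.Traverse M.opp x y

/-- `S` is the scheme of the rooted map `M`: replace every melonic submap by an edge, then every
maximal chain by a chain-vertex. -/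
def HasScheme (M : RootedMap) (S : MapWithChains) : Prop :=
  ∃ N, M.MelonReduction N ∧ N.contractChains.Iso S

end RootedMap

/-- The set of schemes (up to isomorphism) of genus `h` and grade `l`, that is, the set of the
schemes of the rooted maps of genus `h` and grade `l`. -/
def MS (h l : ℕ) : Set (Quotient MapWithChains.setoid) :=
  {s | ∃ (M : RootedMap) (S : MapWithChains),
    M.genus = h ∧ M.grade = l ∧ M.HasScheme S ∧ s = Quotient.mk _ S}

end MatrixModel

/-! # Finiteness of the set of schemes of given genus and grade

The *excess* of a map is `24 c + 12 V - 8 F - 8 φ`, where `c`, `V`, `F` and `φ` are the numbers of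
components, of vertices of degree 4, of faces and of straight cycles.  For a rooted map of genus `g`
and grade `l` it equals `8 g + 4 l` (`RootedMap.excess_toBMap`), it is additive over components, and
it is not affected by the removal of melons (`MelonReduction.excess_eq`).  A scheme is a finite set
of half-edges with finitely many relations, so that it suffices to bound the number of half-edges
that are kept in the scheme of a map `M` without melons in terms of the excess of `M`
(`RootedMap.card_kept_le`).

The proof cuts `M` into pieces by removing dipoles, and for this it works with maps that may be
disconnected and may have vertices of degree 2, which only mark points on edges (`BMap`); the root is
such a vertex.  To remove a dipole is to connect the two half-edges of each side to each other; the
two inner edges become rings.  Removing a dipole keeps the excess if this disconnects the two sides,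
and lowers it by at least 8 otherwise (`Dip.exists_removal`).  Here one counts the cycles of a
permutation that is multiplied by transpositions; the subtle point is a parity argument for straight
cycles (`Dip.IsRemoval.straight_a_d`).  Vertices of degree 2 can be forgotten without changing the
excess (`exists_clean`).

An induction along removals of straight cycles of length 2 shows that the number of components which
are not rings and do not contain two melons is at most a quarter of the excess
(`Clean.four_mul_card_le`).  If there are no straight cycles of length 2, then this follows from the
nonnegativity of the genus, which is Euler's inequality `cyc_add_cyc_add_cyc_le`.

Now let `S` be a maximal family of pairwise disjoint dipoles of `M`.  Their removal leaves `2 |S|`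
rings formed by the inner edges and, up to a number of exceptions controlled by the excess, at least
`|S|` further components, on which the `2 |S|` sides are distributed.  Such a component has
two melons only if it contains at least three sides, because a melon with at most one cut
edge would contain a dipole disjoint from `S` (`IsMultiRemoval.not_twoMelons`); and a ring with a
single side would be a melon of `M`.  Counting sides, all but boundedly many components are rings
with two sides (`exists_exceptional`).  Such a ring is a place where two dipoles of `S` are glued
side by side.  A dipole of `S` that is glued in this way along both sides lies in the interior of a
chain, and none of its half-edges is kept (`not_kept_of_glued`).

It remains to bound the number of half-edges at vertices of degree 4 outside of the dipoles of `S`.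
Each half-edge contributes to the excess at least `3 - 8 / m - 8 / n`, if its face has length
`m` and its straight cycle has `n` half-edges.  By the maximality of `S`, faces and straight
cycles of length 2 only occur next to the boundedly many cut edges.  Elsewhere `m ≥ 4` and `n ≥ 8`,
the contribution is nonnegative, and it vanishes only if `m = 4` and `n = 8`.  So all but
boundedly many half-edges are on faces and straight cycles of length 4.  A half-edge all of whose
neighbours in a ball of fixed radius are of this type belongs to a component that is a quotient of
the torus of size 4 by 4 (`exists_eq_of_locally_square`); this component has no cut edge, which is
impossible in a connected rooted map.  Hence every half-edge is at bounded distance from one of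
boundedly many exceptional ones (`Clean.card_four_le`, `card_four_le_of_exceptional`). -/

namespace MatrixModel
open Equiv

/-! ### Counting classes of generated equivalence relations -/

theorem quot_invariant {D : Type*} {r : D → D → Prop} {P : D → Prop}
    (h : ∀ u v, r u v → (P u ↔ P v)) {x y : D} (hxy : Quot.mk r x = Quot.mk r y) : P x ↔ P y := by
  have := congrArg (Quot.lift P fun u v huv => propext (h u v huv)) hxy
  exact iff_of_eq this

theorem quot_map_eq {D : Type*} {r s : D → D → Prop}
    (h : ∀ u v, r u v → Quot.mk s u = Quot.mk s v) {x y : D} (hxy : Quot.mk r x = Quot.mk r y) :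
    Quot.mk s x = Quot.mk s y :=
  congrArg (Quot.lift (Quot.mk s) h) hxy

theorem card_quot_congr {D : Type*} {r s : D → D → Prop}
    (h₁ : ∀ u v, r u v → Quot.mk s u = Quot.mk s v)
    (h₂ : ∀ u v, s u v → Quot.mk r u = Quot.mk r v) :
    Nat.card (Quot r) = Nat.card (Quot s) :=
  Nat.card_congr
    { toFun := Quot.lift (Quot.mk s) h₁
      invFun := Quot.lift (Quot.mk r) h₂
      left_inv := by rintro ⟨u⟩; rfl
      right_inv := by rintro ⟨u⟩; rfl }

/-- The relation `r` with one further pair. -/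
def addPair {D : Type*} (r : D → D → Prop) (x y : D) : D → D → Prop :=
  fun u v => r u v ∨ (u = x ∧ v = y)

theorem addPair_of_eq {D : Type*} {r : D → D → Prop} (x y : D) {u v : D}
    (h : Quot.mk r u = Quot.mk r v) : Quot.mk (addPair r x y) u = Quot.mk (addPair r x y) v :=
  quot_map_eq (fun _ _ h => Quot.sound (Or.inl h)) h

theorem addPair_eq {D : Type*} (r : D → D → Prop) (x y : D) :
    Quot.mk (addPair r x y) x = Quot.mk (addPair r x y) y :=
  Quot.sound (Or.inr ⟨rfl, rfl⟩)

/-- Identifying two further points of distinct classes lowers the number of classes by one. -/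
theorem card_quot_addPair {D : Type*} [Finite D] {r : D → D → Prop} {x y : D}
    (hxy : Quot.mk r x ≠ Quot.mk r y) :
    Nat.card (Quot r) = Nat.card (Quot (addPair r x y)) + 1 := by
  classical
  set r' := addPair r x y with hr'
  let h : D → {q : Quot r // q ≠ Quot.mk r y} := fun u =>
    if hu : Quot.mk r u = Quot.mk r y then ⟨Quot.mk r x, hxy⟩ else ⟨Quot.mk r u, hu⟩
  have hh : ∀ u v, r' u v → h u = h v := by
    rintro u v (huv | ⟨rfl, rfl⟩)
    · have := Quot.sound huv
      simp only [h, this]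
    · simp only [h, hxy, dif_neg, not_false_eq_true, dif_pos]
  let e : Quot r' ≃ {q : Quot r // q ≠ Quot.mk r y} :=
    { toFun := Quot.lift h hh
      invFun := fun q => Quot.lift (Quot.mk r') (fun u v huv => Quot.sound (Or.inl huv)) q.1
      left_inv := by
        rintro ⟨u⟩
        by_cases hu : Quot.mk r u = Quot.mk r y
        · simp only [h, hu, dif_pos]
          have h1 : Quot.mk r' u = Quot.mk r' y :=
            quot_map_eq (fun u v huv => Quot.sound (Or.inl huv)) hu
          rw [h1]
          exact Quot.sound (Or.inr ⟨rfl, rfl⟩)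
        · simp only [h, hu, dif_neg, not_false_eq_true]
      right_inv := by
        rintro ⟨⟨u⟩, hu⟩
        have hu' : ¬ Quot.mk r u = Quot.mk r y := hu
        simp only [h, hu', dif_neg, not_false_eq_true] }
  have : Fintype (Quot r) := Fintype.ofFinite _
  rw [Nat.card_congr e, Nat.card_eq_fintype_card, Nat.card_eq_fintype_card,
    Fintype.card_subtype_compl, Fintype.card_subtype_eq]
  have : 0 < Fintype.card (Quot r) := Fintype.card_pos_iff.mpr ⟨Quot.mk r y⟩
  omega

theorem card_quot_addPair_of_eq {D : Type*} {r : D → D → Prop} {x y : D}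
    (h : Quot.mk r x = Quot.mk r y) : Nat.card (Quot (addPair r x y)) = Nat.card (Quot r) :=
  card_quot_congr (by rintro u v (huv | ⟨rfl, rfl⟩); exacts [Quot.sound huv, h])
    fun _ _ huv => Quot.sound (Or.inl huv)

theorem even_card_of_involution {D : Type*} (s : Finset D) (g : D → D) (h₁ : ∀ u ∈ s, g u ∈ s)
    (h₂ : ∀ u, g (g u) = u) (h₃ : ∀ u, g u ≠ u) : Even s.card := by
  have : ∑ _u ∈ s, (1 : ZMod 2) = 0 :=
    Finset.sum_involution (fun u _ => g u) (fun _ _ => by decide) (fun u _ _ => h₃ u)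
      (fun u hu => h₁ u hu) (fun u _ => h₂ u)
  rw [Finset.sum_const, nsmul_eq_mul, mul_one] at this
  exact (ZMod.natCast_eq_zero_iff_even).1 this

/-- The number of classes as a sum over points: each point counts for the inverse of the size of
its class. -/
theorem card_quot_eq_sum {D : Type*} [Fintype D] (r : D → D → Prop) :
    (Nat.card (Quot r) : ℚ) =
      ∑ d : D, 1 / (Nat.card {x // Quot.mk r x = Quot.mk r d} : ℚ) := by
  classical
  have : Fintype (Quot r) := Fintype.ofFinite _
  rw [← Finset.sum_fiberwise (s := Finset.univ) (g := Quot.mk r), Nat.card_eq_fintype_card,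
    Fintype.card_eq_sum_ones]
  push_cast
  refine Finset.sum_congr rfl fun q _ => ?_
  have h1 : ∀ d ∈ Finset.univ.filter (fun d => Quot.mk r d = q),
      1 / (Nat.card {x // Quot.mk r x = Quot.mk r d} : ℚ) =
        1 / ((Finset.univ.filter (fun d => Quot.mk r d = q)).card : ℚ) := by
    intro d hd
    rw [Finset.mem_filter] at hd
    rw [hd.2, Nat.card_eq_fintype_card, Fintype.card_subtype]
  rw [Finset.sum_congr rfl h1, Finset.sum_const, nsmul_eq_mul]
  obtain ⟨d, rfl⟩ := Quot.exists_rep q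
  have : 0 < (Finset.univ.filter (fun x => Quot.mk r x = Quot.mk r d)).card :=
    Finset.card_pos.mpr ⟨d, by simp⟩
  field_simp

/-! ### Cycles of permutations -/

/-- The number of cycles of a permutation, fixed points included. -/
noncomputable def cyc {D : Type*} (σ : Perm D) : ℕ := Nat.card (Quot fun x y => y = σ x)

/-- The cycle of `x`. -/
def cls {D : Type*} (σ : Perm D) (x : D) : Quot fun x y => y = σ x := Quot.mk _ x

theorem cls_apply {D : Type*} (σ : Perm D) (x : D) : cls σ (σ x) = cls σ x :=
  (Quot.sound (r := fun x y => y = σ x) rfl).symm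

theorem cls_pow {D : Type*} (σ : Perm D) (n : ℕ) (x : D) : cls σ ((σ ^ n) x) = cls σ x := by
  induction n with
  | zero => rfl
  | succ n ih => rw [pow_succ', Perm.mul_apply, cls_apply, ih]

theorem exists_pow_of_cls_eq {D : Type*} [Finite D] {σ : Perm D} {x y : D}
    (h : cls σ x = cls σ y) : ∃ m, 0 < m ∧ (σ ^ m) x = y := by
  have : σ.SameCycle x x ↔ σ.SameCycle x y :=
    quot_invariant (P := fun u => σ.SameCycle x u)
      (fun u v huv => by subst huv; exact Perm.sameCycle_apply_right.symm) h
  obtain ⟨m, hm, -, h⟩ := (this.1 (Perm.SameCycle.refl _ _)).exists_pow_eq''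
  exact ⟨m, hm, h⟩

theorem mul_swap_apply {D : Type*} [DecidableEq D] (σ : Perm D) (x y u : D) :
    (σ * swap x y) u = if u = x then σ y else if u = y then σ x else σ u := by
  rw [Perm.mul_apply, swap_apply_def]
  split_ifs <;> rfl

/-- Under `σ * swap x y`, the point `x` follows the path of `y` under `σ` until that path meets `x`
or `y`. -/
theorem mul_swap_pow {D : Type*} [DecidableEq D] (σ : Perm D) {x y : D} {m : ℕ} (hm : 0 < m)
    (h : ∀ j, 0 < j → j < m → (σ ^ j) y ≠ x ∧ (σ ^ j) y ≠ y) :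
    ((σ * swap x y) ^ m) x = (σ ^ m) y := by
  induction m, hm using Nat.le_induction with
  | base => simp
  | succ n hn ih =>
    rw [pow_succ', Perm.mul_apply, ih fun j h1 h2 => h j h1 (by omega), mul_swap_apply,
      if_neg (h n hn (by omega)).1, if_neg (h n hn (by omega)).2, pow_succ', Perm.mul_apply]

/-- Composing with the transposition of two points of distinct cycles puts them into one cycle. -/
theorem cls_mul_swap {D : Type*} [Finite D] [DecidableEq D] {σ : Perm D} {x y : D}
    (h : cls σ x ≠ cls σ y) : cls (σ * swap x y) x = cls (σ * swap x y) y := by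
  have hex : ∃ m, 0 < m ∧ (σ ^ m) y = y := exists_pow_of_cls_eq rfl
  have hm := Nat.find_spec hex
  have := mul_swap_pow (σ := σ) (x := x) (y := y) hm.1 fun j h1 h2 =>
    ⟨fun hj => h (by rw [← hj, cls_pow]), fun hj => Nat.find_min hex h2 ⟨h1, hj⟩⟩
  rw [hm.2] at this
  rw [← cls_pow (σ * swap x y) (Nat.find hex) x, this]

/-- Composing with a transposition that merges two cycles lowers the number of cycles by one. -/
theorem cyc_mul_swap_of_ne {D : Type*} [Finite D] [DecidableEq D] {σ : Perm D} {x y : D}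
    (h : cls σ x ≠ cls σ y) : cyc σ = cyc (σ * swap x y) + 1 := by
  have hxy := cls_mul_swap h
  rw [cyc, card_quot_addPair h, Nat.add_right_cancel_iff]
  refine card_quot_congr ?_ ?_
  · rintro u v (rfl | ⟨rfl, rfl⟩)
    · change cls (σ * swap x y) u = cls (σ * swap x y) (σ u)
      have hx : (σ * swap x y) x = σ y := by simp
      have hy : (σ * swap x y) y = σ x := by simp
      by_cases h1 : u = x
      · subst h1; rw [← hy, cls_apply, hxy]
      by_cases h2 : u = y
      · subst h2; rw [← hx, cls_apply, hxy]
      rw [← cls_apply, mul_swap_apply, if_neg h1, if_neg h2]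
    · exact hxy
  · rintro u v rfl
    have hp : ∀ u, Quot.mk (addPair (fun u v => v = σ u) x y) u =
        Quot.mk (addPair (fun u v => v = σ u) x y) (σ u) := fun u => Quot.sound (Or.inl rfl)
    have hq := addPair_eq (fun u v => v = σ u) x y
    rw [mul_swap_apply]
    split_ifs with h1 h2
    · rw [h1, hq, hp]
    · rw [h2, ← hq, hp]
    · exact hp u

/-- Composing with the transposition of two points of the same cycle cuts this cycle in two: one of
the two new cycles is the arc from `y` to `x`. -/
theorem cyc_mul_swap_of_eq {D : Type*} [Finite D] [DecidableEq D] {σ : Perm D} {x y : D}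
    (hne : x ≠ y) (h : cls σ x = cls σ y) : cyc (σ * swap x y) = cyc σ + 1 := by
  have hσ : σ * swap x y * swap x y = σ := by rw [mul_assoc, swap_mul_self, mul_one]
  suffices hd : cls (σ * swap x y) x ≠ cls (σ * swap x y) y by
    rw [cyc_mul_swap_of_ne hd, hσ]
  intro hcl
  have hex : ∃ m, 0 < m ∧ (σ ^ m) y = x := exists_pow_of_cls_eq h.symm
  obtain ⟨hm, hmx⟩ := Nat.find_spec hex
  have hmin := fun j => @Nat.find_min _ _ hex j
  set m := Nat.find hex
  have hy : ∀ j, 0 < j → j < m → (σ ^ j) y ≠ y := by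
    intro j h1 h2 h3
    refine hmin (m - j) (by omega) ⟨by omega, ?_⟩
    conv_lhs => rw [← h3]
    rw [← Perm.mul_apply, ← pow_add, Nat.sub_add_cancel h2.le, hmx]
  -- the arc from `σ y` to `x` is invariant under `σ * swap x y`, and does not contain `y`
  have key : (∃ j, 0 < j ∧ j ≤ m ∧ (σ ^ j) y = x) ↔ (∃ j, 0 < j ∧ j ≤ m ∧ (σ ^ j) y = y) := by
    refine quot_invariant (P := fun u => ∃ j, 0 < j ∧ j ≤ m ∧ (σ ^ j) y = u) ?_ hcl
    rintro u v rfl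
    constructor
    · rintro ⟨j, h1, h2, rfl⟩
      rcases h2.lt_or_eq with h2 | h2
      · refine ⟨j + 1, by omega, by omega, ?_⟩
        rw [mul_swap_apply, if_neg (fun h => hmin j h2 ⟨h1, h⟩), if_neg (hy j h1 h2), pow_succ',
          Perm.mul_apply]
      · refine ⟨1, by omega, by omega, ?_⟩
        rw [h2, hmx]
        simp
    · rintro ⟨j, h1, h2, h3⟩
      rcases Nat.lt_or_ge 1 j with h4 | h4
      · refine ⟨j - 1, by omega, by omega, ?_⟩
        apply (σ * swap x y).injective
        rw [← h3, mul_swap_apply, if_neg (fun h => hmin (j - 1) (by omega) ⟨by omega, h⟩),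
          if_neg (hy (j - 1) (by omega) (by omega)), ← Perm.mul_apply, ← pow_succ']
        congr 2
        omega
      · refine ⟨m, hm, le_rfl, ?_⟩
        apply (σ * swap x y).injective
        rw [← h3, hmx, show j = 1 by omega]
        simp
  obtain ⟨j, h1, h2, h3⟩ := key.1 ⟨m, hm, le_rfl, hmx⟩
  rcases h2.lt_or_eq with h2 | h2
  · exact hy j h1 h2 h3
  · rw [h2, hmx] at h3
    exact hne h3

/-- The composition fixes `y`, and `y` is cut out of its cycle. -/
theorem cyc_split {D : Type*} [Finite D] [DecidableEq D] {σ : Perm D} {x y : D}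
    (hne : x ≠ y) (h : σ x = y) : cyc (σ * swap x y) = cyc σ + 1 :=
  cyc_mul_swap_of_eq hne (by rw [← h, cls_apply])

/-- The relation whose classes are the orbits of the group generated by `σ` and `τ`. -/
def orbRel {D : Type*} (σ τ : Perm D) : D → D → Prop := fun x y => y = τ x ∨ y = σ x

/-- The number of orbits of the group generated by `σ` and `τ`. -/
noncomputable def orb {D : Type*} (σ τ : Perm D) : ℕ := Nat.card (Quot (orbRel σ τ))

theorem orbRel_fst {D : Type*} (σ τ : Perm D) (x : D) :
    Quot.mk (orbRel σ τ) (σ x) = Quot.mk (orbRel σ τ) x :=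
  (Quot.sound (r := orbRel σ τ) (Or.inr rfl)).symm

theorem orbRel_snd {D : Type*} (σ τ : Perm D) (x : D) :
    Quot.mk (orbRel σ τ) (τ x) = Quot.mk (orbRel σ τ) x :=
  (Quot.sound (r := orbRel σ τ) (Or.inl rfl)).symm

theorem orb_map_eq {D : Type*} {σ τ : Perm D} {s : D → D → Prop}
    (h₁ : ∀ u, Quot.mk s (σ u) = Quot.mk s u) (h₂ : ∀ u, Quot.mk s (τ u) = Quot.mk s u) {u v : D}
    (h : Quot.mk (orbRel σ τ) u = Quot.mk (orbRel σ τ) v) : Quot.mk s u = Quot.mk s v :=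
  quot_map_eq (by rintro u v (rfl | rfl); exacts [(h₂ u).symm, (h₁ u).symm]) h

theorem orb_invariant {D : Type*} {σ τ : Perm D} {P : D → Prop}
    (h₁ : ∀ u, P (σ u) ↔ P u) (h₂ : ∀ u, P (τ u) ↔ P u) {u v : D}
    (h : Quot.mk (orbRel σ τ) u = Quot.mk (orbRel σ τ) v) : P u ↔ P v :=
  quot_invariant (by rintro u v (rfl | rfl); exacts [(h₂ u).symm, (h₁ u).symm]) h

theorem card_quot_eq_orb {D : Type*} {r : D → D → Prop} {σ τ : Perm D}
    (h : ∀ u v, r u v → Quot.mk (orbRel σ τ) u = Quot.mk (orbRel σ τ) v)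
    (h₁ : ∀ u, Quot.mk r (σ u) = Quot.mk r u) (h₂ : ∀ u, Quot.mk r (τ u) = Quot.mk r u) :
    Nat.card (Quot r) = orb σ τ :=
  card_quot_congr h (by rintro u v (rfl | rfl); exacts [(h₂ u).symm, (h₁ u).symm])

/-- **Euler's inequality**: the genus of a combinatorial map is nonnegative.  There is equality for
`σ = 1`; the general case follows by cutting points out of the cycles of `σ`, since a step that
increases the number of orbits also increases the number of cycles of `σ * τ`. -/
theorem cyc_add_cyc_add_cyc_le {D : Type*} [Finite D] (σ τ : Perm D) :
    cyc σ + cyc τ + cyc (σ * τ) ≤ Nat.card D + 2 * orb σ τ := by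
  classical
  have hle : ∀ ρ : Perm D, cyc ρ ≤ Nat.card D := fun ρ =>
    Nat.card_le_card_of_surjective _ Quot.mk_surjective
  induction hn : Nat.card D - cyc σ using Nat.strong_induction_on generalizing σ with
  | _ n ih =>
  by_cases h1 : ∀ x, σ x = x
  · have hσ : σ = 1 := Equiv.ext h1
    have h2 : orb σ τ = cyc τ := by
      refine card_quot_congr ?_ ?_
      · rintro u v (rfl | rfl)
        · exact Quot.sound rfl
        · rw [h1]
      · rintro u v rfl
        exact Quot.sound (Or.inl rfl)
    have h3 := hle σ
    rw [h2, hσ, one_mul, ← hσ]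
    omega
  · push Not at h1
    obtain ⟨x, hx⟩ := h1
    set σ' := σ * swap x (σ x) with hσ'
    have hc : cyc σ' = cyc σ + 1 := cyc_split hx.symm rfl
    have hc' := hle σ'
    have key := ih (Nat.card D - cyc σ') (by omega) σ' rfl
    have hστ : σ * τ = σ' * τ * swap (τ⁻¹ x) (τ⁻¹ (σ x)) := by
      ext u
      rw [mul_swap_apply]
      simp only [hσ', Perm.mul_apply, swap_apply_def, Perm.eq_inv_iff_eq]
      split_ifs <;> simp_all
    have hne : τ⁻¹ x ≠ τ⁻¹ (σ x) := fun h => hx (τ⁻¹.injective h).symm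
    have hσx : ∀ u, σ' u = if u = x then σ (σ x) else if u = σ x then σ x else σ u :=
      fun u => mul_swap_apply σ x (σ x) u
    have hold : ∀ u, Quot.mk (orbRel σ τ) (σ' u) = Quot.mk (orbRel σ τ) u := by
      intro u
      rw [hσx]
      split_ifs with h2 h3
      · rw [orbRel_fst, orbRel_fst, h2]
      · rw [h3]
      · rw [orbRel_fst]
    have hnew : ∀ s : D → D → Prop, (∀ u, Quot.mk s (σ' u) = Quot.mk s u) →
        Quot.mk s x = Quot.mk s (σ x) → ∀ u, Quot.mk s (σ u) = Quot.mk s u := by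
      intro s h2 h3 u
      by_cases h4 : u = x
      · rw [h4, h3]
      by_cases h5 : u = σ x
      · rw [h5, ← h3, ← h2 x, hσx, if_pos rfl]
      · rw [← h2 u, hσx, if_neg h4, if_neg h5]
    by_cases ho : Quot.mk (orbRel σ' τ) x = Quot.mk (orbRel σ' τ) (σ x)
    · have h2 : orb σ' τ = orb σ τ := by
        refine card_quot_eq_orb ?_ (hnew _ (orbRel_fst σ' τ) ho) (orbRel_snd σ' τ)
        rintro u v (rfl | rfl)
        · rw [orbRel_snd]
        · rw [hold]
      have h3 : cyc (σ * τ) ≤ cyc (σ' * τ) + 1 := by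
        by_cases h4 : cls (σ' * τ) (τ⁻¹ x) = cls (σ' * τ) (τ⁻¹ (σ x))
        · rw [hστ, cyc_mul_swap_of_eq hne h4]
        · have := cyc_mul_swap_of_ne h4
          rw [← hστ] at this
          omega
      omega
    · have h2 : orb σ' τ = orb σ τ + 1 := by
        rw [orb, card_quot_addPair ho, Nat.add_right_cancel_iff]
        refine card_quot_eq_orb ?_ (hnew _ ?_ (addPair_eq _ _ _)) ?_
        · rintro u v ((rfl | rfl) | ⟨rfl, rfl⟩)
          · rw [orbRel_snd]
          · rw [hold]
          · rw [orbRel_fst]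
        · exact fun u => addPair_of_eq _ _ (orbRel_fst σ' τ u)
        · exact fun u => addPair_of_eq _ _ (orbRel_snd σ' τ u)
      have h4 : cls (σ' * τ) (τ⁻¹ x) ≠ cls (σ' * τ) (τ⁻¹ (σ x)) := by
        intro h4
        apply ho
        have h5 := quot_map_eq (s := orbRel σ' τ) (by
          rintro u v rfl
          rw [Perm.mul_apply, orbRel_fst, orbRel_snd]) h4
        rw [← orbRel_snd σ' τ (τ⁻¹ x), ← orbRel_snd σ' τ (τ⁻¹ (σ x))] at h5
        simpa using h5
      have := cyc_mul_swap_of_ne h4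
      rw [← hστ] at this
      omega

end MatrixModel

namespace MatrixModel
open Equiv

/-! ### Bipartite maps with vertices of degree 2 and 4 -/

/-- A bipartite map, not necessarily connected, whose vertices have degree 4 or 2.  The half-edges
at a vertex of degree 4 have the same colour; a vertex of degree 2 has a white and a black
half-edge, so that it only marks a point of an edge. -/
structure BMap (D : Type*) where
  rot : Perm D
  edge : Perm D
  white : D → Prop
  rot_four : ∀ d, rot (rot (rot (rot d))) = d
  edge_edge : ∀ d, edge (edge d) = d
  white_edge : ∀ d, white (edge d) ↔ ¬ white d
  white_rot_of_ne : ∀ d, rot (rot d) ≠ d → (white (rot d) ↔ white d)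
  white_rot_of_eq : ∀ d, rot (rot d) = d → (white (rot d) ↔ ¬ white d)

namespace BMap

variable {D : Type*} (X : BMap D)

/-- The half-edge `d` is attached to a vertex of degree 4. -/
def Four (d : D) : Prop := X.rot (X.rot d) ≠ d

/-- Both half-edges are in the same connected component. -/
def Conn (x y : D) : Prop := Quot.mk (orbRel X.rot X.edge) x = Quot.mk (orbRel X.rot X.edge) y

variable {X}

theorem not_four {d : D} : ¬ X.Four d ↔ X.rot (X.rot d) = d := not_not

theorem four_rot {d : D} : X.Four (X.rot d) ↔ X.Four d := by
  unfold Four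
  rw [X.rot.injective.ne_iff]

theorem white_rot {d : D} (h : X.Four d) : X.white (X.rot d) ↔ X.white d := X.white_rot_of_ne d h

theorem white_rot' {d : D} (h : ¬ X.Four d) : X.white (X.rot d) ↔ ¬ X.white d :=
  X.white_rot_of_eq d (not_four.1 h)

theorem rot_ne (d : D) : X.rot d ≠ d := by
  intro h
  have := X.white_rot_of_eq d (by rw [h, h])
  rw [h] at this
  exact iff_not_self this

theorem edge_ne (d : D) : X.edge d ≠ d := by
  intro h
  have := X.white_edge d
  rw [h] at this
  exact iff_not_self this

theorem edge_eq_iff {x y : D} : X.edge x = y ↔ x = X.edge y :=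
  ⟨fun h => by rw [← h, X.edge_edge], fun h => by rw [h, X.edge_edge]⟩

theorem Conn.symm {x y : D} (h : X.Conn x y) : X.Conn y x := Eq.symm h

theorem Conn.trans {x y z : D} (h : X.Conn x y) (h' : X.Conn y z) : X.Conn x z := Eq.trans h h'

theorem conn_rot (x : D) : X.Conn (X.rot x) x := orbRel_fst X.rot X.edge x

theorem conn_edge (x : D) : X.Conn (X.edge x) x := orbRel_snd X.rot X.edge x

theorem Conn.invariant {P : D → Prop} (h₁ : ∀ u, P (X.rot u) ↔ P u) (h₂ : ∀ u, P (X.edge u) ↔ P u)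
    {u v : D} (h : X.Conn u v) : P u ↔ P v := orb_invariant h₁ h₂ h

/-- A set of half-edges that is mapped into itself by `rot` and `edge` is a union of components. -/
theorem Conn.mem_of_mapsTo {P : D → Prop} (h₁ : ∀ u, P u → P (X.rot u))
    (h₂ : ∀ u, P u → P (X.edge u)) {u v : D} (h : X.Conn u v) (hu : P u) : P v :=
  (h.invariant (P := P)
    (fun u => ⟨fun h => by have := h₁ _ (h₁ _ (h₁ _ h)); rwa [X.rot_four] at this, h₁ u⟩)
    (fun u => ⟨fun h => by have := h₂ _ h; rwa [X.edge_edge] at this, h₂ u⟩)).1 hu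

variable (X)

open Classical in
/-- The half-edge through which a straight path that enters a vertex through `d` leaves it. -/
noncomputable def opp : Perm D :=
  Function.Involutive.toPerm (fun d => if X.Four d then X.rot (X.rot d) else X.rot d) (by
    intro d
    by_cases h : X.Four d
    · have h' : X.Four (X.rot (X.rot d)) := four_rot.2 (four_rot.2 h)
      simp [h, h', X.rot_four]
    · have h' : ¬ X.Four (X.rot d) := fun h' => h (four_rot.1 h')
      simp [h, h', not_four.1 h])

variable {X}

theorem opp_of_four {d : D} (h : X.Four d) : X.opp d = X.rot (X.rot d) := by
  classical exact (if_pos h : (if X.Four d then X.rot (X.rot d) else X.rot d) = _)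

theorem opp_of_not_four {d : D} (h : ¬ X.Four d) : X.opp d = X.rot d := by
  classical exact (if_neg h : (if X.Four d then X.rot (X.rot d) else X.rot d) = _)

theorem opp_opp (d : D) : X.opp (X.opp d) = d := by
  unfold opp
  exact Function.Involutive.toPerm_involutive _ d

theorem opp_ne (d : D) : X.opp d ≠ d := by
  by_cases h : X.Four d
  · rw [opp_of_four h]; exact h
  · rw [opp_of_not_four h]; exact rot_ne d

theorem opp_congr {Y : BMap D} (h : Y.rot = X.rot) : Y.opp = X.opp := by
  ext d
  by_cases hd : X.Four d
  · have : Y.Four d := by unfold Four; rwa [h]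
    rw [opp_of_four hd, opp_of_four this, h]
  · have : ¬ Y.Four d := by unfold Four; rwa [h]
    rw [opp_of_not_four hd, opp_of_not_four this, h]

theorem four_congr {Y : BMap D} (h : Y.rot = X.rot) (d : D) : Y.Four d ↔ X.Four d := by
  unfold Four; rw [h]

variable (X)

/-- The combination `24 c + 12 V - 8 F - 8 φ` of the numbers of components, of vertices of degree 4,
of faces and of straight cycles.  It is additive over components, and equal to `8 g + 4 l` for a
connected map of genus `g` and grade `l`. -/
noncomputable def excess : ℤ :=
  24 * orb X.rot X.edge + 3 * Nat.card {d // X.Four d} - 8 * cyc (X.rot * X.edge)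
    - 8 * orb X.opp X.edge

/-- Every vertex of degree 2 forms a component on its own, with a single edge. -/
def Clean : Prop := ∀ d, ¬ X.Four d → X.edge d = X.rot d

open Classical in
/-- The contribution of one half-edge to the excess. -/
noncomputable def weight (d : D) : ℚ :=
  24 / (Nat.card {x // X.Conn x d} : ℚ) + (if X.Four d then 3 else 0)
    - 8 / (Nat.card {x // cls (X.rot * X.edge) x = cls (X.rot * X.edge) d} : ℚ)
    - 8 / (Nat.card {x // Quot.mk (orbRel X.opp X.edge) x = Quot.mk (orbRel X.opp X.edge) d} : ℚ)

theorem excess_eq_sum [Fintype D] : (X.excess : ℚ) = ∑ d, X.weight d := by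
  classical
  have h1 := card_quot_eq_sum (orbRel X.rot X.edge)
  have h2 := card_quot_eq_sum (fun x y => y = (X.rot * X.edge) x)
  have h3 := card_quot_eq_sum (orbRel X.opp X.edge)
  have h4 : (Nat.card {d // X.Four d} : ℚ) = ∑ d, if X.Four d then 1 else 0 := by
    rw [Nat.card_eq_fintype_card, Fintype.card_subtype, Finset.sum_boole]
  have h5 : (X.excess : ℚ) = 24 * (orb X.rot X.edge : ℚ) + 3 * (Nat.card {d // X.Four d} : ℚ)
      - 8 * (cyc (X.rot * X.edge) : ℚ) - 8 * (orb X.opp X.edge : ℚ) := by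
    unfold excess; push_cast; rfl
  rw [h5, orb, orb, cyc, h1, h2, h3, h4]
  unfold weight
  simp only [Finset.mul_sum, ← Finset.sum_add_distrib, ← Finset.sum_sub_distrib]
  refine Finset.sum_congr rfl fun d _ => ?_
  unfold Conn cls
  split_ifs <;> ring

variable {X}

theorem card_class_eq {r : D → D → Prop} {d : D} (s : Finset D)
    (h : ∀ x, Quot.mk r x = Quot.mk r d ↔ x ∈ s) :
    Nat.card {x // Quot.mk r x = Quot.mk r d} = s.card := by
  rw [Nat.card_congr (Equiv.subtypeEquivRight h), Nat.card_eq_fintype_card, Fintype.card_coe]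

theorem two_mul_cyc_edge [Finite D] : 2 * cyc X.edge = Nat.card D := by
  classical
  have : Fintype D := Fintype.ofFinite D
  have h := card_quot_eq_sum (fun x y => y = X.edge x)
  have h1 : ∀ d, Nat.card {x // Quot.mk (fun x y => y = X.edge x) x =
      Quot.mk (fun x y => y = X.edge x) d} = 2 := by
    intro d
    rw [card_class_eq {d, X.edge d}, Finset.card_pair (edge_ne d).symm]
    intro x
    constructor
    · intro hx
      refine (quot_invariant (P := fun u => u ∈ ({d, X.edge d} : Finset D)) ?_ hx).2 (by simp)
      rintro u v rfl
      simp only [Finset.mem_insert, Finset.mem_singleton, edge_eq_iff, X.edge_edge]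
      exact or_comm
    · intro hx
      simp only [Finset.mem_insert, Finset.mem_singleton] at hx
      rcases hx with rfl | rfl
      · rfl
      · exact cls_apply X.edge d
  simp only [h1, Finset.sum_const, Finset.card_univ, nsmul_eq_mul] at h
  change (cyc X.edge : ℚ) = _ at h
  have h2 : (2 * cyc X.edge : ℚ) = Nat.card D := by
    rw [h, Nat.card_eq_fintype_card]; push_cast; ring
  exact_mod_cast h2

theorem rot_inj {x y : D} : X.rot x = X.rot y ↔ x = y := X.rot.injective.eq_iff

theorem four_mul_cyc_rot [Finite D] :
    4 * cyc X.rot + Nat.card {d // X.Four d} = 2 * Nat.card D := by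
  classical
  have : Fintype D := Fintype.ofFinite D
  have h := card_quot_eq_sum (fun x y => y = X.rot x)
  have h1 : ∀ d, 1 / (Nat.card {x // Quot.mk (fun x y => y = X.rot x) x =
      Quot.mk (fun x y => y = X.rot x) d} : ℚ) = 1 / 2 - 1 / 4 * if X.Four d then 1 else 0 := by
    intro d
    have h2 : ∀ x, Quot.mk (fun x y => y = X.rot x) x = Quot.mk (fun x y => y = X.rot x) d ↔
        x ∈ ({d, X.rot d, X.rot (X.rot d), X.rot (X.rot (X.rot d))} : Finset D) := by
      intro x
      constructor
      · intro hx
        refine (quot_invariant (P := fun u => u ∈ ({d, X.rot d, X.rot (X.rot d),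
          X.rot (X.rot (X.rot d))} : Finset D)) ?_ hx).2 (by simp)
        rintro u v rfl
        simp only [Finset.mem_insert, Finset.mem_singleton, rot_inj]
        have : X.rot u = d ↔ u = X.rot (X.rot (X.rot d)) := by
          conv_lhs => rw [← X.rot_four d, rot_inj]
        tauto
      · intro hx
        simp only [Finset.mem_insert, Finset.mem_singleton] at hx
        have := cls_apply X.rot
        rcases hx with rfl | rfl | rfl | rfl
        · rfl
        · exact this d
        · exact (this _).trans (this d)
        · exact (this _).trans ((this _).trans (this d))
    rw [card_class_eq _ h2]
    have hr := X.rot_ne d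
    by_cases hd : X.Four d
    · have hd' := hd
      unfold Four at hd'
      have h3 : X.rot (X.rot (X.rot d)) ≠ d := by
        intro h
        apply hr
        have := X.rot_four d
        rwa [h] at this
      rw [Finset.card_insert_of_notMem, Finset.card_insert_of_notMem, Finset.card_pair]
      · simp [hd]; norm_num
      · simp only [ne_eq, rot_inj]; exact hr.symm
      · simp only [Finset.mem_insert, Finset.mem_singleton, rot_inj, not_or]
        exact ⟨hr.symm, hd'.symm⟩
      · simp only [Finset.mem_insert, Finset.mem_singleton, not_or]
        exact ⟨hr.symm, hd'.symm, h3.symm⟩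
    · rw [not_four.1 hd]
      have : ({d, X.rot d, d, X.rot d} : Finset D) = {d, X.rot d} := by
        ext; simp
      rw [this, Finset.card_pair hr.symm]
      simp [hd]
  simp only [h1, Finset.sum_sub_distrib, ← Finset.mul_sum, Finset.sum_const, Finset.card_univ,
    nsmul_eq_mul, Finset.sum_boole] at h
  change (cyc X.rot : ℚ) = _ at h
  have h2 : (4 * cyc X.rot + Nat.card {d // X.Four d} : ℚ) = 2 * Nat.card D := by
    rw [h, Nat.card_eq_fintype_card, Nat.card_eq_fintype_card, Fintype.card_subtype]; ring
  exact_mod_cast h2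

/-- The genus is nonnegative: four times Euler's formula, with the numbers of edges and of vertices
expressed through the numbers of half-edges. -/
theorem four_mul_cyc_le [Finite D] :
    4 * cyc (X.rot * X.edge) ≤ 8 * orb X.rot X.edge + Nat.card {d // X.Four d} := by
  have h1 := cyc_add_cyc_add_cyc_le X.rot X.edge
  have h2 := X.two_mul_cyc_edge
  have h3 := X.four_mul_cyc_rot
  omega

/-- A pair of points exchanged by a permutation is invariant. -/
theorem perm_pair_iff {D : Type*} {g : Perm D} {a d : D} (ga : g a = d) (gd : g d = a) {u : D} :
    (g u = a ∨ g u = d) ↔ (u = a ∨ u = d) := by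
  have h1 : g u = a ↔ u = d := by rw [← gd, g.injective.eq_iff]
  have h2 : g u = d ↔ u = a := by rw [← ga, g.injective.eq_iff]
  rw [h1, h2, or_comm]

/-! ### Forgetting vertices of degree 2 -/

/-- A vertex of degree 2 can be removed from its edge: its two half-edges are connected into a
separate ring, and the half-edges they were connected to form an edge. -/
theorem exists_forget [Finite D] (X : BMap D) {a d : D} (ha : ¬ X.Four a) (had : X.rot a = d)
    (hne : X.edge a ≠ d) :
    ∃ Y : BMap D, Y.rot = X.rot ∧ Y.white = X.white ∧ Y.excess = X.excess ∧
      Y.edge a = d ∧ Y.edge d = a ∧ Y.edge (X.edge a) = X.edge d ∧ Y.edge (X.edge d) = X.edge a ∧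
      (∀ u, u ≠ a → u ≠ d → u ≠ X.edge a → u ≠ X.edge d → Y.edge u = X.edge u) ∧
      ∀ u v, u ≠ a → u ≠ d → v ≠ a → v ≠ d → (Y.Conn u v ↔ X.Conn u v) := by
  classical
  have hda : X.rot d = a := by rw [← had]; exact not_four.1 ha
  have hd : ¬ X.Four d := by rw [← had, four_rot]; exact ha
  have n1 : a ≠ d := by rw [← had]; exact (rot_ne a).symm
  have n2 : X.edge a ≠ a := edge_ne a
  have n3 : X.edge d ≠ d := edge_ne d
  have n4 : X.edge d ≠ a := by rw [Ne, edge_eq_iff]; exact hne.symm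
  have n5 : X.edge a ≠ X.edge d := X.edge.injective.ne n1
  obtain ⟨ε, hε⟩ : ∃ ε : Perm D, ε = X.edge * swap a (X.edge d) * swap (X.edge a) d := ⟨_, rfl⟩
  have e : ∀ u, ε u = if u = a then d else if u = d then a else if u = X.edge a then X.edge d
        else if u = X.edge d then X.edge a else X.edge u := by
    intro u
    have s1 : (X.edge * swap a (X.edge d)) d = X.edge d := by
      rw [mul_swap_apply, if_neg n1.symm, if_neg n3.symm]
    have s2 : (X.edge * swap a (X.edge d)) (X.edge a) = a := by
      rw [mul_swap_apply, if_neg n2, if_neg n5, X.edge_edge]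
    rw [hε, mul_swap_apply, s1, s2, mul_swap_apply, X.edge_edge]
    by_cases h1 : u = a
    · subst h1; simp [n2.symm, n1]
    by_cases h2 : u = d
    · subst h2; simp [n1.symm, hne.symm]
    simp [h1, h2]
  have ea : ε a = d := by rw [e, if_pos rfl]
  have ed : ε d = a := by rw [e, if_neg n1.symm, if_pos rfl]
  have ex : ε (X.edge a) = X.edge d := by rw [e, if_neg n2, if_neg hne, if_pos rfl]
  have ey : ε (X.edge d) = X.edge a := by
    rw [e, if_neg n4, if_neg n3, if_neg n5.symm, if_pos rfl]
  have eu : ∀ u, u ≠ a → u ≠ d → u ≠ X.edge a → u ≠ X.edge d → ε u = X.edge u := by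
    intro u h1 h2 h3 h4
    rw [e, if_neg h1, if_neg h2, if_neg h3, if_neg h4]
  have hw : X.white d ↔ ¬ X.white a := by rw [← had, white_rot' ha]
  let Y : BMap D :=
    { rot := X.rot
      edge := ε
      white := X.white
      rot_four := X.rot_four
      edge_edge := by
        intro u
        by_cases h1 : u = a
        · rw [h1, ea, ed]
        by_cases h2 : u = d
        · rw [h2, ed, ea]
        by_cases h3 : u = X.edge a
        · rw [h3, ex, ey]
        by_cases h4 : u = X.edge d
        · rw [h4, ey, ex]
        rw [eu u h1 h2 h3 h4, eu, X.edge_edge]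
        · rwa [Ne, edge_eq_iff]
        · rwa [Ne, edge_eq_iff]
        · exact X.edge.injective.ne h1
        · exact X.edge.injective.ne h2
      white_edge := by
        intro u
        rw [e]
        have h1 := X.white_edge a
        have h2 := X.white_edge d
        split_ifs with h3 h4 h5 h6
        · rw [h3, hw]
        · rw [h4, hw, not_not]
        · rw [h5, h2, h1, hw]
        · rw [h6, h2, h1, hw]; tauto
        · exact X.white_edge u
      white_rot_of_ne := X.white_rot_of_ne
      white_rot_of_eq := X.white_rot_of_eq }
  have hYe : Y.edge = ε := rfl
  rw [← hYe] at e ea ed ex ey eu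
  have hYr : Y.rot = X.rot := rfl
  -- the same computation counts components (`g = rot`) and straight cycles (`g = opp`)
  have horb : ∀ g : Perm D, g a = d → g d = a → orb g Y.edge = orb g X.edge + 1 := by
    intro g ga gd
    have hg := fun u => perm_pair_iff ga gd (u := u)
    have hsep : Quot.mk (orbRel g Y.edge) a ≠ Quot.mk (orbRel g Y.edge) (X.edge a) := by
      intro h
      have := (orb_invariant (P := fun u => u = a ∨ u = d) hg
        (fun u => perm_pair_iff ea ed) h).1 (Or.inl rfl)
      rcases this with h | h
      · exact n2 h
      · exact hne h
    rw [orb, card_quot_addPair hsep, Nat.add_right_cancel_iff]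
    have q1 := addPair_eq (orbRel g Y.edge) a (X.edge a)
    have q2 : ∀ u, Quot.mk (addPair (orbRel g Y.edge) a (X.edge a)) (Y.edge u) = Quot.mk _ u :=
      fun u => addPair_of_eq _ _ (orbRel_snd g Y.edge u)
    have q3 : ∀ u, Quot.mk (addPair (orbRel g Y.edge) a (X.edge a)) (g u) = Quot.mk _ u :=
      fun u => addPair_of_eq _ _ (orbRel_fst g Y.edge u)
    have q4 := q2 a
    rw [ea] at q4
    have q5 := q2 (X.edge a)
    rw [ex] at q5
    have r1 := orbRel_snd g X.edge
    have r2 := orbRel_fst g X.edge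
    have r3 := r2 a
    rw [ga] at r3
    refine card_quot_eq_orb ?_ q3 ?_
    · rintro u v ((rfl | rfl) | ⟨rfl, rfl⟩)
      · rw [e]
        split_ifs with h1 h2 h3 h4
        · rw [h1, r3]
        · rw [h2, r3]
        · rw [h3, r1, r1, r3]
        · rw [h4, r1, r1, r3]
        · rw [r1]
      · rw [r2]
      · rw [r1]
    · intro u
      by_cases h1 : u = a
      · rw [h1, q1]
      by_cases h2 : u = d
      · rw [h2, q5, q4, q1]
      by_cases h3 : u = X.edge a
      · rw [h3, X.edge_edge, q1]
      by_cases h4 : u = X.edge d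
      · rw [h4, X.edge_edge, q5, ← q1, q4]
      rw [← eu u h1 h2 h3 h4, q2]
  have hc := horb X.rot had hda
  have hφ := horb X.opp (by rw [opp_of_not_four ha, had]) (by rw [opp_of_not_four hd, hda])
  -- the half-edges `a` and `d` are cut out of their faces
  have hF : cyc (X.rot * Y.edge) = cyc (X.rot * X.edge) + 2 := by
    change cyc (X.rot * ε) = _
    rw [hε]
    rw [← mul_assoc, ← mul_assoc, swap_comm a, cyc_split hne, cyc_split n4]
    · rw [Perm.mul_apply, X.edge_edge, hda]
    · rw [mul_swap_apply, if_neg n5, if_neg n2, Perm.mul_apply, X.edge_edge, had]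
  refine ⟨Y, rfl, rfl, ?_, ea, ed, ex, ey, eu, ?_⟩
  · have h4 : Nat.card {d // Y.Four d} = Nat.card {d // X.Four d} := rfl
    have h5 : Y.rot = X.rot := rfl
    unfold excess
    rw [h4, h5, opp_congr h5, hc, hφ, hF]
    push_cast
    ring
  · intro u v u1 u2 v1 v2
    constructor
    · refine orb_map_eq (s := orbRel X.rot X.edge) (fun u => conn_rot (X := X) u) fun u => ?_
      have r3 := X.conn_rot a
      rw [had] at r3
      have r1 := X.conn_edge
      unfold Conn at r1 r3
      rw [e]
      split_ifs with h1 h2 h3 h4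
      · rw [h1, r3]
      · rw [h2, r3]
      · rw [h3, r1, r1, r3]
      · rw [h4, r1, r1, r3]
      · rw [r1]
    · intro h
      -- send the two half-edges of the forgotten vertex to the neighbouring half-edge
      let k : D → Quot (orbRel Y.rot Y.edge) := fun u =>
        if u = a ∨ u = d then Quot.mk _ (X.edge a) else Quot.mk _ u
      have hk : ∀ u v, orbRel X.rot X.edge u v → k u = k v := by
        have h6 : X.edge d ≠ d := n3
        rintro u v (rfl | rfl)
        · by_cases h1 : u = a
          · simp [k, h1]
          by_cases h2 : u = d
          · simp only [k, h2, or_true, if_true, n4, n3, or_self, if_false]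
            rw [← ex]; exact (conn_edge (X := Y) (X.edge a)).symm
          by_cases h3 : u = X.edge a
          · simp [k, h3, X.edge_edge]
          by_cases h4 : u = X.edge d
          · simp only [k, h4, X.edge_edge, or_true, if_true, n4, n3, or_self, if_false]
            rw [← ex]; exact (conn_edge (X := Y) (X.edge a))
          have h5 : X.edge u ≠ a := by rwa [Ne, edge_eq_iff]
          have h7 : X.edge u ≠ d := by rwa [Ne, edge_eq_iff]
          simp only [k, h1, h2, h5, h7, or_self, if_false]
          rw [← eu u h1 h2 h3 h4]; exact (conn_edge (X := Y) u).symm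
        · have := perm_pair_iff had hda (u := u)
          simp only [k, this]
          split_ifs
          · rfl
          · exact (conn_rot (X := Y) u).symm
      have := congrArg (Quot.lift k hk) h
      change k u = k v at this
      simp only [k, u1, u2, v1, v2, or_self, if_false] at this
      exact this

/-- All vertices of degree 2 can be forgotten.  Edges without vertices of degree 2 stay as they are,
and so do the components that are not rings. -/
theorem exists_clean [Finite D] (X : BMap D) :
    ∃ Y : BMap D, Y.Clean ∧ Y.rot = X.rot ∧ Y.white = X.white ∧ Y.excess = X.excess ∧
      (∀ u, X.Four u → X.Four (X.edge u) → Y.edge u = X.edge u) ∧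
      ∀ u v, X.Four u → X.Four v → (Y.Conn u v ↔ X.Conn u v) := by
  induction hn : Nat.card {d // ¬ X.Four d ∧ X.edge d ≠ X.rot d} using Nat.strong_induction_on
    generalizing X with
  | _ n ih =>
  by_cases hX : X.Clean
  · exact ⟨X, hX, rfl, rfl, rfl, fun _ _ _ => rfl, fun _ _ _ _ => Iff.rfl⟩
  · unfold Clean at hX
    push Not at hX
    obtain ⟨a, ha, hne⟩ := hX
    obtain ⟨Y, h1, h2, h3, h4, h5, h6, h7, h8, h9⟩ := exists_forget X ha rfl hne
    have hF := four_congr (X := X) h1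
    have hda : X.rot (X.rot a) = a := not_four.1 ha
    have hd : ¬ X.Four (X.rot a) := by rw [four_rot]; exact ha
    have hsub : {d | ¬ Y.Four d ∧ Y.edge d ≠ Y.rot d} ⊂ {d | ¬ X.Four d ∧ X.edge d ≠ X.rot d} := by
      refine ⟨?_, fun h => ?_⟩
      · rintro u ⟨hu1, hu2⟩
        rw [hF] at hu1
        rw [h1] at hu2
        refine ⟨hu1, ?_⟩
        by_cases g1 : u = a
        · rw [g1]; exact hne
        by_cases g2 : u = X.rot a
        · subst g2; rw [h5] at hu2; exact (hu2 hda.symm).elim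
        by_cases g3 : u = X.edge a
        · rw [g3, X.edge_edge]
          intro h
          apply hne
          rw [← rot_inj (X := X), ← h, hda]
        by_cases g4 : u = X.edge (X.rot a)
        · rw [g4, X.edge_edge, Ne, rot_inj, ← edge_eq_iff]
          exact hne
        rwa [← h8 u g1 g2 g3 g4]
      · have := h (show a ∈ _ from ⟨ha, hne⟩)
        exact this.2 (by rw [h4, h1])
    have hlt : Nat.card {d // ¬ Y.Four d ∧ Y.edge d ≠ Y.rot d} < n := by
      rw [← hn]
      exact Set.ncard_lt_ncard hsub (Set.toFinite _)
    obtain ⟨Z, k1, k2, k3, k4, k5, k6⟩ := ih _ hlt Y rfl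
    refine ⟨Z, k1, k2.trans h1, k3.trans h2, k4.trans h3, ?_, ?_⟩
    · intro u hu hu'
      have : Y.edge u = X.edge u := by
        refine h8 u ?_ ?_ ?_ ?_
        · rintro rfl; exact ha hu
        · rintro rfl; exact hd hu
        · rintro rfl; rw [X.edge_edge] at hu'; exact ha hu'
        · rintro rfl; rw [X.edge_edge] at hu'; exact hd hu'
      rw [k5 u ((hF u).2 hu) (by rw [this]; exact (hF _).2 hu'), this]
    · intro u v hu hv
      rw [k6 u v ((hF u).2 hu) ((hF v).2 hv)]
      refine h9 u v ?_ ?_ ?_ ?_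
      · rintro rfl; exact ha hu
      · rintro rfl; exact hd hu
      · rintro rfl; exact ha hv
      · rintro rfl; exact hd hv

end BMap
end MatrixModel

namespace MatrixModel
open Equiv

/-! ### Products of transpositions -/

theorem swap_mul_edge {D : Type*} [DecidableEq D] (X : BMap D) (x y : D) :
    swap x y * X.edge = X.edge * swap (X.edge x) (X.edge y) := by
  ext u
  simp only [Perm.mul_apply, swap_apply_def, BMap.edge_eq_iff]
  split_ifs <;> simp [X.edge_edge]

theorem swaps_mul_edge {D : Type*} [DecidableEq D] (X : BMap D) (σ : Perm D)
    (x₁ y₁ x₂ y₂ x₃ y₃ x₄ y₄ : D) :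
    σ * swap x₁ y₁ * swap x₂ y₂ * swap x₃ y₃ * swap x₄ y₄ * X.edge =
      σ * X.edge * swap (X.edge x₁) (X.edge y₁) * swap (X.edge x₂) (X.edge y₂) *
        swap (X.edge x₃) (X.edge y₃) * swap (X.edge x₄) (X.edge y₄) := by
  rw [mul_assoc _ _ X.edge, swap_mul_edge, ← mul_assoc, mul_assoc _ _ X.edge, swap_mul_edge,
    ← mul_assoc, mul_assoc _ _ X.edge, swap_mul_edge, ← mul_assoc, mul_assoc _ _ X.edge,
    swap_mul_edge, ← mul_assoc]

theorem mul_swaps_apply {D : Type*} [DecidableEq D] (σ : Perm D) {x₁ y₁ x₂ y₂ x₃ y₃ x₄ y₄ : D}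
    (h : [x₁, y₁, x₂, y₂, x₃, y₃, x₄, y₄].Nodup) :
    let ρ := σ * swap x₁ y₁ * swap x₂ y₂ * swap x₃ y₃ * swap x₄ y₄
    (ρ x₁ = σ y₁ ∧ ρ y₁ = σ x₁ ∧ ρ x₂ = σ y₂ ∧ ρ y₂ = σ x₂ ∧ ρ x₃ = σ y₃ ∧ ρ y₃ = σ x₃ ∧
      ρ x₄ = σ y₄ ∧ ρ y₄ = σ x₄) ∧
    ∀ u, u ∉ ({x₁, y₁, x₂, y₂, x₃, y₃, x₄, y₄} : Set D) → ρ u = σ u := by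
  simp only [List.nodup_cons, List.mem_cons, not_or, List.not_mem_nil, not_false_eq_true] at h
  refine ⟨⟨?_, ?_, ?_, ?_, ?_, ?_, ?_, ?_⟩, fun u hu => ?_⟩
  all_goals
    try simp only [Set.mem_insert_iff, Set.mem_singleton_iff, not_or] at hu
    simp only [mul_swap_apply]
    grind

theorem cyc_split₃ {D : Type*} [Finite D] [DecidableEq D] (σ : Perm D) {x₁ y₁ x₂ y₂ x₃ y₃ : D}
    (h : [x₁, y₁, x₂, y₂, x₃, y₃].Nodup) (h₁ : σ x₁ = y₁) (h₂ : σ x₂ = y₂) (h₃ : σ x₃ = y₃) :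
    cyc (σ * swap x₁ y₁ * swap x₂ y₂ * swap x₃ y₃) = cyc σ + 3 := by
  simp only [List.nodup_cons, List.mem_cons, not_or, List.not_mem_nil, not_false_eq_true] at h
  rw [cyc_split, cyc_split, cyc_split]
  all_goals
    try simp only [mul_swap_apply]
    grind

theorem cyc_split₄ {D : Type*} [Finite D] [DecidableEq D] (σ : Perm D)
    {x₁ y₁ x₂ y₂ x₃ y₃ x₄ y₄ : D} (h : [x₁, y₁, x₂, y₂, x₃, y₃, x₄, y₄].Nodup)
    (h₁ : σ x₁ = y₁) (h₂ : σ x₂ = y₂) (h₃ : σ x₃ = y₃) (h₄ : σ x₄ = y₄) :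
    cyc (σ * swap x₁ y₁ * swap x₂ y₂ * swap x₃ y₃ * swap x₄ y₄) = cyc σ + 4 := by
  simp only [List.nodup_cons, List.mem_cons, not_or, List.not_mem_nil, not_false_eq_true] at h
  rw [cyc_split, cyc_split₃ σ _ h₁ h₂ h₃]
  all_goals
    try simp only [List.nodup_cons, List.mem_cons, not_or, List.not_mem_nil, not_false_eq_true]
    try simp only [mul_swap_apply]
    grind

namespace BMap

/-! ### Dipoles and their removal -/

/-- A dipole with names for the eight half-edges at its white vertex (`p`, `q`, `a`, `b`) and at its
black vertex (`p'`, `q'`, `c`, `d`): the inner edges are `p p'` and `q q'`, and the two sides are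
`a, d` and `b, c`.  The two inner edges bound a face (first shape) or form a straight cycle (second
shape).  No vertex of degree 2 lies on the inner edges. -/
structure Dip {D : Type*} (X : BMap D) where
  (p q a b p' q' c d : D)
  white_p : X.white p
  four_p : X.Four p
  four_p' : X.Four p'
  edge_p : X.edge p = p'
  edge_q : X.edge q = q'
  shape :
    (X.rot p = q ∧ X.rot q = a ∧ X.rot a = b ∧ X.rot b = p ∧
      X.rot q' = p' ∧ X.rot p' = c ∧ X.rot c = d ∧ X.rot d = q') ∨
    (X.rot p = a ∧ X.rot a = q ∧ X.rot q = b ∧ X.rot b = p ∧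
      X.rot p' = c ∧ X.rot c = q' ∧ X.rot q' = d ∧ X.rot d = p')

namespace Dip

variable {D : Type*} {X : BMap D} (δ : X.Dip)

/-- The half-edges at the two vertices of the dipole. -/
def darts : Set D := {δ.p, δ.q, δ.a, δ.b, δ.p', δ.q', δ.c, δ.d}

theorem mem_darts {u : D} : u ∈ δ.darts ↔ u = δ.p ∨ u = δ.q ∨ u = δ.a ∨ u = δ.b ∨ u = δ.p' ∨
    u = δ.q' ∨ u = δ.c ∨ u = δ.d := by
  simp [darts]

theorem not_white_p' : ¬ X.white δ.p' := by
  rw [← δ.edge_p, X.white_edge, not_not]; exact δ.white_p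

theorem whites : X.white δ.p ∧ X.white δ.q ∧ X.white δ.a ∧ X.white δ.b := by
  have h := δ.white_p
  have f := δ.four_p
  have h1 : X.white (X.rot δ.p) := (white_rot f).2 h
  have f1 : X.Four (X.rot δ.p) := four_rot.2 f
  have h2 : X.white (X.rot (X.rot δ.p)) := (white_rot f1).2 h1
  have f2 := four_rot.2 f1
  have h3 : X.white (X.rot (X.rot (X.rot δ.p))) := (white_rot f2).2 h2
  rcases δ.shape with ⟨e1, e2, e3, -⟩ | ⟨e1, e2, e3, -⟩ <;> rw [e1] at h1 h2 h3 <;>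
    rw [e2] at h2 h3 <;> rw [e3] at h3 <;> simp [*]

theorem blacks : ¬ X.white δ.p' ∧ ¬ X.white δ.q' ∧ ¬ X.white δ.c ∧ ¬ X.white δ.d := by
  have h := δ.not_white_p'
  have f := δ.four_p'
  have h1 : ¬ X.white (X.rot δ.p') := fun h' => h ((white_rot f).1 h')
  have f1 : X.Four (X.rot δ.p') := four_rot.2 f
  have h2 : ¬ X.white (X.rot (X.rot δ.p')) := fun h' => h1 ((white_rot f1).1 h')
  have f2 := four_rot.2 f1
  have h3 : ¬ X.white (X.rot (X.rot (X.rot δ.p'))) := fun h' => h2 ((white_rot f2).1 h')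
  rcases δ.shape with ⟨-, -, -, -, e4, e1, e2, e3⟩ | ⟨-, -, -, -, e1, e2, e3, -⟩ <;>
    rw [e1] at h1 h2 h3 <;> rw [e2] at h2 h3 <;> rw [e3] at h3 <;> simp [*]

theorem fours {u : D} (hu : u ∈ δ.darts) : X.Four u := by
  have f := δ.four_p
  have f1 := four_rot.2 f
  have f2 := four_rot.2 f1
  have f3 := four_rot.2 f2
  have g := δ.four_p'
  have g1 := four_rot.2 g
  have g2 := four_rot.2 g1
  have g3 := four_rot.2 g2
  rw [mem_darts] at hu
  rcases δ.shape with ⟨e1, e2, e3, -, e4, e5, e6, e7⟩ | ⟨e1, e2, e3, -, e5, e6, e7, e8⟩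
  · rw [e1] at f1 f2 f3; rw [e2] at f2 f3; rw [e3] at f3
    rw [e5] at g1 g2 g3; rw [e6] at g2 g3; rw [e7] at g3
    rcases hu with rfl | rfl | rfl | rfl | rfl | rfl | rfl | rfl <;> assumption
  · rw [e1] at f1 f2 f3; rw [e2] at f2 f3; rw [e3] at f3
    rw [e5] at g1 g2 g3; rw [e6] at g2 g3; rw [e7] at g3
    rcases hu with rfl | rfl | rfl | rfl | rfl | rfl | rfl | rfl <;> assumption

theorem nodup_cycle {x y z w : D} (h : X.Four x) (h1 : X.rot x = y) (h2 : X.rot y = z)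
    (h3 : X.rot z = w) : x ≠ y ∧ x ≠ z ∧ x ≠ w ∧ y ≠ z ∧ y ≠ w ∧ z ≠ w := by
  subst h1 h2 h3
  refine ⟨(rot_ne _).symm, Ne.symm h, fun h' => ?_, (rot_ne _).symm,
    Ne.symm (four_rot.2 h), (rot_ne _).symm⟩
  have := X.rot_four x
  rw [← h'] at this
  exact rot_ne _ this

theorem nodup : [δ.p, δ.q, δ.a, δ.b, δ.p', δ.q', δ.c, δ.d].Nodup := by
  obtain ⟨w1, w2, w3, w4⟩ := δ.whites
  obtain ⟨b1, b2, b3, b4⟩ := δ.blacks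
  have hwb : ∀ {u v}, X.white u → ¬ X.white v → u ≠ v := by rintro u v hu hv rfl; exact hv hu
  have h1 : δ.p ≠ δ.q ∧ δ.p ≠ δ.a ∧ δ.p ≠ δ.b ∧ δ.q ≠ δ.a ∧ δ.q ≠ δ.b ∧ δ.a ≠ δ.b := by
    rcases δ.shape with ⟨e1, e2, e3, -⟩ | ⟨e1, e2, e3, -⟩
    · exact nodup_cycle δ.four_p e1 e2 e3
    · obtain ⟨h1, h2, h3, h4, h5, h6⟩ := nodup_cycle δ.four_p e1 e2 e3
      exact ⟨h2, h1, h3, h4.symm, h6, h5⟩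
  have h2 : δ.p' ≠ δ.q' ∧ δ.p' ≠ δ.c ∧ δ.p' ≠ δ.d ∧ δ.q' ≠ δ.c ∧ δ.q' ≠ δ.d ∧ δ.c ≠ δ.d := by
    rcases δ.shape with ⟨-, -, -, -, e0, e1, e2, e3⟩ | ⟨-, -, -, -, e1, e2, e3, -⟩
    · obtain ⟨h1, h2, h3, h4, h5, h6⟩ := nodup_cycle δ.four_p' e1 e2 e3
      exact ⟨h3, h1, h2, h5.symm, h6.symm, h4⟩
    · obtain ⟨h1, h2, h3, h4, h5, h6⟩ := nodup_cycle δ.four_p' e1 e2 e3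
      exact ⟨h2, h1, h3, h4.symm, h6, h5⟩
  have := @hwb
  simp only [List.nodup_cons, List.mem_cons, not_or, List.not_mem_nil, not_false_eq_true,
    List.nodup_nil, and_true]
  exact ⟨⟨h1.1, h1.2.1, h1.2.2.1, hwb w1 b1, hwb w1 b2, hwb w1 b3, hwb w1 b4⟩,
    ⟨h1.2.2.2.1, h1.2.2.2.2.1, hwb w2 b1, hwb w2 b2, hwb w2 b3, hwb w2 b4⟩,
    ⟨h1.2.2.2.2.2, hwb w3 b1, hwb w3 b2, hwb w3 b3, hwb w3 b4⟩,
    ⟨hwb w4 b1, hwb w4 b2, hwb w4 b3, hwb w4 b4⟩, ⟨h2.1, h2.2.1, h2.2.2.1⟩,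
    ⟨h2.2.2.2.1, h2.2.2.2.2.1⟩, h2.2.2.2.2.2⟩

theorem edge_p' : X.edge δ.p' = δ.p := by rw [← δ.edge_p, X.edge_edge]

theorem edge_q' : X.edge δ.q' = δ.q := by rw [← δ.edge_q, X.edge_edge]

theorem rot_mem {u : D} : X.rot u ∈ δ.darts ↔ u ∈ δ.darts := by
  have key : ∀ u, u ∈ δ.darts → X.rot u ∈ δ.darts := by
    intro u hu
    rw [mem_darts] at hu ⊢
    rcases δ.shape with ⟨e1, e2, e3, e4, e5, e6, e7, e8⟩ | ⟨e1, e2, e3, e4, e5, e6, e7, e8⟩ <;>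
      rcases hu with rfl | rfl | rfl | rfl | rfl | rfl | rfl | rfl <;> simp [*]
  exact ⟨fun h => by have := key _ (key _ (key _ h)); rwa [X.rot_four] at this, key u⟩

/-- The rotation after the removal of a dipole is obtained by composing with four transpositions, each
of which adds a face.  The only exception is the last one at a face of length 2: it may join two
faces, but then the two sides are connected after the removal. -/
theorem exists_rot [Finite D] : ∃ ρ : Perm D, ρ δ.a = δ.d ∧ ρ δ.d = δ.a ∧ ρ δ.b = δ.c ∧
    ρ δ.c = δ.b ∧ ρ δ.p = δ.p' ∧ ρ δ.p' = δ.p ∧ ρ δ.q = δ.q' ∧ ρ δ.q' = δ.q ∧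
    (∀ u, u ∉ δ.darts → ρ u = X.rot u) ∧
    (X.rot δ.p = δ.q ∧ (cyc (ρ * X.edge) = cyc (X.rot * X.edge) + 4 ∨
        cyc (ρ * X.edge) = cyc (X.rot * X.edge) + 2 ∧
          cls (ρ * X.edge) (X.edge δ.a) = cls (ρ * X.edge) (X.edge δ.c)) ∨
      X.rot δ.p = δ.a ∧ cyc (ρ * X.edge) = cyc (X.rot * X.edge) + 4) := by
  classical
  have hnd := δ.nodup
  have hp := δ.edge_p
  have hq := δ.edge_q
  have hp' := δ.edge_p'
  have hq' := δ.edge_q'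
  rcases δ.shape with ⟨e1, e2, e3, e4, e5, e6, e7, e8⟩ | ⟨e1, e2, e3, e4, e5, e6, e7, e8⟩
  · have hl : [δ.d, δ.q, δ.b, δ.p', δ.p, δ.q', δ.a, δ.c].Nodup := by
      simp only [List.nodup_cons, List.mem_cons, not_or, List.not_mem_nil, not_false_eq_true]
        at hnd ⊢
      grind
    obtain ⟨⟨k1, k2, k3, k4, k5, k6, k7, k8⟩, k⟩ := mul_swaps_apply X.rot hl
    refine ⟨_, k7.trans e7, k1.trans e2, k3.trans e6, k8.trans e3, k5.trans e5, k4.trans e4,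
      k2.trans e8, k6.trans e1, fun u hu => k u fun hu' => hu ?_, Or.inl ⟨e1, ?_⟩⟩
    · rw [mem_darts]
      simp only [Set.mem_insert_iff, Set.mem_singleton_iff] at hu'
      tauto
    · have hl' := hl.map X.edge.injective
      simp only [List.map_cons, List.map_nil, hp, hq, hp', hq'] at hl'
      rw [show X.rot * swap δ.d δ.q * swap δ.b δ.p' * swap δ.p δ.q' * swap δ.a δ.c * X.edge =
        X.rot * X.edge * swap (X.edge δ.d) δ.q' * swap (X.edge δ.b) δ.p * swap δ.p' δ.q *
          swap (X.edge δ.a) (X.edge δ.c) by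
          rw [swaps_mul_edge, hp, hq, hp', hq']]
      have h3 := cyc_split₃ (X.rot * X.edge) (x₁ := X.edge δ.d) (y₁ := δ.q') (x₂ := X.edge δ.b)
        (y₂ := δ.p) (x₃ := δ.p') (y₃ := δ.q)
        (hl'.sublist (by simp)) (by rw [Perm.mul_apply, X.edge_edge, e8])
        (by rw [Perm.mul_apply, X.edge_edge, e4]) (by rw [Perm.mul_apply, hp', e1])
      by_cases hcl : cls (X.rot * X.edge * swap (X.edge δ.d) δ.q' * swap (X.edge δ.b) δ.p *
          swap δ.p' δ.q) (X.edge δ.a) = cls (X.rot * X.edge * swap (X.edge δ.d) δ.q' *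
          swap (X.edge δ.b) δ.p * swap δ.p' δ.q) (X.edge δ.c)
      · left
        rw [cyc_mul_swap_of_eq _ hcl]
        · omega
        · intro h
          simp only [List.nodup_cons, List.mem_cons] at hl'
          tauto
      · right
        have := cyc_mul_swap_of_ne hcl
        exact ⟨by omega, cls_mul_swap hcl⟩
  · have hl : [δ.a, δ.q', δ.d, δ.p, δ.b, δ.p', δ.c, δ.q].Nodup := by
      simp only [List.nodup_cons, List.mem_cons, not_or, List.not_mem_nil, not_false_eq_true]
        at hnd ⊢
      grind
    obtain ⟨⟨k1, k2, k3, k4, k5, k6, k7, k8⟩, k⟩ := mul_swaps_apply X.rot hl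
    refine ⟨_, k1.trans e7, k3.trans e1, k5.trans e5, k7.trans e3, k4.trans e8, k6.trans e4,
      k8.trans e6, k2.trans e2, fun u hu => k u fun hu' => hu ?_, Or.inr ⟨e1, ?_⟩⟩
    · rw [mem_darts]
      simp only [Set.mem_insert_iff, Set.mem_singleton_iff] at hu'
      tauto
    · have hl' := hl.map X.edge.injective
      simp only [List.map_cons, List.map_nil, hp, hq, hp', hq'] at hl'
      rw [show X.rot * swap δ.a δ.q' * swap δ.d δ.p * swap δ.b δ.p' * swap δ.c δ.q * X.edge =
        X.rot * X.edge * swap (X.edge δ.a) δ.q * swap (X.edge δ.d) δ.p' * swap (X.edge δ.b) δ.p *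
          swap (X.edge δ.c) δ.q' by
          rw [swaps_mul_edge, hp, hq, hp', hq']]
      exact cyc_split₄ _ hl' (by rw [Perm.mul_apply, X.edge_edge, e2])
        (by rw [Perm.mul_apply, X.edge_edge, e8]) (by rw [Perm.mul_apply, X.edge_edge, e4])
        (by rw [Perm.mul_apply, X.edge_edge, e6])

end Dip
end BMap
end MatrixModel

namespace MatrixModel
open Equiv
namespace BMap
namespace Dip

variable {D : Type*} {X : BMap D} (δ : X.Dip)

theorem conn_p {u : D} (hu : u ∈ δ.darts) : X.Conn u δ.p := by
  have r := X.conn_rot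
  have h : X.Conn δ.p' δ.p := by rw [← δ.edge_p]; exact conn_edge _
  rw [mem_darts] at hu
  rcases δ.shape with ⟨e1, e2, e3, e4, e5, e6, e7, e8⟩ | ⟨e1, e2, e3, e4, e5, e6, e7, e8⟩
  · have h1 := r δ.p; have h2 := r δ.q; have h3 := r δ.a; have h5 := r δ.q'; have h6 := r δ.p'
    have h7 := r δ.c
    rw [e1] at h1; rw [e2] at h2; rw [e3] at h3; rw [e5] at h5; rw [e6] at h6; rw [e7] at h7
    rcases hu with rfl | rfl | rfl | rfl | rfl | rfl | rfl | rfl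
    exacts [rfl, h1, h2.trans h1, h3.trans (h2.trans h1), h, h5.symm.trans h, h6.trans h,
      h7.trans (h6.trans h)]
  · have h1 := r δ.p; have h2 := r δ.a; have h3 := r δ.q; have h5 := r δ.p'; have h6 := r δ.c
    have h7 := r δ.q'
    rw [e1] at h1; rw [e2] at h2; rw [e3] at h3; rw [e5] at h5; rw [e6] at h6; rw [e7] at h7
    rcases hu with rfl | rfl | rfl | rfl | rfl | rfl | rfl | rfl
    exacts [rfl, h2.trans h1, h1, h3.trans (h2.trans h1), h, h6.trans (h5.trans h), h5.trans h,
      h7.trans (h6.trans (h5.trans h))]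

/-- `Y` is obtained from `X` by removing a dipole: the half-edges of each side are connected to each
other, and the inner edges become separate rings. -/
structure IsRemoval (Y : BMap D) : Prop where
  edge : Y.edge = X.edge
  white : Y.white = X.white
  rot_a : Y.rot δ.a = δ.d
  rot_d : Y.rot δ.d = δ.a
  rot_b : Y.rot δ.b = δ.c
  rot_c : Y.rot δ.c = δ.b
  rot_p : Y.rot δ.p = δ.p'
  rot_p' : Y.rot δ.p' = δ.p
  rot_q : Y.rot δ.q = δ.q'
  rot_q' : Y.rot δ.q' = δ.q
  rot_of_notMem : ∀ u, u ∉ δ.darts → Y.rot u = X.rot u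

variable {δ}

theorem IsRemoval.not_four {Y : BMap D} (h : δ.IsRemoval Y) {u : D} (hu : u ∈ δ.darts) :
    ¬ Y.Four u := by
  rw [BMap.not_four]
  rw [mem_darts] at hu
  obtain ⟨-, -, h1, h2, h3, h4, h5, h6, h7, h8, -⟩ := h
  rcases hu with rfl | rfl | rfl | rfl | rfl | rfl | rfl | rfl <;> simp [*]

theorem IsRemoval.four_iff {Y : BMap D} (h : δ.IsRemoval Y) {u : D} :
    Y.Four u ↔ X.Four u ∧ u ∉ δ.darts := by
  by_cases hu : u ∈ δ.darts
  · simp [h.not_four hu, hu]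
  · have hu' : X.rot u ∉ δ.darts := fun h => hu (δ.rot_mem.1 h)
    unfold Four
    rw [h.rot_of_notMem _ hu, h.rot_of_notMem _ hu']
    simp [hu]

theorem IsRemoval.opp_of_mem {Y : BMap D} (h : δ.IsRemoval Y) {u : D} (hu : u ∈ δ.darts) :
    Y.opp u = Y.rot u := opp_of_not_four (h.not_four hu)

theorem IsRemoval.opp_of_notMem {Y : BMap D} (h : δ.IsRemoval Y) {u : D} (hu : u ∉ δ.darts) :
    Y.opp u = X.opp u := by
  have hu' : X.rot u ∉ δ.darts := fun h => hu (δ.rot_mem.1 h)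
  by_cases hf : X.Four u
  · rw [opp_of_four hf, opp_of_four (h.four_iff.2 ⟨hf, hu⟩), h.rot_of_notMem _ hu,
      h.rot_of_notMem _ hu']
  · rw [opp_of_not_four hf, opp_of_not_four fun h' => hf (h.four_iff.1 h').1,
      h.rot_of_notMem _ hu]

theorem card_four_of_isRemoval [Finite D] {Y : BMap D} (h : δ.IsRemoval Y) :
    Nat.card {u // X.Four u} = Nat.card {u // Y.Four u} + 8 := by
  classical
  have : Fintype D := Fintype.ofFinite D
  have hl := δ.nodup
  have h8 : (Finset.univ.filter fun u => u ∈ δ.darts).card = 8 := by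
    have : (Finset.univ.filter fun u => u ∈ δ.darts) =
        [δ.p, δ.q, δ.a, δ.b, δ.p', δ.q', δ.c, δ.d].toFinset := by
      ext u
      simp [mem_darts]
    rw [this, List.toFinset_card_of_nodup hl]
    rfl
  rw [Nat.card_eq_fintype_card, Nat.card_eq_fintype_card, Fintype.card_subtype,
    Fintype.card_subtype, ← h8, ← Finset.card_union_of_disjoint]
  · congr 1
    ext u
    simp only [Finset.mem_filter, Finset.mem_univ, true_and, Finset.mem_union, h.four_iff]
    by_cases hu : u ∈ δ.darts
    · simp [hu, δ.fours hu]
    · simp [hu]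
  · rw [Finset.disjoint_filter]
    intro u _ hu hu'
    exact h.not_four hu' hu

/-- The two inner edges form rings after the removal: their pairs of half-edges are invariant under
rotation, edges, and straight continuation. -/
theorem IsRemoval.swaps {Y : BMap D} (h : δ.IsRemoval Y) :
    (∀ u, Y.rot u = δ.p ∨ Y.rot u = δ.p' ↔ u = δ.p ∨ u = δ.p') ∧
    (∀ u, Y.rot u = δ.q ∨ Y.rot u = δ.q' ↔ u = δ.q ∨ u = δ.q') ∧
    (∀ u, Y.edge u = δ.p ∨ Y.edge u = δ.p' ↔ u = δ.p ∨ u = δ.p') ∧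
    (∀ u, Y.edge u = δ.q ∨ Y.edge u = δ.q' ↔ u = δ.q ∨ u = δ.q') ∧
    (∀ u, Y.opp u = δ.p ∨ Y.opp u = δ.p' ↔ u = δ.p ∨ u = δ.p') ∧
    (∀ u, Y.opp u = δ.q ∨ Y.opp u = δ.q' ↔ u = δ.q ∨ u = δ.q') := by
  have ho : ∀ {u}, u ∈ δ.darts → Y.opp u = Y.rot u := fun hu => h.opp_of_mem hu
  refine ⟨fun _ => perm_pair_iff h.rot_p h.rot_p', fun _ => perm_pair_iff h.rot_q h.rot_q',
    fun _ => perm_pair_iff ?_ ?_, fun _ => perm_pair_iff ?_ ?_,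
    fun _ => perm_pair_iff ((ho ?_).trans h.rot_p) ((ho ?_).trans h.rot_p'),
    fun _ => perm_pair_iff ((ho ?_).trans h.rot_q) ((ho ?_).trans h.rot_q')⟩
  · rw [h.edge, δ.edge_p]
  · rw [h.edge, δ.edge_p']
  · rw [h.edge, δ.edge_q]
  · rw [h.edge, δ.edge_q']
  all_goals simp [mem_darts]

/-- Removing a dipole creates two rings; it may moreover disconnect the two sides. -/
theorem IsRemoval.orb_rot [Finite D] {Y : BMap D} (h : δ.IsRemoval Y) :
    (Y.Conn δ.a δ.b → orb Y.rot Y.edge = orb X.rot X.edge + 2) ∧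
    (¬ Y.Conn δ.a δ.b → orb Y.rot Y.edge = orb X.rot X.edge + 3) := by
  obtain ⟨s1, s2, s3, s4, -, -⟩ := h.swaps
  have hnd := δ.nodup
  simp only [List.nodup_cons, List.mem_cons, not_or, List.not_mem_nil, not_false_eq_true] at hnd
  -- the components of `X` arise from those of `Y` by joining the two sides and the two rings
  set r₀ := orbRel Y.rot Y.edge with hr₀
  set r₁ := addPair r₀ δ.a δ.b with hr₁
  set r₂ := addPair r₁ δ.a δ.p with hr₂
  set r₃ := addPair r₂ δ.a δ.q with hr₃
  have h12 : Quot.mk r₁ δ.a ≠ Quot.mk r₁ δ.p := by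
    intro hq
    have := (quot_invariant (P := fun u => u = δ.p ∨ u = δ.p') ?_ hq).2 (Or.inl rfl)
    · tauto
    · rintro u v ((rfl | rfl) | ⟨rfl, rfl⟩)
      exacts [(s3 u).symm, (s1 u).symm, by tauto]
  have h23 : Quot.mk r₂ δ.a ≠ Quot.mk r₂ δ.q := by
    intro hq
    have := (quot_invariant (P := fun u => u = δ.q ∨ u = δ.q') ?_ hq).2 (Or.inl rfl)
    · tauto
    · rintro u v (((rfl | rfl) | ⟨rfl, rfl⟩) | ⟨rfl, rfl⟩)
      exacts [(s4 u).symm, (s2 u).symm, by tauto, by grind]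
  have h3 : Nat.card (Quot r₃) = orb X.rot X.edge := by
    have q0 : ∀ {u v}, Quot.mk r₀ u = Quot.mk r₀ v → Quot.mk r₃ u = Quot.mk r₃ v :=
      fun hq => addPair_of_eq _ _ (addPair_of_eq _ _ (addPair_of_eq _ _ hq))
    have qr : ∀ u, Quot.mk r₃ (Y.rot u) = Quot.mk r₃ u := fun u => q0 (orbRel_fst _ _ u)
    have qe : ∀ u, Quot.mk r₃ (Y.edge u) = Quot.mk r₃ u := fun u => q0 (orbRel_snd _ _ u)
    have qb : Quot.mk r₃ δ.a = Quot.mk r₃ δ.b :=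
      addPair_of_eq _ _ (addPair_of_eq _ _ (addPair_eq _ _ _))
    have qp : Quot.mk r₃ δ.a = Quot.mk r₃ δ.p := addPair_of_eq _ _ (addPair_eq _ _ _)
    have qq : Quot.mk r₃ δ.a = Quot.mk r₃ δ.q := addPair_eq _ _ _
    have q1 := qr δ.a; have q2 := qr δ.b; have q3 := qr δ.p; have q4 := qr δ.q
    rw [h.rot_a] at q1; rw [h.rot_b] at q2; rw [h.rot_p] at q3; rw [h.rot_q] at q4
    have qd : ∀ u ∈ δ.darts, Quot.mk r₃ u = Quot.mk r₃ δ.a := by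
      intro u hu
      rw [mem_darts] at hu
      rcases hu with rfl | rfl | rfl | rfl | rfl | rfl | rfl | rfl
      exacts [qp.symm, qq.symm, rfl, qb.symm, q3.trans qp.symm, q4.trans qq.symm,
        q2.trans qb.symm, q1]
    refine card_quot_eq_orb ?_ ?_ ?_
    · have c := fun u (hu : u ∈ δ.darts) => δ.conn_p hu
      have ha := c δ.a (by simp [mem_darts])
      rintro u v ((((rfl | rfl) | ⟨rfl, rfl⟩) | ⟨rfl, rfl⟩) | ⟨rfl, rfl⟩)
      · rw [h.edge]; exact (conn_edge u).symm
      · by_cases hu : u ∈ δ.darts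
        · have hu' : Y.rot u ∈ δ.darts := by
            rw [mem_darts] at hu ⊢
            obtain ⟨-, -, h1, h2, h3, h4, h5, h6, h7, h8, -⟩ := h
            rcases hu with rfl | rfl | rfl | rfl | rfl | rfl | rfl | rfl <;> simp [*]
          exact (c u hu).trans (c _ hu').symm
        · rw [h.rot_of_notMem u hu]; exact (conn_rot u).symm
      · exact ha.trans (c δ.b (by simp [mem_darts])).symm
      · exact ha
      · exact ha.trans (c δ.q (by simp [mem_darts])).symm
    · intro u
      by_cases hu : u ∈ δ.darts
      · rw [qd _ hu, qd _ (δ.rot_mem.2 hu)]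
      · rw [← h.rot_of_notMem u hu, qr]
    · rw [← h.edge]; exact qe
  have e1 : Nat.card (Quot r₁) = Nat.card (Quot r₂) + 1 := card_quot_addPair h12
  have e2 : Nat.card (Quot r₂) = Nat.card (Quot r₃) + 1 := card_quot_addPair h23
  constructor
  · intro hab
    have e0 : Nat.card (Quot r₁) = orb Y.rot Y.edge := card_quot_addPair_of_eq hab
    omega
  · intro hab
    have e0 : orb Y.rot Y.edge = Nat.card (Quot r₁) + 1 := card_quot_addPair hab
    omega

/-- At a face of length 2, the two straight paths through the dipole each run through one side, so that
they persist, and the two inner edges become straight cycles of their own. -/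
theorem IsRemoval.orb_opp_of_face [Finite D] {Y : BMap D} (h : δ.IsRemoval Y)
    (hU : X.rot δ.p = δ.q) : orb Y.opp Y.edge = orb X.opp X.edge + 2 := by
  obtain ⟨-, -, s3, s4, s1, s2⟩ := h.swaps
  have hnd := δ.nodup
  simp only [List.nodup_cons, List.mem_cons, not_or, List.not_mem_nil, not_false_eq_true] at hnd
  have ho : ∀ {u}, u ∈ δ.darts → X.opp u = X.rot (X.rot u) := fun hu => opp_of_four (δ.fours hu)
  have hy : ∀ {u}, u ∈ δ.darts → Y.opp u = Y.rot u := fun hu => h.opp_of_mem hu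
  obtain ⟨-, e2, e3, e4, e5, e6, e7, e8⟩ : X.rot δ.p = δ.q ∧ X.rot δ.q = δ.a ∧ X.rot δ.a = δ.b ∧
      X.rot δ.b = δ.p ∧ X.rot δ.q' = δ.p' ∧ X.rot δ.p' = δ.c ∧ X.rot δ.c = δ.d ∧
      X.rot δ.d = δ.q' := by
    rcases δ.shape with h | h
    · exact h
    · exact absurd (h.1.symm.trans hU) (by tauto)
  have oa : X.opp δ.a = δ.p := by rw [ho (by simp [mem_darts]), e3, e4]
  have op : X.opp δ.p = δ.a := by rw [ho (by simp [mem_darts]), hU, e2]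
  have ob : X.opp δ.b = δ.q := by rw [ho (by simp [mem_darts]), e4, hU]
  have oq : X.opp δ.q = δ.b := by rw [ho (by simp [mem_darts]), e2, e3]
  have od : X.opp δ.d = δ.p' := by rw [ho (by simp [mem_darts]), e8, e5]
  have op' : X.opp δ.p' = δ.d := by rw [ho (by simp [mem_darts]), e6, e7]
  have oc : X.opp δ.c = δ.q' := by rw [ho (by simp [mem_darts]), e7, e8]
  have oq' : X.opp δ.q' = δ.c := by rw [ho (by simp [mem_darts]), e5, e6]
  set r₀ := orbRel Y.opp Y.edge with hr₀
  set r₁ := addPair r₀ δ.a δ.p with hr₁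
  set r₂ := addPair r₁ δ.b δ.q with hr₂
  have h01 : Quot.mk r₀ δ.a ≠ Quot.mk r₀ δ.p := by
    intro hq
    have := (quot_invariant (P := fun u => u = δ.p ∨ u = δ.p') ?_ hq).2 (Or.inl rfl)
    · tauto
    · rintro u v (rfl | rfl)
      exacts [(s3 u).symm, (s1 u).symm]
  have h12 : Quot.mk r₁ δ.b ≠ Quot.mk r₁ δ.q := by
    intro hq
    have := (quot_invariant (P := fun u => u = δ.q ∨ u = δ.q') ?_ hq).2 (Or.inl rfl)
    · tauto
    · rintro u v ((rfl | rfl) | ⟨rfl, rfl⟩)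
      exacts [(s4 u).symm, (s2 u).symm, by grind]
  have h2 : Nat.card (Quot r₂) = orb X.opp X.edge := by
    have q0 : ∀ {u v}, Quot.mk r₀ u = Quot.mk r₀ v → Quot.mk r₂ u = Quot.mk r₂ v :=
      fun hq => addPair_of_eq _ _ (addPair_of_eq _ _ hq)
    have qr : ∀ u, Quot.mk r₂ (Y.opp u) = Quot.mk r₂ u := fun u => q0 (orbRel_fst _ _ u)
    have qe : ∀ u, Quot.mk r₂ (Y.edge u) = Quot.mk r₂ u := fun u => q0 (orbRel_snd _ _ u)
    have qp : Quot.mk r₂ δ.a = Quot.mk r₂ δ.p := addPair_of_eq _ _ (addPair_eq _ _ _)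
    have qq : Quot.mk r₂ δ.b = Quot.mk r₂ δ.q := addPair_eq _ _ _
    have q1 := qr δ.a; have q2 := qr δ.b; have q3 := qr δ.p; have q4 := qr δ.q
    rw [hy (by simp [mem_darts]), h.rot_a] at q1
    rw [hy (by simp [mem_darts]), h.rot_b] at q2
    rw [hy (by simp [mem_darts]), h.rot_p] at q3
    rw [hy (by simp [mem_darts]), h.rot_q] at q4
    have c := orbRel_fst X.opp X.edge
    have c' := orbRel_snd X.opp X.edge
    have ca := c δ.a; have cd := c δ.d; have cb := c δ.b; have cc := c δ.c
    rw [oa] at ca; rw [od] at cd; rw [ob] at cb; rw [oc] at cc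
    have cp := c' δ.p; have cq := c' δ.q
    rw [δ.edge_p] at cp; rw [δ.edge_q] at cq
    have cad := ca.symm.trans (cp.symm.trans cd)
    have cbc := cb.symm.trans (cq.symm.trans cc)
    refine card_quot_eq_orb ?_ ?_ ?_
    · rintro u v (((rfl | rfl) | ⟨rfl, rfl⟩) | ⟨rfl, rfl⟩)
      · rw [h.edge]; exact (c' u).symm
      · by_cases hu : u ∈ δ.darts
        · rw [hy hu]
          rw [mem_darts] at hu
          rcases hu with rfl | rfl | rfl | rfl | rfl | rfl | rfl | rfl
          · rw [h.rot_p, cp]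
          · rw [h.rot_q, cq]
          · rw [h.rot_a, cad]
          · rw [h.rot_b, cbc]
          · rw [h.rot_p', cp]
          · rw [h.rot_q', cq]
          · rw [h.rot_c, cbc]
          · rw [h.rot_d, cad]
        · rw [h.opp_of_notMem hu, c]
      · exact ca.symm
      · exact cb.symm
    · intro u
      by_cases hu : u ∈ δ.darts
      · rw [mem_darts] at hu
        rcases hu with rfl | rfl | rfl | rfl | rfl | rfl | rfl | rfl
        · rw [op, qp]
        · rw [oq, qq]
        · rw [oa, qp]
        · rw [ob, qq]
        · rw [op', q1, qp, q3]
        · rw [oq', q2, qq, q4]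
        · rw [oc, q4, q2, qq]
        · rw [od, q3, q1, qp]
      · rw [← h.opp_of_notMem hu, qr]
    · rw [← h.edge]; exact qe
  have e1 : orb Y.opp Y.edge = Nat.card (Quot r₁) + 1 := card_quot_addPair h01
  have e2 : Nat.card (Quot r₁) = Nat.card (Quot r₂) + 1 := card_quot_addPair h12
  omega

/-- When removing a straight cycle of length 2 disconnects the two sides, the straight path that
leaves the dipole through `a` comes back through `d`: otherwise its half-edges on the side of `a`
would be paired by `edge` and, except for `a` itself, by `opp`. -/
theorem IsRemoval.straight_a_d [Finite D] {Y : BMap D} (h : δ.IsRemoval Y)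
    (hab : ¬ Y.Conn δ.a δ.b) (oa : X.opp δ.a = δ.b) :
    Quot.mk (orbRel X.opp X.edge) δ.a = Quot.mk (orbRel X.opp X.edge) δ.d := by
  classical
  have : Fintype D := Fintype.ofFinite D
  by_contra had
  obtain ⟨s1, s2, s3, s4, -, -⟩ := h.swaps
  have hnd := δ.nodup
  simp only [List.nodup_cons, List.mem_cons, not_or, List.not_mem_nil, not_false_eq_true] at hnd
  have np : ∀ u, u = δ.p ∨ u = δ.p' → ¬ Y.Conn u δ.a := by
    intro u hu hc
    have := (hc.invariant (P := fun u => u = δ.p ∨ u = δ.p') s1 s3).1 hu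
    tauto
  have nq : ∀ u, u = δ.q ∨ u = δ.q' → ¬ Y.Conn u δ.a := by
    intro u hu hc
    have := (hc.invariant (P := fun u => u = δ.q ∨ u = δ.q') s2 s4).1 hu
    tauto
  have nb : ¬ Y.Conn δ.b δ.a := fun hc => hab hc.symm
  have nc : ¬ Y.Conn δ.c δ.a := by
    intro hc
    have := conn_rot (X := Y) δ.b
    rw [h.rot_b] at this
    exact nb (this.symm.trans hc)
  let S : Finset D := Finset.univ.filter fun u =>
    Quot.mk (orbRel X.opp X.edge) u = Quot.mk (orbRel X.opp X.edge) δ.a ∧ Y.Conn u δ.a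
  have hS : ∀ u, u ∈ S ↔ Quot.mk (orbRel X.opp X.edge) u = Quot.mk (orbRel X.opp X.edge) δ.a ∧
      Y.Conn u δ.a := by simp [S]
  have haS : δ.a ∈ S := (hS _).2 ⟨rfl, rfl⟩
  have hdS : ∀ u ∈ S, u ∈ δ.darts → u = δ.a := by
    intro u hu hd
    rw [hS] at hu
    rw [mem_darts] at hd
    rcases hd with rfl | rfl | rfl | rfl | rfl | rfl | rfl | rfl
    · exact (np _ (Or.inl rfl) hu.2).elim
    · exact (nq _ (Or.inl rfl) hu.2).elim
    · rfl
    · exact (nb hu.2).elim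
    · exact (np _ (Or.inr rfl) hu.2).elim
    · exact (nq _ (Or.inr rfl) hu.2).elim
    · exact (nc hu.2).elim
    · exact (had hu.1.symm).elim
  have h1 : Even S.card := by
    refine even_card_of_involution S X.edge (fun u hu => ?_) X.edge_edge edge_ne
    rw [hS] at hu ⊢
    refine ⟨(orbRel_snd X.opp X.edge u).trans hu.1, ?_⟩
    rw [← h.edge]
    exact (conn_edge u).trans hu.2
  have h2 : Even (S.erase δ.a).card := by
    refine even_card_of_involution _ X.opp (fun u hu => ?_) opp_opp opp_ne
    rw [Finset.mem_erase] at hu ⊢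
    have hu' : u ∉ δ.darts := fun hd => hu.1 (hdS u hu.2 hd)
    have hu2 := (hS u).1 hu.2
    refine ⟨fun ha => ?_, (hS _).2 ⟨(orbRel_fst X.opp X.edge u).trans hu2.1, ?_⟩⟩
    · apply hu'
      rw [← opp_opp (X := X) u, ha, oa]
      simp [mem_darts]
    · rw [← h.opp_of_notMem hu']
      by_cases hf : Y.Four u
      · rw [opp_of_four hf]
        exact (conn_rot _).trans ((conn_rot u).trans hu2.2)
      · rw [opp_of_not_four hf]
        exact (conn_rot u).trans hu2.2
  rw [Finset.card_erase_of_mem haS] at h2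
  have := Finset.card_pos.2 ⟨_, haS⟩
  rcases h1 with ⟨x, hx⟩
  rcases h2 with ⟨y, hy⟩
  omega

/-- The removal of a straight cycle of length 2 replaces it by two rings.  The straight paths through
the two sides may be joined; if the two sides get disconnected, a single straight path is cut in
two. -/
theorem IsRemoval.orb_opp_of_straight [Finite D] {Y : BMap D} (h : δ.IsRemoval Y)
    (hO : X.rot δ.p = δ.a) : orb X.opp X.edge ≤ orb Y.opp Y.edge ∧
      (¬ Y.Conn δ.a δ.b → orb Y.opp Y.edge = orb X.opp X.edge + 2) := by
  obtain ⟨t1, t2, s3, s4, s1, s2⟩ := h.swaps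
  have hnd := δ.nodup
  simp only [List.nodup_cons, List.mem_cons, not_or, List.not_mem_nil, not_false_eq_true] at hnd
  have ho : ∀ {u}, u ∈ δ.darts → X.opp u = X.rot (X.rot u) := fun hu => opp_of_four (δ.fours hu)
  have hy : ∀ {u}, u ∈ δ.darts → Y.opp u = Y.rot u := fun hu => h.opp_of_mem hu
  obtain ⟨-, e2, e3, e4, e5, e6, e7, e8⟩ : X.rot δ.p = δ.a ∧ X.rot δ.a = δ.q ∧ X.rot δ.q = δ.b ∧
      X.rot δ.b = δ.p ∧ X.rot δ.p' = δ.c ∧ X.rot δ.c = δ.q' ∧ X.rot δ.q' = δ.d ∧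
      X.rot δ.d = δ.p' := by
    rcases δ.shape with h | h
    · exact absurd (h.1.symm.trans hO) (by tauto)
    · exact h
  have op : X.opp δ.p = δ.q := by rw [ho (by simp [mem_darts]), hO, e2]
  have oa : X.opp δ.a = δ.b := by rw [ho (by simp [mem_darts]), e2, e3]
  have oq : X.opp δ.q = δ.p := by rw [ho (by simp [mem_darts]), e3, e4]
  have ob : X.opp δ.b = δ.a := by rw [ho (by simp [mem_darts]), e4, hO]
  have op' : X.opp δ.p' = δ.q' := by rw [ho (by simp [mem_darts]), e5, e6]
  have oc : X.opp δ.c = δ.d := by rw [ho (by simp [mem_darts]), e6, e7]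
  have oq' : X.opp δ.q' = δ.p' := by rw [ho (by simp [mem_darts]), e7, e8]
  have od : X.opp δ.d = δ.c := by rw [ho (by simp [mem_darts]), e8, e5]
  set r₀ := orbRel Y.opp Y.edge with hr₀
  set r₁ := addPair r₀ δ.p δ.q with hr₁
  set r₂ := addPair r₁ δ.a δ.b with hr₂
  -- `r₂` is also generated by the straight cycles of `X` and the pair `a`, `d`
  set t := addPair (orbRel X.opp X.edge) δ.a δ.d with ht
  have h01 : Quot.mk r₀ δ.p ≠ Quot.mk r₀ δ.q := by
    intro hq
    have := (quot_invariant (P := fun u => u = δ.p ∨ u = δ.p') ?_ hq).1 (Or.inl rfl)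
    · grind
    · rintro u v (rfl | rfl)
      exacts [(s3 u).symm, (s1 u).symm]
  have hsep : ¬ Y.Conn δ.a δ.b → Quot.mk r₁ δ.a ≠ Quot.mk r₁ δ.b := by
    intro hab hq
    have hr : ∀ u, Y.Conn (Y.opp u) u := by
      intro u
      by_cases hf : Y.Four u
      · rw [opp_of_four hf]; exact (conn_rot _).trans (conn_rot u)
      · rw [opp_of_not_four hf]; exact conn_rot u
    have np : ¬ Y.Conn δ.p δ.a := by
      intro hc
      have := (hc.invariant (P := fun u => u = δ.p ∨ u = δ.p') t1 s3).1 (Or.inl rfl)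
      tauto
    have nq : ¬ Y.Conn δ.q δ.a := by
      intro hc
      have := (hc.invariant (P := fun u => u = δ.q ∨ u = δ.q') t2 s4).1 (Or.inl rfl)
      tauto
    have := (quot_invariant (P := fun u => Y.Conn u δ.a) ?_ hq).1 rfl
    · exact hab this.symm
    · rintro u v ((rfl | rfl) | ⟨rfl, rfl⟩)
      · exact ⟨fun h => (conn_edge u).trans h, fun h => (conn_edge u).symm.trans h⟩
      · exact ⟨fun h => (hr u).trans h, fun h => (hr u).symm.trans h⟩
      · exact iff_of_false np nq
  have h2 : Nat.card (Quot r₂) = Nat.card (Quot t) := by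
    have q0 : ∀ {u v}, Quot.mk r₀ u = Quot.mk r₀ v → Quot.mk r₂ u = Quot.mk r₂ v :=
      fun hq => addPair_of_eq _ _ (addPair_of_eq _ _ hq)
    have qr : ∀ u, Quot.mk r₂ (Y.opp u) = Quot.mk r₂ u := fun u => q0 (orbRel_fst _ _ u)
    have qe : ∀ u, Quot.mk r₂ (Y.edge u) = Quot.mk r₂ u := fun u => q0 (orbRel_snd _ _ u)
    have qp : Quot.mk r₂ δ.p = Quot.mk r₂ δ.q := addPair_of_eq _ _ (addPair_eq _ _ _)
    have qq : Quot.mk r₂ δ.a = Quot.mk r₂ δ.b := addPair_eq _ _ _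
    have q1 := qr δ.a; have q2 := qr δ.b; have q3 := qr δ.p; have q4 := qr δ.q
    rw [hy (by simp [mem_darts]), h.rot_a] at q1
    rw [hy (by simp [mem_darts]), h.rot_b] at q2
    rw [hy (by simp [mem_darts]), h.rot_p] at q3
    rw [hy (by simp [mem_darts]), h.rot_q] at q4
    have c : ∀ u, Quot.mk t (X.opp u) = Quot.mk t u :=
      fun u => addPair_of_eq _ _ (orbRel_fst _ _ u)
    have c' : ∀ u, Quot.mk t (X.edge u) = Quot.mk t u :=
      fun u => addPair_of_eq _ _ (orbRel_snd _ _ u)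
    have ct : Quot.mk t δ.a = Quot.mk t δ.d := addPair_eq _ _ _
    have ca := c δ.a; have cd := c δ.d; have cp := c δ.p; have cp' := c δ.p'
    rw [oa] at ca; rw [od] at cd; rw [op] at cp; rw [op'] at cp'
    have ep := c' δ.p; have eq := c' δ.q
    rw [δ.edge_p] at ep; rw [δ.edge_q] at eq
    refine card_quot_congr ?_ ?_
    · rintro u v (((rfl | rfl) | ⟨rfl, rfl⟩) | ⟨rfl, rfl⟩)
      · rw [h.edge]; exact (c' u).symm
      · by_cases hu : u ∈ δ.darts
        · rw [hy hu]
          rw [mem_darts] at hu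
          rcases hu with rfl | rfl | rfl | rfl | rfl | rfl | rfl | rfl
          · rw [h.rot_p, ep]
          · rw [h.rot_q, eq]
          · rw [h.rot_a, ct]
          · rw [h.rot_b, ca, cd, ct]
          · rw [h.rot_p', ep]
          · rw [h.rot_q', eq]
          · rw [h.rot_c, ca, cd, ct]
          · rw [h.rot_d, ct]
        · rw [h.opp_of_notMem hu, c]
      · exact cp.symm
      · exact ca.symm
    · rintro u v ((rfl | rfl) | ⟨rfl, rfl⟩)
      · rw [← h.edge, qe]
      · by_cases hu : u ∈ δ.darts
        · rw [mem_darts] at hu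
          rcases hu with rfl | rfl | rfl | rfl | rfl | rfl | rfl | rfl
          · rw [op, qp]
          · rw [oq, qp]
          · rw [oa, qq]
          · rw [ob, qq]
          · rw [op', q3, q4, qp]
          · rw [oq', q3, q4, qp]
          · rw [oc, q1, q2, qq]
          · rw [od, q1, q2, qq]
        · rw [← h.opp_of_notMem hu, qr]
      · exact q1.symm
  have e1 : orb Y.opp Y.edge = Nat.card (Quot r₁) + 1 := card_quot_addPair h01
  have e2 : Nat.card (Quot t) ≤ Nat.card (Quot r₁) := by
    rw [← h2]
    by_cases hq : Quot.mk r₁ δ.a = Quot.mk r₁ δ.b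
    · exact (card_quot_addPair_of_eq hq).le
    · have : Nat.card (Quot r₁) = Nat.card (Quot r₂) + 1 := card_quot_addPair hq
      omega
  have e3 : orb X.opp X.edge ≤ Nat.card (Quot t) + 1 := by
    by_cases hq : Quot.mk (orbRel X.opp X.edge) δ.a = Quot.mk (orbRel X.opp X.edge) δ.d
    · have : Nat.card (Quot t) = orb X.opp X.edge := card_quot_addPair_of_eq hq
      omega
    · exact (card_quot_addPair hq).le
  refine ⟨by omega, fun hab => ?_⟩
  have e4 : Nat.card (Quot r₁) = Nat.card (Quot r₂) + 1 := card_quot_addPair (hsep hab)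
  have e5 : Nat.card (Quot t) = orb X.opp X.edge :=
    card_quot_addPair_of_eq (h.straight_a_d hab oa)
  omega

variable (δ)

/-- A dipole can be removed.  If this disconnects its two sides, the excess does not change;
otherwise it decreases. -/
theorem exists_removal [Finite D] : ∃ Y : BMap D, δ.IsRemoval Y ∧
    ((¬ Y.Conn δ.a δ.b ∧ orb Y.rot Y.edge = orb X.rot X.edge + 3 ∧ Y.excess = X.excess) ∨
      (Y.Conn δ.a δ.b ∧ orb Y.rot Y.edge = orb X.rot X.edge + 2 ∧
        Y.excess + 8 ≤ X.excess)) := by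
  obtain ⟨ρ, ha, hd, hb, hc, hp, hp', hq, hq', hn, hF⟩ := δ.exists_rot
  have two : ∀ u ∈ δ.darts, ρ (ρ u) = u := by
    intro u hu
    rw [mem_darts] at hu
    rcases hu with rfl | rfl | rfl | rfl | rfl | rfl | rfl | rfl <;> simp [*]
  have mem : ∀ u, u ∉ δ.darts → X.rot u ∉ δ.darts := fun u hu h => hu (δ.rot_mem.1 h)
  let Y : BMap D :=
    { rot := ρ
      edge := X.edge
      white := X.white
      rot_four := by
        intro u
        by_cases hu : u ∈ δ.darts
        · have hu' : ρ (ρ u) ∈ δ.darts := by rwa [two u hu]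
          rw [two _ hu', two u hu]
        · rw [hn u hu, hn _ (mem _ hu), hn _ (mem _ (mem _ hu)), hn _ (mem _ (mem _ (mem _ hu))),
            X.rot_four]
      edge_edge := X.edge_edge
      white_edge := X.white_edge
      white_rot_of_ne := by
        intro u h
        by_cases hu : u ∈ δ.darts
        · exact (h (two u hu)).elim
        · rw [hn u hu, hn _ (mem _ hu)] at h
          rw [hn u hu]
          exact X.white_rot_of_ne u h
      white_rot_of_eq := by
        intro u h
        by_cases hu : u ∈ δ.darts
        · obtain ⟨w1, w2, w3, w4⟩ := δ.whites
          obtain ⟨b1, b2, b3, b4⟩ := δ.blacks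
          rw [mem_darts] at hu
          rcases hu with rfl | rfl | rfl | rfl | rfl | rfl | rfl | rfl <;> simp [*]
        · rw [hn u hu, hn _ (mem _ hu)] at h
          rw [hn u hu]
          exact X.white_rot_of_eq u h }
  have h : δ.IsRemoval Y := ⟨rfl, rfl, ha, hd, hb, hc, hp, hp', hq, hq', hn⟩
  refine ⟨Y, h, ?_⟩
  have h4 := card_four_of_isRemoval h
  have h1 := h.orb_rot
  have hF' : X.rot δ.p = δ.q ∧ (cyc (Y.rot * Y.edge) = cyc (X.rot * X.edge) + 4 ∨
        cyc (Y.rot * Y.edge) = cyc (X.rot * X.edge) + 2 ∧ Y.Conn δ.a δ.b) ∨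
      X.rot δ.p = δ.a ∧ cyc (Y.rot * Y.edge) = cyc (X.rot * X.edge) + 4 := by
    refine hF.imp (fun ⟨h1, h2⟩ => ⟨h1, h2.imp id fun ⟨h2, h3⟩ => ⟨h2, ?_⟩⟩) id
    have h5 : Y.Conn (X.edge δ.a) (X.edge δ.c) := by
      refine quot_map_eq ?_ h3
      rintro u v rfl
      exact ((conn_rot (X := Y) _).trans (conn_edge u)).symm
    have h6 := conn_rot (X := Y) δ.b
    rw [h.rot_b] at h6
    exact (conn_edge (X := Y) δ.a).symm.trans (h5.trans ((conn_edge (X := Y) δ.c).trans h6))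
  unfold excess
  by_cases hab : Y.Conn δ.a δ.b
  · right
    have h2 := h1.1 hab
    refine ⟨hab, h2, ?_⟩
    rcases hF' with ⟨hU, hF⟩ | ⟨hO, hF⟩
    · have h3 := h.orb_opp_of_face hU
      rcases hF with hF | hF <;> omega
    · have h3 := (h.orb_opp_of_straight hO).1
      omega
  · left
    have h2 := h1.2 hab
    refine ⟨hab, h2, ?_⟩
    rcases hF' with ⟨hU, hF⟩ | ⟨hO, hF⟩
    · have h3 := h.orb_opp_of_face hU
      rcases hF with hF | hF
      · omega
      · exact (hab hF.2).elim
    · have h3 := (h.orb_opp_of_straight hO).2 hab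
      omega

end Dip
end BMap
end MatrixModel

namespace MatrixModel
open Equiv
namespace BMap

/-! ### Components without melons -/

variable {D : Type*} {X : BMap D}

/-- An elementary melon, given by the first of its three half-edges at the white vertex. -/
def IsMelon (X : BMap D) (p : D) : Prop :=
  X.white p ∧ X.Four p ∧ X.Four (X.edge p) ∧ X.edge p = X.rot (X.edge (X.rot p)) ∧
    X.edge (X.rot p) = X.rot (X.edge (X.rot (X.rot p)))

/-- The component of `t` contains two elementary melons.  They may have the same vertices, when the
component has only two vertices, joined by four edges. -/
def TwoMelons (X : BMap D) (t : D) : Prop :=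
  ∃ m n, m ≠ n ∧ X.Conn m t ∧ X.Conn n t ∧ X.IsMelon m ∧ X.IsMelon n

/-- If a component contains two melons, then it contains one whose edges do not start at a given
half-edge. -/
theorem TwoMelons.exists_avoiding {t : D} (h : X.TwoMelons t) (z : D) :
    ∃ m, X.Conn m t ∧ X.IsMelon m ∧ z ≠ m ∧ z ≠ X.rot m ∧ z ≠ X.rot (X.rot m) := by
  obtain ⟨m, n, hmn, cm, cn, hm, hn⟩ := h
  by_cases h1 : z ≠ m ∧ z ≠ X.rot m ∧ z ≠ X.rot (X.rot m)
  · exact ⟨m, cm, hm, h1⟩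
  by_cases h2 : z ≠ n ∧ z ≠ X.rot n ∧ z ≠ X.rot (X.rot n)
  · exact ⟨n, cn, hn, h2⟩
  obtain ⟨wm, fm, fm', e0, e1⟩ := hm
  obtain ⟨-, -, -, k0, k1⟩ := hn
  have hz : z = m ∨ z = X.rot m ∨ z = X.rot (X.rot m) := by tauto
  have hz' : z = n ∨ z = X.rot n ∨ z = X.rot (X.rot n) := by tauto
  have rm := X.rot_four m
  have rn := X.rot_four n
  have hi : ∀ x y, X.rot x = X.rot y → x = y := fun x y => X.rot.injective.eq_iff.1
  have hn : n = X.rot m ∨ n = X.rot (X.rot m) ∨ n = X.rot (X.rot (X.rot m)) := by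
    rcases hz with rfl | rfl | rfl <;> rcases hz' with h | h | h <;> grind
  -- otherwise `n` is a half-edge of the same vertex as `m`, all four edges of this vertex arrive at
  -- the same vertex in reverse order, and the four rotations of `m` are melons
  have r4 := X.rot_four
  have key : X.edge (X.rot (X.rot m)) = X.rot (X.edge (X.rot (X.rot (X.rot m)))) ∧
      X.edge (X.rot (X.rot (X.rot m))) = X.rot (X.edge m) := by
    have := r4 (X.edge m)
    have := r4 (X.edge (X.rot m))
    have := r4 (X.edge (X.rot (X.rot m)))
    have := r4 (X.edge (X.rot (X.rot (X.rot m))))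
    rcases hn with rfl | rfl | rfl
    · rw [k1] at k0 e1; grind
    · rw [rm] at k1; grind
    · rw [rm] at k0 k1; grind
  obtain ⟨e2, e3⟩ := key
  have w1 := (white_rot fm).2 wm
  have f1 := four_rot.2 fm
  have w2 := (white_rot f1).2 w1
  have f2 := four_rot.2 f1
  have w3 := (white_rot f2).2 w2
  have f3 := four_rot.2 f2
  have g3 := four_rot.2 fm'
  rw [← e3] at g3
  have g2 := four_rot.2 g3
  rw [← e2] at g2
  have g1 := four_rot.2 g2
  rw [← e1] at g1
  have c1 := (conn_rot m).trans cm
  have c2 := (conn_rot _).trans c1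
  have c3 := (conn_rot _).trans c2
  have ne : ∀ x, X.Four x → x ≠ X.rot x ∧ x ≠ X.rot (X.rot x) ∧ x ≠ X.rot (X.rot (X.rot x)) :=
    fun x hx => by
      obtain ⟨h1, h2, h3, -⟩ := Dip.nodup_cycle hx rfl rfl rfl
      exact ⟨h1, h2, h3⟩
  rcases hz with rfl | rfl | rfl
  · exact ⟨X.rot z, c1, ⟨w1, f1, g1, e1, e2⟩, ne z fm⟩
  · exact ⟨X.rot (X.rot m), c2, ⟨w2, f2, g2, e2, by rw [rm]; exact e3⟩, ne _ f1⟩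
  · exact ⟨X.rot (X.rot (X.rot m)), c3, ⟨w3, f3, g3, by rw [rm]; exact e3, by rw [rm]; exact e0⟩,
      ne _ f2⟩

theorem Clean.four_edge (hX : X.Clean) {u : D} : X.Four (X.edge u) ↔ X.Four u := by
  have key : ∀ u, ¬ X.Four u → ¬ X.Four (X.edge u) := fun u hu => by
    rw [hX u hu, four_rot]; exact hu
  constructor
  · exact fun h => by_contra fun h' => key u h' h
  · exact fun h => by_contra fun h' => key _ h' (by rwa [X.edge_edge])

theorem Clean.four_of_conn (hX : X.Clean) {u v : D} (h : X.Conn u v) : X.Four u ↔ X.Four v :=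
  h.invariant (fun _ => four_rot) (fun _ => hX.four_edge)

theorem four_opp {u : D} : X.Four (X.opp u) ↔ X.Four u := by
  by_cases h : X.Four u
  · rw [opp_of_four h, four_rot, four_rot]
  · rw [opp_of_not_four h, four_rot]

theorem white_opp {u : D} (h : X.Four u) : X.white (X.opp u) ↔ X.white u := by
  rw [opp_of_four h, white_rot (four_rot.2 h), white_rot h]

theorem card_le_card_class [Finite D] {r : D → D → Prop} {d : D} (s : Finset D)
    (h : ∀ x ∈ s, Quot.mk r x = Quot.mk r d) :
    s.card ≤ Nat.card {x // Quot.mk r x = Quot.mk r d} := by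
  rw [← Set.ncard_coe_finset]
  exact Set.ncard_le_ncard (t := {x | Quot.mk r x = Quot.mk r d}) (fun x hx => h x hx)
    (Set.toFinite _)

theorem card_eq_four [DecidableEq D] {x y z w : D}
    (h : x ≠ y ∧ x ≠ z ∧ x ≠ w ∧ y ≠ z ∧ y ≠ w ∧ z ≠ w) : ({x, y, z, w} : Finset D).card = 4 := by
  obtain ⟨h1, h2, h3, h4, h5, h6⟩ := h
  rw [Finset.card_insert_of_notMem (by simp [h1, h2, h3]),
    Finset.card_insert_of_notMem (by simp [h4, h5]), Finset.card_pair h6]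

theorem card_union_eq_eight [DecidableEq D] {W : D → Prop} {x y z w x' y' z' w' : D}
    (h : x ≠ y ∧ x ≠ z ∧ x ≠ w ∧ y ≠ z ∧ y ≠ w ∧ z ≠ w)
    (h' : x' ≠ y' ∧ x' ≠ z' ∧ x' ≠ w' ∧ y' ≠ z' ∧ y' ≠ w' ∧ z' ≠ w')
    (hW : ∀ u ∈ ({x, y, z, w} : Finset D), W u)
    (hW' : ∀ u ∈ ({x', y', z', w'} : Finset D), ¬ W u) :
    (({x, y, z, w} : Finset D) ∪ {x', y', z', w'}).card = 8 := by
  rw [Finset.card_union_of_disjoint, card_eq_four h, card_eq_four h']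
  rw [Finset.disjoint_left]
  exact fun u h1 h2 => hW' u h2 (hW u h1)

/-- A straight cycle of length other than 2 has at least 8 half-edges, because its length is even. -/
theorem Clean.eight_le [Finite D] (hX : X.Clean) {d : D} (hd : X.Four d)
    (n1 : X.edge (X.opp d) ≠ X.opp (X.edge d)) :
    8 ≤ Nat.card {x // Quot.mk (orbRel X.opp X.edge) x = Quot.mk (orbRel X.opp X.edge) d} := by
  classical
  obtain ⟨o, ho⟩ : ∃ o, o = X.opp := ⟨_, rfl⟩
  obtain ⟨e, he⟩ : ∃ e, e = X.edge := ⟨_, rfl⟩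
  rw [← ho, ← he] at n1
  have oo : ∀ x, o (o x) = x := by rw [ho]; exact opp_opp
  have ee : ∀ x, e (e x) = x := by rw [he]; exact X.edge_edge
  have oi : ∀ {x y}, o x = o y → x = y := fun h => o.injective h
  have ei : ∀ {x y}, e x = e y → x = y := fun h => e.injective h
  have n0 : ∀ x, o x ≠ x := by rw [ho]; exact opp_ne
  have fo : ∀ {x}, X.Four x → X.Four (o x) := by rw [ho]; exact four_opp.2
  have fe : ∀ {x}, X.Four x → X.Four (e x) := by rw [he]; exact hX.four_edge.2
  have wo : ∀ {x}, X.Four x → (X.white (o x) ↔ X.white x) := by rw [ho]; exact white_opp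
  have we : ∀ {x}, X.Four x → (X.white (e x) ↔ ¬ X.white x) := by
    rw [he]; exact fun {x} _ => X.white_edge x
  have c1 : ∀ x, x ≠ e (o (e x)) := fun x h => n0 (e x) (by
    have := congrArg e h; rw [ee] at this; exact this.symm)
  have d1 : d ≠ e (o (e (o d))) := fun h => n1 (by
    have := congrArg o (congrArg e h); rw [ee, oo] at this; exact this.symm)
  have d2 : o d ≠ e (o (e d)) := fun h => n1 (by
    have := congrArg e h; rwa [ee] at this)
  have d5 : e d ≠ o (e (o d)) := fun h => n1 (by
    have := congrArg o h; rw [oo] at this; exact this.symm)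
  have g1 := wo hd
  have g3 := we (fo hd)
  have g4 := wo (fe hd)
  have g5 := wo (fe (fo hd))
  have g6 := we (fo (fe hd))
  have g7 := we (fo (fe (fo hd)))
  have hcard := card_union_eq_eight (W := fun u => X.white u ↔ X.white d)
    (x := d) (y := o d) (z := e (o (e d))) (w := e (o (e (o d)))) (x' := e d) (y' := e (o d))
    (z' := o (e d)) (w' := o (e (o d)))
    ⟨(n0 d).symm, c1 d, d1, d2, c1 _, fun h => n0 d (ei (oi (ei h))).symm⟩
    ⟨fun h => n0 d (ei h).symm, (n0 _).symm, d5, n1, (n0 _).symm, fun h => n0 d (ei (oi h)).symm⟩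
    (by simp [g1, g3, g4, g5, g6, g7, we hd]) (by simp [g1, g3, g4, g5, we hd])
  rw [← hcard]
  refine card_le_card_class _ ?_
  have ro : ∀ x, Quot.mk (orbRel X.opp X.edge) (o x) = Quot.mk _ x := by
    rw [ho]; exact orbRel_fst _ _
  have re : ∀ x, Quot.mk (orbRel X.opp X.edge) (e x) = Quot.mk _ x := by
    rw [he]; exact orbRel_snd _ _
  simp [ro, re]

end BMap
end MatrixModel

namespace MatrixModel
open Equiv
namespace BMap

variable {D : Type*} {X : BMap D}

theorem Clean.card_class_of_not_four (hX : X.Clean) {d : D} (hd : ¬ X.Four d) (u : D) :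
    X.Conn u d → u = d ∨ u = X.rot d := by
  have hr : X.rot (X.rot d) = d := not_four.1 hd
  have he : X.edge d = X.rot d := hX d hd
  have he' : X.edge (X.rot d) = d := by rw [← he, X.edge_edge]
  exact fun h => (h.invariant (P := fun u => u = d ∨ u = X.rot d)
    (fun u => perm_pair_iff rfl hr) (fun u => perm_pair_iff he he')).2 (Or.inl rfl)

/-- If there is no straight cycle of length 2, then the excess bounds the number of components that
are not rings: straight cycles have at least 8 half-edges, and the genus is nonnegative. -/
theorem Clean.four_mul_card_le_of_forall_ne [Finite D] (hX : X.Clean)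
    (hO : ∀ p, X.white p → X.Four p → X.edge (X.rot (X.rot p)) ≠ X.rot (X.rot (X.edge p)))
    (T : Finset D) (hT : ∀ t ∈ T, X.Four t) (hT' : ∀ s ∈ T, ∀ t ∈ T, X.Conn s t → s = t) :
    (4 * T.card : ℤ) ≤ X.excess := by
  classical
  have : Fintype D := Fintype.ofFinite D
  have : Fintype (Quot (orbRel X.rot X.edge)) := Fintype.ofFinite _
  set N : Finset D := Finset.univ.filter fun d => ¬ X.Four d with hN
  set F : Finset D := Finset.univ.filter fun d => X.Four d with hF
  have hF4 : Nat.card {d // X.Four d} = F.card := by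
    rw [Nat.card_eq_fintype_card, Fintype.card_subtype]
  have hcomm : ∀ x, X.Four x → X.edge (X.opp x) ≠ X.opp (X.edge x) := by
    have key : ∀ x, X.white x → X.Four x → X.edge (X.opp x) ≠ X.opp (X.edge x) := by
      intro x hw hx
      rw [opp_of_four hx, opp_of_four (hX.four_edge.2 hx)]
      exact hO x hw hx
    intro x hx
    by_cases hw : X.white x
    · exact key x hw hx
    · intro h
      refine key (X.edge x) ((X.white_edge x).2 hw) (hX.four_edge.2 hx) ?_
      rw [← h, X.edge_edge, X.edge_edge]
  -- straight cycles
  have h1 : 8 * orb X.opp X.edge ≤ F.card + 4 * N.card := by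
    have h := card_quot_eq_sum (orbRel X.opp X.edge)
    rw [← Finset.sum_filter_add_sum_filter_not Finset.univ (fun d => X.Four d)] at h
    have hs1 : ∑ d ∈ F, 1 / (Nat.card {x // Quot.mk (orbRel X.opp X.edge) x =
        Quot.mk (orbRel X.opp X.edge) d} : ℚ) ≤ F.card * (1 / 8) := by
      rw [← nsmul_eq_mul]
      refine Finset.sum_le_card_nsmul _ _ _ fun d hd => ?_
      have : (8 : ℚ) ≤ Nat.card {x // Quot.mk (orbRel X.opp X.edge) x =
        Quot.mk (orbRel X.opp X.edge) d} := by
          have hd' : X.Four d := by simpa [hF] using hd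
          exact_mod_cast hX.eight_le hd' (hcomm d hd')
      exact one_div_le_one_div_of_le (by norm_num) this
    have hs2 : ∑ d ∈ N, 1 / (Nat.card {x // Quot.mk (orbRel X.opp X.edge) x =
        Quot.mk (orbRel X.opp X.edge) d} : ℚ) ≤ N.card * (1 / 2) := by
      rw [← nsmul_eq_mul]
      refine Finset.sum_le_card_nsmul _ _ _ fun d hd => ?_
      have : (2 : ℚ) ≤ Nat.card {x // Quot.mk (orbRel X.opp X.edge) x =
        Quot.mk (orbRel X.opp X.edge) d} := by
          have := card_le_card_class (r := orbRel X.opp X.edge) (d := d) {d, X.edge d}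
            (by simp [orbRel_snd])
          rw [Finset.card_pair (edge_ne d).symm] at this
          exact_mod_cast this
      exact one_div_le_one_div_of_le (by norm_num) this
    have : (8 * orb X.opp X.edge : ℚ) ≤ F.card + 4 * N.card := by
      unfold orb
      rw [h]
      linarith
    exact_mod_cast this
  -- components
  have h2 : 2 * T.card + N.card ≤ 2 * orb X.rot X.edge := by
    have hTi : (T.image (Quot.mk (orbRel X.rot X.edge))).card = T.card :=
      Finset.card_image_of_injOn fun s hs t ht h => hT' s hs t ht h
    have hNi : N.card ≤ 2 * (N.image (Quot.mk (orbRel X.rot X.edge))).card := by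
      refine Finset.card_le_mul_card_image _ _ fun q hq => ?_
      obtain ⟨d, hd, rfl⟩ := Finset.mem_image.1 hq
      have hd' : ¬ X.Four d := by simpa [hN] using hd
      refine (Finset.card_le_card (t := {d, X.rot d}) fun u hu => ?_).trans Finset.card_le_two
      rw [Finset.mem_filter] at hu
      simpa using hX.card_class_of_not_four hd' u hu.2
    have hdisj : Disjoint (T.image (Quot.mk (orbRel X.rot X.edge)))
        (N.image (Quot.mk (orbRel X.rot X.edge))) := by
      rw [Finset.disjoint_left]
      intro q hq hq'
      obtain ⟨t, ht, rfl⟩ := Finset.mem_image.1 hq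
      obtain ⟨d, hd, hdt⟩ := Finset.mem_image.1 hq'
      have hd' : ¬ X.Four d := by simpa [hN] using hd
      exact hd' ((hX.four_of_conn (show X.Conn d t from hdt)).2 (hT t ht))
    have h3 := Finset.card_le_univ (T.image (Quot.mk (orbRel X.rot X.edge)) ∪
        (N.image (Quot.mk (orbRel X.rot X.edge))))
    rw [Finset.card_union_of_disjoint hdisj, hTi] at h3
    unfold orb
    rw [Nat.card_eq_fintype_card]
    omega
  have h3 := X.four_mul_cyc_le
  unfold excess
  rw [hF4] at h3 ⊢
  omega

theorem Dip.IsRemoval.conn {δ : X.Dip} {Y : BMap D} (h : δ.IsRemoval Y) {u v : D}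
    (huv : Y.Conn u v) : X.Conn u v := by
  refine orb_map_eq (s := orbRel X.rot X.edge) (fun u => ?_) (fun u => ?_) huv
  · by_cases hu : u ∈ δ.darts
    · have hu' : Y.rot u ∈ δ.darts := by
        by_contra hu'
        apply hu'
        rw [← δ.rot_mem, ← h.rot_of_notMem _ hu', BMap.not_four.1 (h.not_four hu)]
        exact hu
      exact (δ.conn_p hu').trans (δ.conn_p hu).symm
    · rw [h.rot_of_notMem u hu]; exact conn_rot u
  · rw [h.edge]; exact conn_edge u

theorem Dip.IsRemoval.four_of_not_conn {δ : X.Dip} {Y : BMap D} (h : δ.IsRemoval Y) {u : D}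
    (hu : X.Four u) (hc : ¬ X.Conn u δ.p) : Y.Four u :=
  h.four_iff.2 ⟨hu, fun hd => hc (δ.conn_p hd)⟩

/-- A melon of the map obtained by removing a dipole and forgetting the vertices of degree 2 is a
melon of the original map if its edges did not carry any vertex of degree 2. -/
theorem Dip.IsRemoval.isMelon {δ : X.Dip} {Y Z : BMap D} (h : δ.IsRemoval Y)
    (hr : Z.rot = Y.rot) (hw : Z.white = Y.white)
    (he : ∀ u, Y.Four u → Y.Four (Y.edge u) → Z.edge u = Y.edge u) {m : D} (hm : Z.IsMelon m)
    (hE : ∀ u, u = m ∨ u = X.rot m ∨ u = X.rot (X.rot m) → Y.Four (X.edge u)) : X.IsMelon m := by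
  obtain ⟨wm, fm, -, e0, e1⟩ := hm
  rw [hw, h.white] at wm
  have fY : Y.Four m := (four_congr hr m).1 fm
  have hrX : ∀ u, Y.Four u → Z.rot u = X.rot u ∧ Y.Four (X.rot u) := by
    intro u hu
    have hu' := (h.four_iff.1 hu).2
    have : Y.rot u = X.rot u := h.rot_of_notMem u hu'
    exact ⟨by rw [hr, this], by rw [← this, four_rot]; exact hu⟩
  obtain ⟨r1, f1⟩ := hrX m fY
  obtain ⟨r2, f2⟩ := hrX _ f1
  have g0 := hE m (Or.inl rfl)
  have g1 := hE (X.rot m) (Or.inr (Or.inl rfl))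
  have g2 := hE (X.rot (X.rot m)) (Or.inr (Or.inr rfl))
  have hee : ∀ u, Y.Four u → Y.Four (X.edge u) → Z.edge u = X.edge u := by
    intro u hu hu'
    rw [← h.edge] at hu' ⊢
    exact he u hu hu'
  rw [hee m fY g0, r1, hee _ f1 g1, (hrX _ g1).1] at e0
  rw [r1, hee _ f1 g1, r2, hee _ f2 g2, (hrX _ g2).1] at e1
  exact ⟨wm, (h.four_iff.1 fY).1, (h.four_iff.1 g0).1, e0, e1⟩

/-- Let the removal of a straight cycle of length 2 disconnect its sides.  If the side of `a` is not
just an edge, and has two melons after forgetting the cut, then one of them does not use the cut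
edge and is a melon of the original map.  If the side is an edge, then it closes the dipole to a
melon. -/
theorem Clean.exists_melon_on_side (hX : X.Clean) {δ : X.Dip} {Y Z : BMap D}
    (h : δ.IsRemoval Y) (hO : X.rot δ.p = δ.a) (hr : Z.rot = Y.rot) (hw : Z.white = Y.white)
    (he : ∀ u, Y.Four u → Y.Four (Y.edge u) → Z.edge u = Y.edge u)
    (hc : ∀ u v, Y.Four u → Y.Four v → (Z.Conn u v ↔ Y.Conn u v)) (hab : ¬ Y.Conn δ.a δ.b)
    (hT : ∀ t, Y.Four t → Y.Conn t δ.a → Z.TwoMelons t) :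
    ∃ m, X.IsMelon m ∧ X.Conn m δ.p ∧ (m = δ.p ∨ Y.Conn m δ.a ∧ Y.Four m) := by
  have hnd := δ.nodup
  simp only [List.nodup_cons, List.mem_cons, not_or, List.not_mem_nil, not_false_eq_true] at hnd
  obtain ⟨t1, t2, s3, s4, -, -⟩ := h.swaps
  have hap : X.Conn δ.a δ.p := δ.conn_p (by simp [Dip.mem_darts])
  have hfour : ∀ u, Y.Conn u δ.a → X.Four u := fun u hu =>
    (hX.four_of_conn ((h.conn hu).trans hap)).2 δ.four_p
  have hmem : ∀ u, Y.Conn u δ.a → ¬ Y.Four u → u = δ.a ∨ u = δ.d := by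
    intro u hu hf
    have hd : u ∈ δ.darts := by
      by_contra hd
      exact hf (h.four_iff.2 ⟨hfour u hu, hd⟩)
    have np : u = δ.p ∨ u = δ.p' → False := by
      intro h
      have := (hu.invariant (P := fun u => u = δ.p ∨ u = δ.p') t1 s3).1 h
      tauto
    have nq : u = δ.q ∨ u = δ.q' → False := by
      intro h
      have := (hu.invariant (P := fun u => u = δ.q ∨ u = δ.q') t2 s4).1 h
      tauto
    have hcb := conn_rot (X := Y) δ.b
    rw [h.rot_b] at hcb
    rw [Dip.mem_darts] at hd
    rcases hd with hd | hd | hd | hd | hd | hd | hd | hd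
    · exact (np (Or.inl hd)).elim
    · exact (nq (Or.inl hd)).elim
    · exact Or.inl hd
    · subst hd; exact (hab hu.symm).elim
    · exact (np (Or.inr hd)).elim
    · exact (nq (Or.inr hd)).elim
    · subst hd; exact (hab (hu.symm.trans hcb)).elim
    · exact Or.inr hd
  have hwa := δ.whites.2.2.1
  by_cases hex : ∃ t, Y.Four t ∧ Y.Conn t δ.a
  · obtain ⟨t, ft, ct⟩ := hex
    -- the edge towards `d` is the only one of this side on which a vertex of degree 2 lies
    obtain ⟨m, cm, hm, h1, h2, h3⟩ := (hT t ft ct).exists_avoiding (X.edge δ.d)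
    have fm : Y.Four m := (four_congr hr m).1 hm.2.1
    have cm' : Y.Conn m δ.a := ((hc m t fm ft).1 cm).trans ct
    have hd0 := (h.four_iff.1 fm).2
    have r1 : Z.rot m = X.rot m := by rw [hr, h.rot_of_notMem m hd0]
    have hd1 : X.rot m ∉ δ.darts := fun h => hd0 (δ.rot_mem.1 h)
    have r2 : Z.rot (X.rot m) = X.rot (X.rot m) := by rw [hr, h.rot_of_notMem _ hd1]
    rw [r1] at h2 h3
    rw [r2] at h3
    have c1 : Y.Conn (X.rot m) δ.a := by
      rw [← r1, hr]; exact (conn_rot m).trans cm'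
    have c2 : Y.Conn (X.rot (X.rot m)) δ.a := by
      rw [← r2, hr]; exact (conn_rot _).trans c1
    have wm : X.white m := by have := hm.1; rwa [hw, h.white] at this
    have w1 := (white_rot (hfour m cm')).2 wm
    have w2 := (white_rot (hfour _ c1)).2 w1
    refine ⟨m, h.isMelon hr hw he hm fun u hu => ?_, (h.conn cm').trans hap, Or.inr ⟨cm', fm⟩⟩
    have cu : Y.Conn u δ.a := by rcases hu with rfl | rfl | rfl <;> assumption
    have wu : X.white u := by rcases hu with rfl | rfl | rfl <;> assumption
    have hu' : u ≠ X.edge δ.d := by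
      rcases hu with rfl | rfl | rfl
      exacts [h1.symm, h2.symm, h3.symm]
    by_contra hf
    have ce : Y.Conn (X.edge u) δ.a := by
      rw [← h.edge]; exact (conn_edge u).trans cu
    rcases hmem _ ce hf with h4 | h4
    · have := (X.white_edge u).1 (by rw [h4]; exact hwa)
      exact this wu
    · exact hu' (by rw [← h4, X.edge_edge])
  · -- the side is closed by an edge, and the dipole is part of a melon
    push Not at hex
    have ce : Y.Conn (X.edge δ.a) δ.a := by rw [← h.edge]; exact conn_edge δ.a
    have had : X.edge δ.a = δ.d := by
      rcases hmem _ ce (fun hf => hex _ hf ce) with h4 | h4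
      · exact (edge_ne _ h4).elim
      · exact h4
    refine ⟨δ.p, ⟨δ.white_p, δ.four_p, ?_, ?_, ?_⟩, rfl, Or.inl rfl⟩
    · rw [δ.edge_p]; exact δ.four_p'
    · rcases δ.shape with hs | hs
      · exact absurd (hs.1.symm.trans hO) (by tauto)
      · rw [hO, had, hs.2.2.2.2.2.2.2, δ.edge_p]
    · rcases δ.shape with hs | hs
      · exact absurd (hs.1.symm.trans hO) (by tauto)
      · rw [hO, had, hs.2.1, δ.edge_q, hs.2.2.2.2.2.2.1]

/-- The dipole of a straight cycle of length 2. -/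
def straightDip (X : BMap D) (p : D) (hw : X.white p) (hf : X.Four p) (hf' : X.Four (X.edge p))
    (hp : X.edge (X.rot (X.rot p)) = X.rot (X.rot (X.edge p))) : X.Dip where
  p := p
  q := X.rot (X.rot p)
  a := X.rot p
  b := X.rot (X.rot (X.rot p))
  p' := X.edge p
  q' := X.edge (X.rot (X.rot p))
  c := X.rot (X.edge p)
  d := X.rot (X.rot (X.rot (X.edge p)))
  white_p := hw
  four_p := hf
  four_p' := hf'
  edge_p := rfl
  edge_q := rfl
  shape := Or.inr ⟨rfl, rfl, rfl, X.rot_four p, rfl, hp.symm, by rw [hp], X.rot_four _⟩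

/-- The dipole of a straight cycle of length 2 with its two sides exchanged. -/
theorem Dip.IsRemoval.exists_flip {δ : X.Dip} {Y : BMap D} (h : δ.IsRemoval Y)
    (hO : X.rot δ.p = δ.a) : ∃ ε : X.Dip, ε.p = δ.q ∧ ε.a = δ.b ∧ ε.b = δ.a ∧ ε.IsRemoval Y ∧
      X.rot ε.p = ε.a := by
  have hs : X.rot δ.p = δ.a ∧ X.rot δ.a = δ.q ∧ X.rot δ.q = δ.b ∧ X.rot δ.b = δ.p ∧
      X.rot δ.p' = δ.c ∧ X.rot δ.c = δ.q' ∧ X.rot δ.q' = δ.d ∧ X.rot δ.d = δ.p' := by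
    rcases δ.shape with hs | hs
    · have hnd := δ.nodup
      simp only [List.nodup_cons, List.mem_cons, not_or] at hnd
      exact absurd (hs.1.symm.trans hO) (by tauto)
    · exact hs
  refine ⟨{ p := δ.q, q := δ.p, a := δ.b, b := δ.a, p' := δ.q', q' := δ.p', c := δ.d, d := δ.c
            white_p := δ.whites.2.1
            four_p := δ.fours (by simp [Dip.mem_darts])
            four_p' := δ.fours (by simp [Dip.mem_darts])
            edge_p := δ.edge_q
            edge_q := δ.edge_p
            shape := Or.inr ⟨hs.2.2.1, hs.2.2.2.1, hs.1, hs.2.1, hs.2.2.2.2.2.2.1,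
              hs.2.2.2.2.2.2.2, hs.2.2.2.2.1, hs.2.2.2.2.2.1⟩ }, rfl, rfl, rfl,
    ⟨h.edge, h.white, h.rot_b, h.rot_c, h.rot_a, h.rot_d, h.rot_q, h.rot_q', h.rot_p, h.rot_p',
      fun u hu => h.rot_of_notMem u fun hu' => hu ?_⟩, hs.2.2.1⟩
  rw [Dip.mem_darts] at hu' ⊢
  tauto

/-- **Excess and melons.** The number of components other than rings without a pair of melons is at
most a quarter of the excess.  In particular the excess is nonnegative, and if it vanishes then
every component other than a ring contains two melons. -/
theorem Clean.four_mul_card_le [Finite D] (hX : X.Clean) (T : Finset D)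
    (hT : ∀ t ∈ T, X.Four t) (hT' : ∀ s ∈ T, ∀ t ∈ T, X.Conn s t → s = t)
    (hT'' : ∀ t ∈ T, ¬ X.TwoMelons t) : (4 * T.card : ℤ) ≤ X.excess := by
  classical
  induction hn : Nat.card {d // X.Four d} using Nat.strong_induction_on generalizing X T with
  | _ n ih =>
  -- induction on the number of half-edges at vertices of degree 4, by removing a straight cycle of
  -- length 2 as long as there is one
  by_cases hO : ∀ p, X.white p → X.Four p → X.edge (X.rot (X.rot p)) ≠ X.rot (X.rot (X.edge p))
  · exact hX.four_mul_card_le_of_forall_ne hO T hT hT'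
  push Not at hO
  obtain ⟨p, wp, fp, hp⟩ := hO
  obtain ⟨δ, rfl, hOδ⟩ : ∃ δ : X.Dip, δ.p = p ∧ X.rot δ.p = δ.a :=
    ⟨X.straightDip p wp fp (hX.four_edge.2 fp) hp, rfl, rfl⟩
  clear hp wp fp
  obtain ⟨Y, h, hY⟩ := δ.exists_removal
  obtain ⟨Z, hZ, hr, hw, hE, he, hc⟩ := exists_clean Y
  have h4 : Nat.card {d // Z.Four d} < n := by
    have := Dip.card_four_of_isRemoval h
    have h5 : Nat.card {d // Z.Four d} = Nat.card {d // Y.Four d} :=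
      Nat.card_congr (Equiv.subtypeEquivRight (four_congr hr))
    omega
  have hZX : ∀ u v, Y.Four u → Y.Four v → Z.Conn u v → X.Conn u v := fun u v hu hv huv =>
    h.conn ((hc u v hu hv).1 huv)
  -- melons of components that do not contain the dipole are not affected
  have hmel : ∀ t, X.Four t → ¬ X.Conn t δ.p → Z.TwoMelons t → X.TwoMelons t := by
    rintro t ft ct ⟨m, m', hne, cm, cm', hm, hm'⟩
    have ft' : Y.Four t := h.four_of_not_conn ft ct
    have key : ∀ m, Z.IsMelon m → Z.Conn m t → X.Conn m t ∧ X.IsMelon m := by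
      intro m hm cm
      have fm : Y.Four m := (four_congr hr m).1 hm.2.1
      have cX := hZX m t fm ft' cm
      refine ⟨cX, h.isMelon hr hw he hm fun u hu => ?_⟩
      have cu : X.Conn (X.edge u) t := by
        refine (conn_edge u).trans (Conn.trans ?_ cX)
        rcases hu with rfl | rfl | rfl
        exacts [rfl, conn_rot m, (conn_rot _).trans (conn_rot m)]
      exact h.four_of_not_conn ((hX.four_of_conn cu).2 ft) fun hcu => ct (cu.symm.trans hcu)
    exact ⟨m, m', hne, (key m hm cm).1, (key m' hm' cm').1, (key m hm cm).2, (key m' hm' cm').2⟩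
  -- the induction hypothesis for representatives of the components away from the dipole and at most
  -- one further component that the removal leaves
  have key : ∀ T' : Finset D, (∀ t ∈ T', t ∈ T ∧ ¬ X.Conn t δ.p ∨
      Y.Four t ∧ ¬ Z.TwoMelons t ∧ X.Conn t δ.p) →
      (∀ s ∈ T', ∀ t ∈ T', X.Conn s δ.p → X.Conn t δ.p → s = t) → (4 * T'.card : ℤ) ≤ Y.excess := by
    intro T' hT1 hT2
    have hf : ∀ t ∈ T', Y.Four t := by
      intro t ht
      rcases hT1 t ht with ⟨h1, h2⟩ | ⟨h1, -⟩
      exacts [h.four_of_not_conn (hT t h1) h2, h1]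
    rw [← hE]
    refine ih _ h4 hZ T' (fun t ht => (four_congr hr t).2 (hf t ht)) ?_ ?_ rfl
    · intro s hs t ht hst
      have hst' := hZX s t (hf s hs) (hf t ht) hst
      rcases hT1 s hs with ⟨h1, h2⟩ | ⟨-, -, h1⟩
      · rcases hT1 t ht with ⟨h3, -⟩ | ⟨-, -, h3⟩
        · exact hT' s h1 t h3 hst'
        · exact (h2 (hst'.trans h3)).elim
      · exact hT2 s hs t ht h1 (hst'.symm.trans h1)
    · intro t ht h1
      rcases hT1 t ht with ⟨h2, h3⟩ | ⟨-, h2, -⟩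
      · exact hT'' t h2 (hmel t (hT t h2) h3 h1)
      · exact h2 h1
  by_cases ht0 : ∃ t0 ∈ T, X.Conn t0 δ.p
  · obtain ⟨t0, ht0, hc0⟩ := ht0
    have hcard : (T.erase t0).card + 1 = T.card := Finset.card_erase_add_one ht0
    have herase : ∀ t ∈ T.erase t0, t ∈ T ∧ ¬ X.Conn t δ.p := by
      intro t ht
      rw [Finset.mem_erase] at ht
      exact ⟨ht.2, fun hc => ht.1 (hT' t ht.2 t0 ht0 (hc.trans hc0.symm))⟩
    -- if the sides get disconnected, then some component on one of the sides does not have two melons,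
    -- for otherwise each side would provide a melon of the component of `t0`; if the sides remain
    -- connected, then the loss of excess makes up for the component of `t0`
    rcases hY with ⟨hab, -, hE'⟩ | ⟨-, -, hE'⟩
    · have hex : ∃ t1, Y.Four t1 ∧ ¬ Z.TwoMelons t1 ∧ X.Conn t1 δ.p := by
        by_contra hno
        push Not at hno
        have hab' : ∀ u ∈ δ.darts, ∀ t, Y.Conn t u → X.Conn t δ.p := fun u hu t ht =>
          (h.conn ht).trans (δ.conn_p hu)
        obtain ⟨m, hm, cm, hm'⟩ := hX.exists_melon_on_side h hOδ hr hw he hc hab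
          fun t ft ct => by
            by_contra h2; exact hno t ft h2 (hab' δ.a (by simp [Dip.mem_darts]) t ct)
        obtain ⟨ε, hε1, hε2, hε3, h', hOε⟩ := h.exists_flip hOδ
        obtain ⟨n, hn, cn, hn'⟩ := hX.exists_melon_on_side h' hOε hr hw he hc
          (by rw [hε2, hε3]; exact fun h => hab h.symm)
          fun t ft ct => by
            rw [hε2] at ct
            by_contra h2; exact hno t ft h2 (hab' δ.b (by simp [Dip.mem_darts]) t ct)
        rw [hε1] at cn hn'
        rw [hε2] at hn'
        have hqp : X.Conn δ.q δ.p := δ.conn_p (by simp [Dip.mem_darts])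
        refine hT'' t0 ht0 ⟨m, n, ?_, cm.trans hc0.symm, (Conn.trans cn hqp).trans hc0.symm, hm, hn⟩
        rintro rfl
        have hp' : ¬ Y.Four δ.p := h.not_four (by simp [Dip.mem_darts])
        have hq' : ¬ Y.Four δ.q := h.not_four (by simp [Dip.mem_darts])
        rcases hm' with h1 | ⟨h1, h1'⟩ <;> rcases hn' with h2 | ⟨h2, h2'⟩
        · have hnd := δ.nodup
          simp only [List.nodup_cons, List.mem_cons, not_or] at hnd
          exact hnd.1.1 (h1.symm.trans h2)
        · exact hp' (h1 ▸ h2')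
        · exact hq' (h2 ▸ h1')
        · exact hab (h1.symm.trans h2)
      obtain ⟨t1, f1, hn1, c1⟩ := hex
      have hnot : t1 ∉ T.erase t0 := fun h1 => (herase t1 h1).2 c1
      have := key (insert t1 (T.erase t0)) (fun t ht => ?_) (fun s hs t ht cs ct => ?_)
      · rw [Finset.card_insert_of_notMem hnot, hcard] at this
        omega
      · rcases Finset.mem_insert.1 ht with rfl | ht
        · exact Or.inr ⟨f1, hn1, c1⟩
        · exact Or.inl (herase t ht)
      · rcases Finset.mem_insert.1 hs with rfl | hs
        · rcases Finset.mem_insert.1 ht with rfl | ht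
          · rfl
          · exact ((herase t ht).2 ct).elim
        · exact ((herase s hs).2 cs).elim
    · have := key (T.erase t0) (fun t ht => Or.inl (herase t ht))
        (fun s hs t ht cs ct => ((herase s hs).2 cs).elim)
      omega
  · push Not at ht0
    have := key T (fun t ht => Or.inl ⟨ht, ht0 t ht⟩) (fun s hs t ht cs _ => (ht0 s hs cs).elim)
    rcases hY with ⟨-, -, hE'⟩ | ⟨-, -, hE'⟩ <;> omega

end BMap
end MatrixModel

namespace MatrixModel
open Equiv

/-! ### Pieces of the square lattice -/

/-- Let `r` and `e` be the rotation and the edge involution of a map whose vertices have degree 4,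
with the translations `t = r² e` and `s = r t r⁻¹`.  If faces and straight cycles close up after four
steps at the half-edges `r ^ k t ^ i s ^ j d`, then these half-edges form the component of `d`, a
quotient of the torus of size 4 by 4.  The conclusion is stated for a property `P` of the listed
half-edges: it holds on an invariant set that contains `d`. -/
theorem exists_eq_of_locally_square {D : Type*} {r e t s : Perm D} (hr : r ^ 4 = 1) (he : e * e = 1)
    (ht : t = r * r * e) (hs : s = r * t * r⁻¹) {d : D}
    (h : ∀ k < 4, ∀ i < 4, ∀ j < 4, (t ^ 4) ((r ^ k * t ^ i * s ^ j) d) = (r ^ k * t ^ i * s ^ j) d ∧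
      ((r * e) ^ 4) ((r ^ k * t ^ i * s ^ j) d) = (r ^ k * t ^ i * s ^ j) d)
    {P : D → Prop} (hP : ∀ k < 4, ∀ i < 4, ∀ j < 4, P ((r ^ k * t ^ i * s ^ j) d)) :
    ∃ N : D → Prop, N d ∧ (∀ u, N u → N (r u)) ∧ (∀ u, N u → N (e u)) ∧ ∀ u, N u → P u := by
  have hri : r⁻¹ = r ^ 3 := by rw [inv_eq_iff_mul_eq_one, ← pow_succ', hr]
  have hei : e⁻¹ = e := by rw [inv_eq_iff_mul_eq_one, he]
  have hsr : s * r = r * t := by rw [hs]; group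
  have hti : t⁻¹ = e * (r * r) := by
    rw [ht, mul_inv_rev, mul_inv_rev, hei, hri]
    have : r ^ 3 * r ^ 3 = r * r := by
      rw [← pow_add, show 3 + 3 = 4 + 2 by rfl, pow_add, hr, one_mul, pow_two]
    rw [this]
  have hrs : r * s = t⁻¹ * r := by
    rw [hti, hs, ht, hri]
    have : r * (r * (r * r * e) * r ^ 3) = r ^ 4 * (e * r ^ 3) := by
      simp only [pow_succ, pow_zero, one_mul, mul_assoc]
    rw [this, hr, one_mul]
    simp only [pow_succ, pow_zero, one_mul, mul_assoc]
  have htr : t * r = r * s⁻¹ := by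
    rw [eq_mul_inv_iff_mul_eq, mul_assoc, hrs, mul_inv_cancel_left]
  -- the half-edges `t ^ i s ^ j d`
  let A : D → Prop := fun u => ∃ i j, j < 4 ∧ u = (t ^ i) ((s ^ j) d)
  have hA4 : ∀ j < 4, ∀ i, (t ^ i) ((s ^ j) d) = (t ^ (i % 4)) ((s ^ j) d) := by
    intro j hj i
    have h1 : (t ^ 4) ((s ^ j) d) = (s ^ j) d := by
      simpa using (h 0 (by norm_num) 0 (by norm_num) j hj).1
    have h2 : ∀ q, ((t ^ 4) ^ q) ((s ^ j) d) = (s ^ j) d := by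
      intro q
      induction q with
      | zero => rfl
      | succ q ih => rw [pow_succ, Perm.mul_apply, h1, ih]
    conv_lhs => rw [← Nat.mod_add_div i 4, pow_add, Perm.mul_apply, pow_mul, h2]
  have hAgood : ∀ u, A u → ∃ i < 4, ∃ j < 4, u = (t ^ i * s ^ j) d := by
    rintro u ⟨i, j, hj, rfl⟩
    exact ⟨i % 4, Nat.mod_lt _ (by norm_num), j, hj, hA4 j hj i⟩
  have hAt4 : ∀ u, A u → (t ^ 4) u = u := by
    intro u hu
    obtain ⟨i, hi, j, hj, rfl⟩ := hAgood u hu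
    simpa [mul_assoc] using (h 0 (by norm_num) i hi j hj).1
  have hAs4 : ∀ u, A u → (s ^ 4) u = u := by
    intro u hu
    obtain ⟨i, hi, j, hj, rfl⟩ := hAgood u hu
    have h1 := (h 3 (by norm_num) i hi j hj).1
    rw [← hri, mul_assoc, Perm.mul_apply] at h1
    have h2 : s ^ 4 = r * t ^ 4 * r⁻¹ := by rw [hs, conj_pow]
    rw [h2, Perm.mul_apply, Perm.mul_apply, h1, ← Perm.mul_apply, mul_inv_cancel, Perm.one_apply]
  -- the translations commute at `u` if the face at `u` has length 4
  have hcomm : ∀ u, A u → t (s u) = s (t u) := by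
    intro u hu
    obtain ⟨i, hi, j, hj, rfl⟩ := hAgood u hu
    have h1 := (h 0 (by norm_num) i hi j hj).2
    simp only [pow_zero, one_mul] at h1
    set v := (t ^ i * s ^ j) d
    have h2 : (t * s)⁻¹ * (s * t) = (r * e) ^ 4 := by
      have ee : ∀ x, e * (e * x) = x := fun x => by rw [← mul_assoc, he, one_mul]
      have r4 : ∀ x, r * (r * (r * (r * x))) = x := fun x => by
        have : r * (r * (r * (r * x))) = r ^ 4 * x := by
          simp only [pow_succ, pow_zero, one_mul, mul_assoc]
        rw [this, hr, one_mul]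
      rw [inv_mul_eq_iff_eq_mul, hs, ht]
      simp only [pow_succ, pow_zero, one_mul, mul_assoc, inv_mul_cancel_left, ee, r4]
    have h5 : ((t * s)⁻¹ * (s * t)) v = v := by rw [h2, h1]
    rw [Perm.mul_apply, Perm.inv_eq_iff_eq] at h5
    exact h5.symm
  have hAt : ∀ u, A u → A (t u) := by
    rintro u ⟨i, j, hj, rfl⟩
    exact ⟨i + 1, j, hj, by rw [pow_succ', Perm.mul_apply]⟩
  have hAs' : ∀ j < 4, ∀ i, s ((t ^ i) ((s ^ j) d)) = (t ^ i) ((s ^ (j + 1)) d) := by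
    intro j hj i
    induction i with
    | zero => simp [pow_succ']
    | succ i ih =>
      rw [pow_succ', Perm.mul_apply, Perm.mul_apply, ← hcomm _ ⟨i, j, hj, rfl⟩, ih]
  have hAs : ∀ u, A u → A (s u) := by
    rintro u ⟨i, j, hj, rfl⟩
    rw [hAs' j hj i]
    rcases Nat.lt_or_ge (j + 1) 4 with h1 | h1
    · exact ⟨i, j + 1, h1, rfl⟩
    · refine ⟨i, 0, by norm_num, ?_⟩
      rw [show j + 1 = 4 by omega, hAs4 d ⟨0, 0, by norm_num, rfl⟩]
      rfl
  have hinv : ∀ (g : Perm D), (∀ u, A u → A (g u)) → (∀ u, A u → (g ^ 4) u = u) →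
      ∀ u, A u → A (g⁻¹ u) := by
    intro g h1 h2 u hu
    have h3 : g⁻¹ u = g (g (g u)) := by
      rw [Perm.inv_eq_iff_eq]
      exact (h2 u hu).symm
    rw [h3]
    exact h1 _ (h1 _ (h1 _ hu))
  -- conjugation by `r` permutes the translations `t`, `s`, `t⁻¹` and `s⁻¹`
  have key : ∀ k : ℕ, (∀ u, A u → ∃ v, A v ∧ t ((r ^ k) u) = (r ^ k) v) ∧
      (∀ u, A u → ∃ v, A v ∧ s ((r ^ k) u) = (r ^ k) v) ∧
      (∀ u, A u → ∃ v, A v ∧ t⁻¹ ((r ^ k) u) = (r ^ k) v) ∧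
      (∀ u, A u → ∃ v, A v ∧ s⁻¹ ((r ^ k) u) = (r ^ k) v) := by
    intro k
    induction k with
    | zero =>
      exact ⟨fun u hu => ⟨_, hAt u hu, rfl⟩, fun u hu => ⟨_, hAs u hu, rfl⟩,
        fun u hu => ⟨_, hinv t hAt hAt4 u hu, rfl⟩, fun u hu => ⟨_, hinv s hAs hAs4 u hu, rfl⟩⟩
    | succ k ih =>
      obtain ⟨ih1, ih2, ih3, ih4⟩ := ih
      have step : ∀ g g' : Perm D, g * r = r * g' →
          (∀ u, A u → ∃ v, A v ∧ g' ((r ^ k) u) = (r ^ k) v) →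
          ∀ u, A u → ∃ v, A v ∧ g ((r ^ (k + 1)) u) = (r ^ (k + 1)) v := by
        intro g g' hg hg' u hu
        obtain ⟨v, hv, hv'⟩ := hg' u hu
        refine ⟨v, hv, ?_⟩
        rw [pow_succ', Perm.mul_apply, Perm.mul_apply, ← hv', ← Perm.mul_apply, hg,
          Perm.mul_apply]
      refine ⟨step t s⁻¹ htr ih4, step s t hsr ih1, step t⁻¹ s hrs.symm ih2, step s⁻¹ t⁻¹ ?_ ih3⟩
      rw [inv_mul_eq_iff_eq_mul, ← mul_assoc, hsr, mul_inv_cancel_right]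
  refine ⟨fun u => ∃ k v, A v ∧ u = (r ^ k) v, ⟨0, d, ⟨0, 0, by norm_num, rfl⟩, rfl⟩, ?_, ?_, ?_⟩
  · rintro u ⟨k, v, hv, rfl⟩
    exact ⟨k + 1, v, hv, by rw [pow_succ', Perm.mul_apply]⟩
  · rintro u ⟨k, v, hv, rfl⟩
    obtain ⟨w, hw, hw'⟩ := (key k).1 v hv
    refine ⟨k + 2, w, hw, ?_⟩
    have h1 : e = r ^ 2 * t := by
      rw [ht, ← mul_assoc, ← pow_two, ← pow_add, hr, one_mul]
    rw [add_comm, pow_add, Perm.mul_apply, ← hw', ← Perm.mul_apply (r ^ 2), ← h1]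
  · rintro u ⟨k, v, hv, rfl⟩
    obtain ⟨i, hi, j, hj, rfl⟩ := hAgood v hv
    have h1 : r ^ k = r ^ (k % 4) := by
      conv_lhs => rw [← Nat.mod_add_div k 4, pow_add, pow_mul, hr, one_pow, mul_one]
    rw [h1, ← Perm.mul_apply, ← mul_assoc]
    exact hP _ (Nat.mod_lt _ (by norm_num)) i hi j hj

end MatrixModel

namespace MatrixModel
open Equiv
namespace BMap

/-! ### Counting half-edges at vertices of degree 4 -/

variable {D : Type*} {X : BMap D}

/-- A ring has at most two half-edges, hence a contribution of at least `24 / 2 - 8 / 1 - 8 / 2`. -/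
theorem Clean.weight_nonneg_of_not_four [Finite D] (hX : X.Clean) {d : D} (hd : ¬ X.Four d) :
    0 ≤ X.weight d := by
  classical
  have h1 : Nat.card {x // X.Conn x d} ≤ 2 := by
    have : {x | X.Conn x d} ⊆ ({d, X.rot d} : Set D) := fun u hu =>
      hX.card_class_of_not_four hd u hu
    exact (Set.ncard_le_ncard this (Set.toFinite _)).trans (Set.ncard_pair (rot_ne d).symm).le
  have h1' : 0 < Nat.card {x // X.Conn x d} := Nat.card_pos_iff.2 ⟨⟨⟨d, rfl⟩⟩, inferInstance⟩
  have h2 := card_le_card_class (r := fun x y => y = (X.rot * X.edge) x) (d := d) {d} (by simp)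
  have h3 := card_le_card_class (r := orbRel X.opp X.edge) (d := d) {d, X.edge d}
    (by simp [orbRel_snd])
  rw [Finset.card_singleton] at h2
  rw [Finset.card_pair (edge_ne d).symm] at h3
  unfold weight
  rw [if_neg hd]
  have k1 : (12 : ℚ) ≤ 24 / (Nat.card {x // X.Conn x d} : ℚ) := by
    rw [le_div_iff₀ (by exact_mod_cast h1')]
    have : (Nat.card {x // X.Conn x d} : ℚ) ≤ 2 := by exact_mod_cast h1
    linarith
  have k2 : 8 / (Nat.card {x // cls (X.rot * X.edge) x = cls (X.rot * X.edge) d} : ℚ) ≤ 8 := by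
    apply div_le_self (by norm_num)
    exact_mod_cast h2
  have k3 : 8 / (Nat.card {x // Quot.mk (orbRel X.opp X.edge) x =
      Quot.mk (orbRel X.opp X.edge) d} : ℚ) ≤ 4 := by
    have : (2 : ℚ) ≤ Nat.card {x // Quot.mk (orbRel X.opp X.edge) x =
      Quot.mk (orbRel X.opp X.edge) d} := by exact_mod_cast h3
    rw [div_le_iff₀ (by linarith)]
    linarith
  linarith

/-- Lower bound for the contribution of a half-edge on a face of length at least `m` and a straight
cycle of at least `n` half-edges. -/
theorem le_weight {d : D} (hd : X.Four d) {m n : ℚ} (hm : 0 < m) (hn : 0 < n)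
    (h1 : m ≤ Nat.card {x // cls (X.rot * X.edge) x = cls (X.rot * X.edge) d})
    (h2 : n ≤ Nat.card {x // Quot.mk (orbRel X.opp X.edge) x =
      Quot.mk (orbRel X.opp X.edge) d}) : 3 - 8 / m - 8 / n ≤ X.weight d := by
  unfold weight
  rw [if_pos hd]
  have k1 : (0 : ℚ) ≤ 24 / (Nat.card {x // X.Conn x d} : ℚ) := by positivity
  have k2 := div_le_div_of_nonneg_left (show (0 : ℚ) ≤ 8 by norm_num) hm h1
  have k3 := div_le_div_of_nonneg_left (show (0 : ℚ) ≤ 8 by norm_num) hn h2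
  linarith

/-- The next half-edge on the face. -/
def face (X : BMap D) : Perm D := X.rot * X.edge

theorem Clean.four_face (hX : X.Clean) {d : D} : X.Four (X.face d) ↔ X.Four d := by
  rw [face, Perm.mul_apply, four_rot, hX.four_edge]

theorem Clean.white_face (hX : X.Clean) {d : D} (hd : X.Four d) :
    X.white (X.face d) ↔ ¬ X.white d := by
  rw [face, Perm.mul_apply, white_rot (hX.four_edge.2 hd), X.white_edge]

theorem Clean.two_le_face [Finite D] (hX : X.Clean) {d : D} (hd : X.Four d) :
    2 ≤ Nat.card {x // cls (X.rot * X.edge) x = cls (X.rot * X.edge) d} := by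
  classical
  have w1 := hX.white_face hd
  have h := card_le_card_class (r := fun x y => y = (X.rot * X.edge) x) (d := d) {d, X.face d}
    (by
      simp only [Finset.mem_insert, Finset.mem_singleton, forall_eq_or_imp, forall_eq, true_and]
      exact cls_apply (X.rot * X.edge) d)
  rw [Finset.card_pair] at h
  · exact h
  · intro h; rw [← h] at w1; exact iff_not_self w1

/-- A face of length other than 2 has length at least 4, because its length is even. -/
theorem Clean.face_card [Finite D] (hX : X.Clean) {d : D} (hd : X.Four d)
    (h2 : X.face (X.face d) ≠ d) :
    4 ≤ Nat.card {x // cls (X.rot * X.edge) x = cls (X.rot * X.edge) d} ∧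
    ((X.face ^ 4) d ≠ d →
      5 ≤ Nat.card {x // cls (X.rot * X.edge) x = cls (X.rot * X.edge) d}) := by
  classical
  set f := X.face with hf
  have f1 : X.Four (f d) := hX.four_face.2 hd
  have f2 : X.Four (f (f d)) := hX.four_face.2 f1
  have w1 : X.white (f d) ↔ ¬ X.white d := hX.white_face hd
  have w2 : X.white (f (f d)) ↔ ¬ X.white (f d) := hX.white_face f1
  have w3 : X.white (f (f (f d))) ↔ ¬ X.white (f (f d)) := hX.white_face f2
  have hW : ∀ {x y}, (X.white x ↔ ¬ X.white y) → x ≠ y := by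
    rintro x y h rfl; exact iff_not_self h
  have c : ∀ u, cls f (f u) = cls f u := cls_apply f
  have i : ∀ {x y}, f x = f y → x = y := fun h => f.injective h
  have n01 : d ≠ f d := (hW w1).symm
  have n03 : d ≠ f (f (f d)) := (hW (by tauto)).symm
  have n12 : f d ≠ f (f d) := fun h => n01 (i h)
  have n13 : f d ≠ f (f (f d)) := fun h => h2 (i h).symm
  have n23 : f (f d) ≠ f (f (f d)) := fun h => n01 (i (i h))
  have h4 := card_eq_four ⟨n01, Ne.symm h2, n03, n12, n13, n23⟩
  constructor
  · rw [← h4]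
    exact card_le_card_class (r := fun x y => y = (X.rot * X.edge) x) _
      (by simpa using ⟨c d, (c _).trans (c d), (c _).trans ((c _).trans (c d))⟩)
  · intro h5
    have h6 : (f ^ 4) d = f (f (f (f d))) := rfl
    rw [h6] at h5
    have h7 : (insert (f (f (f (f d)))) ({d, f d, f (f d), f (f (f d))} : Finset D)).card = 5 := by
      rw [Finset.card_insert_of_notMem, h4]
      simp only [Finset.mem_insert, Finset.mem_singleton, not_or]
      exact ⟨h5, fun h => n03 (i h).symm, fun h => h2 (i (i h)), fun h => n01 (i (i (i h))).symm⟩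
    rw [← h7]
    exact card_le_card_class (r := fun x y => y = (X.rot * X.edge) x) _
      (by simpa using ⟨(c _).trans ((c _).trans ((c _).trans (c d))), c d, (c _).trans (c d),
        (c _).trans ((c _).trans (c d))⟩)

theorem four_le_straight [Finite D] {d : D} (hd : X.Four d) :
    4 ≤ Nat.card {x // Quot.mk (orbRel X.opp X.edge) x = Quot.mk (orbRel X.opp X.edge) d} := by
  classical
  have hW : ∀ {x y}, (X.white x ↔ ¬ X.white y) → x ≠ y := by
    rintro x y h rfl; exact iff_not_self h
  have w1 := white_opp hd
  have w2 := X.white_edge d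
  have w3 := X.white_edge (X.opp d)
  have h4 := card_eq_four (x := d) (y := X.opp d) (z := X.edge d) (w := X.edge (X.opp d))
    ⟨(opp_ne d).symm, hW (by tauto), hW (by tauto), hW (by tauto), hW (by tauto),
      fun h => opp_ne d (X.edge.injective h).symm⟩
  rw [← h4]
  exact card_le_card_class _ (by simp [orbRel_fst, orbRel_snd])

/-- A straight cycle of length other than 2 and 4 has more than 8 half-edges. -/
theorem Clean.nine_le [Finite D] (hX : X.Clean) {d : D} (hd : X.Four d)
    (h2 : ((X.opp * X.edge) ^ 2) d ≠ d) (h4 : ((X.opp * X.edge) ^ 4) d ≠ d) :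
    9 ≤ Nat.card {x // Quot.mk (orbRel X.opp X.edge) x = Quot.mk (orbRel X.opp X.edge) d} := by
  classical
  obtain ⟨o, ho⟩ : ∃ o, o = X.opp := ⟨_, rfl⟩
  obtain ⟨e, he⟩ : ∃ e, e = X.edge := ⟨_, rfl⟩
  have oo : ∀ x, o (o x) = x := by rw [ho]; exact opp_opp
  have ee : ∀ x, e (e x) = x := by rw [he]; exact X.edge_edge
  have n0 : ∀ x, o x ≠ x := by rw [ho]; exact opp_ne
  have fo : ∀ {x}, X.Four x → X.Four (o x) := by rw [ho]; exact four_opp.2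
  have fe : ∀ {x}, X.Four x → X.Four (e x) := by rw [he]; exact hX.four_edge.2
  have wo : ∀ {x}, X.Four x → (X.white (o x) ↔ X.white x) := by rw [ho]; exact white_opp
  have we : ∀ {x}, X.Four x → (X.white (e x) ↔ ¬ X.white x) := by
    rw [he]; exact fun {x} _ => X.white_edge x
  have ro : ∀ x, Quot.mk (orbRel X.opp X.edge) (o x) = Quot.mk _ x := by
    rw [ho]; exact orbRel_fst _ _
  have re : ∀ x, Quot.mk (orbRel X.opp X.edge) (e x) = Quot.mk _ x := by
    rw [he]; exact orbRel_snd _ _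
  -- the successive half-edges on the straight path that starts at `d`
  obtain ⟨z1, h1⟩ : ∃ z, z = e d := ⟨_, rfl⟩
  obtain ⟨z2, h2'⟩ : ∃ z, z = o z1 := ⟨_, rfl⟩
  obtain ⟨z3, h3⟩ : ∃ z, z = e z2 := ⟨_, rfl⟩
  obtain ⟨z4, h4'⟩ : ∃ z, z = o z3 := ⟨_, rfl⟩
  obtain ⟨z5, h5⟩ : ∃ z, z = e z4 := ⟨_, rfl⟩
  obtain ⟨z6, h6⟩ : ∃ z, z = o z5 := ⟨_, rfl⟩
  obtain ⟨z7, h7⟩ : ∃ z, z = e z6 := ⟨_, rfl⟩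
  obtain ⟨z8, h8⟩ : ∃ z, z = o z7 := ⟨_, rfl⟩
  have m4 : z4 ≠ d := by rw [h4', h3, h2', h1, ho, he]; exact h2
  have m8 : z8 ≠ d := by rw [h8, h7, h6, h5, h4', h3, h2', h1, ho, he]; exact h4
  have f1 : X.Four z1 := h1 ▸ fe hd
  have f2 : X.Four z2 := h2' ▸ fo f1
  have f3 : X.Four z3 := h3 ▸ fe f2
  have f4 : X.Four z4 := h4' ▸ fo f3
  have f5 : X.Four z5 := h5 ▸ fe f4
  have f6 : X.Four z6 := h6 ▸ fo f5
  have f7 : X.Four z7 := h7 ▸ fe f6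
  have w1 : X.white z1 ↔ ¬ X.white d := h1 ▸ we hd
  have w2 : X.white z2 ↔ X.white z1 := h2' ▸ wo f1
  have w3 : X.white z3 ↔ ¬ X.white z2 := h3 ▸ we f2
  have w4 : X.white z4 ↔ X.white z3 := h4' ▸ wo f3
  have w5 : X.white z5 ↔ ¬ X.white z4 := h5 ▸ we f4
  have w6 : X.white z6 ↔ X.white z5 := h6 ▸ wo f5
  have w7 : X.white z7 ↔ ¬ X.white z6 := h7 ▸ we f6
  have w8 : X.white z8 ↔ X.white z7 := h8 ▸ wo f7
  have ie : ∀ {x y}, e x = e y → x = y := fun {x y} h => by rw [← ee x, h, ee]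
  have io : ∀ {x y}, o x = o y → x = y := fun {x y} h => by rw [← oo x, h, oo]
  have p12 : z1 ≠ z2 := fun h => n0 z1 (h2' ▸ h.symm)
  have p34 : z3 ≠ z4 := fun h => n0 z3 (h4' ▸ h.symm)
  have p56 : z5 ≠ z6 := fun h => n0 z5 (h6 ▸ h.symm)
  have p78 : z8 ≠ z7 := fun h => n0 z7 (h8 ▸ h)
  have p03 : d ≠ z3 := fun h => p12 (ie (by rw [← h3, ← h, h1, ee]))
  have p15 : z1 ≠ z5 := fun h => m4 (ie (by rw [← h5, ← h, h1]))
  have p25 : z2 ≠ z5 := fun h => p34 (ie (by rw [← h5, ← h, h3, ee]))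
  have p16 : z1 ≠ z6 := fun h => p25 (io (by rw [← h6, ← h, h2', oo]))
  have p26 : z2 ≠ z6 := fun h => p15 (io (by rw [← h6, ← h, h2']))
  have p07 : d ≠ z7 := fun h => p16 (ie (by rw [← h7, ← h, h1, ee]))
  have p37 : z3 ≠ z7 := fun h => p26 (ie (by rw [← h7, ← h, h3]))
  have p47 : z4 ≠ z7 := fun h => p56 (ie (by rw [← h7, ← h, h5, ee]))
  have p83 : z8 ≠ z3 := fun h => p47 (io (by rw [← h8, h, h4', oo]))
  have p84 : z8 ≠ z4 := fun h => p37 (io (by rw [← h8, h, h4']))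
  have hcard := card_union_eq_eight (W := fun u => X.white u ↔ X.white d)
    (x := d) (y := z3) (z := z4) (w := z7) (x' := z1) (y' := z2) (z' := z5) (w' := z6)
    ⟨p03, m4.symm, p07, p34, p37, p47⟩ ⟨p12, p15, p16, p25, p26, p56⟩
    (by simp [w1, w2, w3, w4, w5, w6, w7]) (by simp [w1, w2, w3, w4, w5, w6])
  have h9 : (insert z8 (({d, z3, z4, z7} : Finset D) ∪ {z1, z2, z5, z6})).card = 9 := by
    have hz : ∀ {z}, (X.white z ↔ ¬ X.white z8) → z8 ≠ z := by
      rintro z h rfl; exact iff_not_self h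
    have u6 : X.white z6 ↔ ¬ X.white z8 := by rw [w8, w7, not_not]
    have u5 : X.white z5 ↔ ¬ X.white z8 := w6.symm.trans u6
    have u2 : X.white z2 ↔ ¬ X.white z8 := by rw [← u5, w5, w4, w3, not_not]
    have u1 : X.white z1 ↔ ¬ X.white z8 := w2.symm.trans u2
    rw [Finset.card_insert_of_notMem, hcard]
    simp only [Finset.mem_insert, Finset.mem_singleton, Finset.mem_union, not_or]
    exact ⟨⟨m8, p83, p84, p78⟩, hz u1, hz u2, hz u5, hz u6⟩
  rw [← h9]
  refine card_le_card_class _ ?_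
  simp only [Finset.mem_insert, Finset.mem_singleton, Finset.mem_union]
  have q1 := h1 ▸ re d
  have q2 := (h2' ▸ ro z1).trans q1
  have q3 := (h3 ▸ re z2).trans q2
  have q4 := (h4' ▸ ro z3).trans q3
  have q5 := (h5 ▸ re z4).trans q4
  have q6 := (h6 ▸ ro z5).trans q5
  have q7 := (h7 ▸ re z6).trans q6
  have q8 := (h8 ▸ ro z7).trans q7
  rintro u (rfl | (rfl | rfl | rfl | rfl) | (rfl | rfl | rfl | rfl))
  exacts [q8, rfl, q3, q4, q7, q1, q2, q5, q6]

/-- **Few half-edges.** In a map whose faces of length 2 and straight cycles of length 2 all pass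
through marked half-edges, and each of whose components other than rings contains a marked
half-edge, the number of half-edges is bounded in terms of the excess and the number of marked
half-edges: far from the marked half-edges and from the faces and straight cycles of length other
than 4, whose number is controlled by the excess, the map is a piece of the square lattice and
closes up to a torus. -/
theorem Clean.card_four_le [Finite D] (hX : X.Clean) (Mk : Finset D)
    (hU : ∀ x, X.Four x → X.face (X.face x) = x → x ∈ Mk ∨ X.face x ∈ Mk)
    (hO : ∀ x, X.Four x → ((X.opp * X.edge) ^ 2) x = x → x ∈ Mk ∨ X.opp x ∈ Mk)
    (hM : ∀ d, X.Four d → ∃ m ∈ Mk, X.Conn m d) :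
    (Nat.card {d // X.Four d} : ℤ) ≤ 64 * (85 * Mk.card + 9 * X.excess) := by
  classical
  have : Fintype D := Fintype.ofFinite D
  set F : Finset D := Finset.univ.filter fun d => X.Four d with hF
  have hF4 : Nat.card {d // X.Four d} = F.card := by
    rw [Nat.card_eq_fintype_card, Fintype.card_subtype]
  have mF : ∀ d, d ∈ F ↔ X.Four d := by simp [hF]
  -- `S`: half-edges on faces or straight cycles of length 2; `B`: other half-edges, on a face or a
  -- straight cycle of length other than 4
  set S : Finset D := F.filter fun d => X.face (X.face d) = d ∨ ((X.opp * X.edge) ^ 2) d = d with hS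
  set B : Finset D := F.filter fun d => ¬ (X.face (X.face d) = d ∨
    ((X.opp * X.edge) ^ 2) d = d) ∧ ((X.face ^ 4) d ≠ d ∨ ((X.opp * X.edge) ^ 4) d ≠ d) with hB
  have hScard : S.card ≤ 3 * Mk.card := by
    have hsub : S ⊆ Mk ∪ Mk.image X.face.symm ∪ Mk.image X.opp.symm := by
      intro d hd
      rw [hS, Finset.mem_filter, mF] at hd
      simp only [Finset.mem_union, Finset.mem_image]
      rcases hd.2 with h | h
      · rcases hU d hd.1 h with h | h
        · exact Or.inl (Or.inl h)
        · exact Or.inl (Or.inr ⟨_, h, by simp⟩)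
      · rcases hO d hd.1 h with h | h
        · exact Or.inl (Or.inl h)
        · exact Or.inr ⟨_, h, by simp⟩
    have h1 := Finset.card_le_card hsub
    have h2 := Finset.card_union_le (Mk ∪ Mk.image X.face.symm) (Mk.image X.opp.symm)
    have h3 := Finset.card_union_le Mk (Mk.image X.face.symm)
    have h4 := Finset.card_image_le (s := Mk) (f := X.face.symm)
    have h5 := Finset.card_image_le (s := Mk) (f := X.opp.symm)
    omega
  -- `3 - 8 / 2 - 8 / 4 = -3` on `S`; on `B`, at least the minimum of `3 - 8 / 5 - 8 / 8` and
  -- `3 - 8 / 4 - 8 / 9 = 1 / 9`; and `3 - 8 / 4 - 8 / 8 = 0` elsewhere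
  have hw : ∀ d, (if d ∈ S then (-3 : ℚ) else 0) + (if d ∈ B then 1 / 9 else 0) ≤ X.weight d := by
    intro d
    by_cases hd : X.Four d
    · by_cases hdS : d ∈ S
      · have hdB : d ∉ B := by
          rw [hS, Finset.mem_filter] at hdS
          rw [hB, Finset.mem_filter]
          tauto
        rw [if_pos hdS, if_neg hdB]
        have h1 := hX.two_le_face hd
        have h2 := four_le_straight hd
        have := le_weight hd (m := 2) (n := 4) (by norm_num) (by norm_num)
          (by exact_mod_cast h1) (by exact_mod_cast h2)
        norm_num at this ⊢
        linarith
      · rw [if_neg hdS]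
        have hdS' := hdS
        rw [hS, Finset.mem_filter, mF] at hdS'
        have n1 : X.face (X.face d) ≠ d := by tauto
        have n2 : ((X.opp * X.edge) ^ 2) d ≠ d := by tauto
        have h1 := hX.face_card hd n1
        have h2 := hX.eight_le hd (by
          intro h
          apply n2
          change X.opp (X.edge (X.opp (X.edge d))) = d
          rw [← h, X.edge_edge, opp_opp])
        by_cases hdB : d ∈ B
        · rw [if_pos hdB]
          rw [hB, Finset.mem_filter] at hdB
          rcases hdB.2.2 with h | h
          · have := le_weight hd (m := 5) (n := 8) (by norm_num) (by norm_num)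
              (by exact_mod_cast h1.2 h) (by exact_mod_cast h2)
            norm_num at this ⊢
            linarith
          · have := le_weight hd (m := 4) (n := 9) (by norm_num) (by norm_num)
              (by exact_mod_cast h1.1) (by exact_mod_cast hX.nine_le hd n2 h)
            norm_num at this ⊢
            linarith
        · rw [if_neg hdB]
          have := le_weight hd (m := 4) (n := 8) (by norm_num) (by norm_num)
            (by exact_mod_cast h1.1) (by exact_mod_cast h2)
          norm_num at this ⊢
          linarith
    · have h1 : d ∉ S := by rw [hS, Finset.mem_filter, mF]; tauto
      have h2 : d ∉ B := by rw [hB, Finset.mem_filter, mF]; tauto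
      rw [if_neg h1, if_neg h2, add_zero]
      exact hX.weight_nonneg_of_not_four hd
  have hsum : -3 * (S.card : ℚ) + (1 / 9) * B.card ≤ X.excess := by
    rw [X.excess_eq_sum]
    have h1 := Finset.sum_le_sum fun d (_ : d ∈ Finset.univ) => hw d
    rw [Finset.sum_add_distrib, Finset.sum_ite_mem, Finset.sum_ite_mem, Finset.univ_inter,
      Finset.univ_inter, Finset.sum_const, Finset.sum_const, nsmul_eq_mul, nsmul_eq_mul] at h1
    linarith
  have hBcard : (B.card : ℤ) ≤ 9 * X.excess + 27 * S.card := by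
    have : (B.card : ℚ) ≤ 9 * X.excess + 27 * S.card := by linarith
    exact_mod_cast this
  -- every half-edge is close to an exceptional one
  set t : Perm D := X.rot * X.rot * X.edge with ht
  set s : Perm D := X.rot * t * X.rot⁻¹ with hs
  have hto : ∀ u, X.Four u → ∀ k, ((X.opp * X.edge) ^ k) u = (t ^ k) u ∧ X.Four ((t ^ k) u) := by
    intro u hu k
    induction k with
    | zero => exact ⟨rfl, hu⟩
    | succ k ih =>
      rw [pow_succ', pow_succ', Perm.mul_apply, Perm.mul_apply, ih.1, Perm.mul_apply,
        opp_of_four (hX.four_edge.2 ih.2)]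
      refine ⟨rfl, ?_⟩
      simp only [ht, Perm.mul_apply]
      rw [four_rot, four_rot, hX.four_edge]
      exact ih.2
  have hr : X.rot ^ 4 = 1 := by ext u; exact X.rot_four u
  have he : X.edge * X.edge = 1 := by ext u; exact X.edge_edge u
  have hinv : ∀ u, X.Four (X.rot⁻¹ u) ↔ X.Four u := fun u => by
    rw [← four_rot, ← Perm.mul_apply, mul_inv_cancel, Perm.one_apply]
  have hs4 : ∀ u, X.Four u → ∀ k, X.Four ((s ^ k) u) := by
    intro u hu k
    induction k with
    | zero => exact hu
    | succ k ih =>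
      rw [pow_succ', Perm.mul_apply]
      simp only [hs, ht, Perm.mul_apply]
      rw [four_rot, four_rot, four_rot, hX.four_edge, hinv]
      exact ih
  have hr4 : ∀ u, X.Four u → ∀ k, X.Four ((X.rot ^ k) u) := by
    intro u hu k
    induction k with
    | zero => exact hu
    | succ k ih => rw [pow_succ', Perm.mul_apply, four_rot]; exact ih
  have hnear : ∀ d ∈ F, ∃ k < 4, ∃ i < 4, ∃ j < 4,
      (X.rot ^ k * t ^ i * s ^ j) d ∈ Mk ∪ S ∪ B := by
    intro d hd
    rw [mF] at hd
    by_contra hno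
    push Not at hno
    have hfour : ∀ k i j, X.Four ((X.rot ^ k * t ^ i * s ^ j) d) := fun k i j =>
      hr4 _ (hto _ (hs4 d hd j) i).2 k
    obtain ⟨N, hN0, hN1, hN2, hN3⟩ := exists_eq_of_locally_square hr he ht hs (d := d)
      (P := fun u => u ∉ Mk) (fun k hk i hi j hj => by
        have h1 := hno k hk i hi j hj
        have h2 := hfour k i j
        set u := (X.rot ^ k * t ^ i * s ^ j) d
        simp only [Finset.mem_union, not_or, hS, hB, Finset.mem_filter, mF] at h1
        rw [← (hto u h2 4).1]
        change _ ∧ (X.face ^ 4) u = u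
        tauto) (fun k hk i hi j hj => by
        have h1 := hno k hk i hi j hj
        simp only [Finset.mem_union, not_or] at h1
        exact h1.1.1)
    obtain ⟨m, hm, hc⟩ := hM d hd
    exact hN3 m (hc.symm.mem_of_mapsTo hN1 hN2 hN0) hm
  have hcov : F ⊆ (((Finset.range 4 ×ˢ Finset.range 4) ×ˢ Finset.range 4) ×ˢ (Mk ∪ S ∪ B)).image
      fun x => (X.rot ^ x.1.1.1 * t ^ x.1.1.2 * s ^ x.1.2)⁻¹ x.2 := by
    intro d hd
    obtain ⟨k, hk, i, hi, j, hj, h⟩ := hnear d hd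
    rw [Finset.mem_image]
    refine ⟨(((k, i), j), (X.rot ^ k * t ^ i * s ^ j) d), by simp [hk, hi, hj]; simpa using h, ?_⟩
    rw [← Perm.mul_apply, inv_mul_cancel, Perm.one_apply]
  -- `1 + 3 + 27 * 3 = 85`
  have h1 := (Finset.card_le_card hcov).trans Finset.card_image_le
  simp only [Finset.card_product, Finset.card_range] at h1
  have h2 := Finset.card_union_le (Mk ∪ S) B
  have h3 := Finset.card_union_le Mk S
  rw [hF4]
  omega

end BMap
end MatrixModel

namespace MatrixModel
open Equiv

/-! ### Rooted maps -/

namespace RootedMap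

variable (M : RootedMap)

instance : Finite M.Dart := M.finite_dart

/-- A rooted map, with its root vertex as the only vertex of degree 2. -/
def toBMap : BMap M.Dart where
  rot := M.rot
  edge := M.edge
  white := M.white
  rot_four d := by
    by_cases h1 : d = M.root
    · rw [h1, M.rot_rot_root, M.rot_rot_root]
    by_cases h2 : d = M.rot M.root
    · rw [h2, M.rot_rot_root, M.rot_rot_root]
    exact (M.degree_four d h1 h2).1
  edge_edge := M.edge_edge
  white_edge := M.white_edge
  white_rot_of_ne d h := by
    refine M.white_rot d ?_ ?_
    · rintro rfl; exact h M.rot_rot_root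
    · rintro rfl; exact h (by rw [M.rot_rot_root])
  white_rot_of_eq d h := by
    by_cases h1 : d = M.root
    · rw [h1]; exact iff_of_false M.black_rot_root (not_not.2 M.white_root)
    by_cases h2 : d = M.rot M.root
    · rw [h2, M.rot_rot_root]; exact iff_of_true M.white_root M.black_rot_root
    exact ((M.degree_four d h1 h2).2 h).elim

variable {M}

theorem four_toBMap {d : M.Dart} : M.toBMap.Four d ↔ M.Ordinary d := by
  constructor
  · refine fun h => ⟨?_, ?_⟩
    · rintro rfl; exact h M.rot_rot_root
    · rintro rfl; exact h (congrArg M.rot M.rot_rot_root)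
  · exact fun h => (M.degree_four d h.1 h.2).2

theorem opp_toBMap (d : M.Dart) : M.toBMap.opp d = M.opp d := by
  classical
  unfold opp
  split_ifs with h
  · exact BMap.opp_of_four (four_toBMap.2 h)
  · exact BMap.opp_of_not_four (fun h' => h (four_toBMap.1 h'))

theorem conn_toBMap (x y : M.Dart) : M.toBMap.Conn x y := by
  obtain ⟨g, hg, rfl⟩ := M.connected x y
  have : ∀ x, M.toBMap.Conn (g x) x := by
    induction hg using Subgroup.closure_induction with
    | mem g hg =>
      rcases hg with rfl | rfl
      · exact BMap.conn_rot (X := M.toBMap)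
      · exact BMap.conn_edge (X := M.toBMap)
    | one => exact fun x => rfl
    | mul g h _ _ ih ih' => exact fun x => (ih (h x)).trans (ih' x)
    | inv g _ ih =>
      intro x
      have := ih (g⁻¹ x)
      rw [← Perm.mul_apply, mul_inv_cancel, Perm.one_apply] at this
      exact this.symm
  exact (this x).symm

variable (M)

theorem card_four_toBMap : Nat.card {d // M.toBMap.Four d} + 2 = Nat.card M.Dart := by
  have h1 : {d | M.toBMap.Four d}ᶜ = {M.root, M.rot M.root} := by
    ext d
    simp only [Set.mem_compl_iff, Set.mem_ofPred_eq, Set.mem_insert_iff, Set.mem_singleton_iff,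
      four_toBMap, Ordinary]
    tauto
  have h2 : M.root ≠ M.rot M.root := fun h => M.black_rot_root (h ▸ M.white_root)
  have h3 := Set.ncard_add_ncard_compl {d | M.toBMap.Four d}
  rw [h1, Set.ncard_pair h2] at h3
  exact h3

theorem orb_toBMap : orb M.toBMap.rot M.toBMap.edge = 1 := by
  rw [orb, Nat.card_eq_one_iff_unique]
  refine ⟨⟨fun x y => ?_⟩, ⟨Quot.mk _ M.root⟩⟩
  induction x using Quot.ind
  induction y using Quot.ind
  exact conn_toBMap _ _

/-- The number of edges is eliminated by `E = 2 V`. -/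
theorem excess_toBMap : (M.toBMap.excess : ℚ) = 8 * M.genus + 4 * M.grade := by
  have h1 := M.card_four_toBMap
  have h2 := M.toBMap.two_mul_cyc_edge
  have h3 := M.toBMap.four_mul_cyc_rot
  have h4 : M.numFaces = cyc (M.toBMap.rot * M.toBMap.edge) := rfl
  have h5 : M.numStraight = orb M.toBMap.opp M.toBMap.edge := by
    unfold numStraight orb orbRel
    simp only [opp_toBMap]
    rfl
  have h6 : M.numVertices = (cyc M.toBMap.rot : ℤ) - 1 := rfl
  have h7 : M.numEdges = (cyc M.toBMap.edge : ℤ) - 1 := rfl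
  unfold genus grade genus BMap.excess
  rw [h4, h5, h6, h7, orb_toBMap]
  rw [← h1] at h2 h3
  have h2' : (2 * cyc M.toBMap.edge : ℚ) = Nat.card {d // M.toBMap.Four d} + 2 := by
    exact_mod_cast h2
  have h3' : (4 * cyc M.toBMap.rot + Nat.card {d // M.toBMap.Four d} : ℚ) =
      2 * (Nat.card {d // M.toBMap.Four d} + 2) := by exact_mod_cast h3
  push_cast
  linarith

theorem isMelon_toBMap {p : M.Dart} : M.toBMap.IsMelon p ↔ M.IsMelon p := by
  unfold BMap.IsMelon IsMelon
  rw [four_toBMap, four_toBMap]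
  rfl

end RootedMap
end MatrixModel

namespace MatrixModel
open Equiv

/-! ### Removal of melons -/

/-- A class of the target that meets the image of the embedding is the image of a class, if the
relation on the target does not lead out of the image. -/
theorem card_class_of_embedding {D D' : Type*} {r : D → D → Prop} {r' : D' → D' → Prop}
    {ι : D' → D} (hι : Function.Injective ι) (h₁ : ∀ x y, r' x y → r (ι x) (ι y))
    (h₂ : ∀ x y, r x y → x ∈ Set.range ι ∨ y ∈ Set.range ι → ∃ u v, ι u = x ∧ ι v = y ∧ r' u v)
    (d : D') : Nat.card {x // Quot.mk r x = Quot.mk r (ι d)} =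
      Nat.card {x // Quot.mk r' x = Quot.mk r' d} := by
  classical
  let k : D → Option (Quot r') := fun u =>
    if h : ∃ v, ι v = u then some (Quot.mk _ h.choose) else none
  have kι : ∀ v, k (ι v) = some (Quot.mk _ v) := fun v => by
    have h : ∃ w, ι w = ι v := ⟨v, rfl⟩
    simp only [k, dif_pos h, hι h.choose_spec]
  have hk : ∀ x y, r x y → k x = k y := by
    intro x y hxy
    by_cases h : x ∈ Set.range ι ∨ y ∈ Set.range ι
    · obtain ⟨u, v, rfl, rfl, huv⟩ := h₂ x y hxy h
      rw [kι, kι, Quot.sound huv]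
    · rw [not_or] at h
      have h1 : ¬ ∃ v, ι v = x := h.1
      have h2 : ¬ ∃ v, ι v = y := h.2
      simp only [k, dif_neg h1, dif_neg h2]
  have hk' : ∀ x y, Quot.mk r x = Quot.mk r y → k x = k y :=
    fun x y h => congrArg (Quot.lift k hk) h
  have hf : ∀ x, Quot.mk r' x = Quot.mk r' d → Quot.mk r (ι x) = Quot.mk r (ι d) := fun x h =>
    congrArg (Quot.lift (fun u => Quot.mk r (ι u)) fun u v huv => Quot.sound (h₁ u v huv)) h
  refine (Nat.card_congr (Equiv.ofBijective (fun x => ⟨ι x.1, hf x.1 x.2⟩) ⟨?_, ?_⟩)).symm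
  · exact fun x y h => Subtype.ext (hι (congrArg Subtype.val h))
  · rintro ⟨x, hx⟩
    have h := hk' _ _ hx
    rw [kι] at h
    by_cases hx' : ∃ v, ι v = x
    · obtain ⟨v, rfl⟩ := hx'
      rw [kι, Option.some_inj] at h
      exact ⟨⟨v, h⟩, rfl⟩
    · simp [k, dif_neg hx'] at h

namespace BMap

/-- Rings without vertices of degree 4 do not contribute to the excess. -/
theorem weight_of_ring {D : Type*} {X : BMap D} {d : D} (h : ¬ X.Four d)
    (h' : X.edge d = X.rot d) : X.weight d = 0 := by
  classical
  have r2 : X.rot (X.rot d) = d := not_four.1 h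
  have e2 : X.edge (X.rot d) = d := by rw [← h', X.edge_edge]
  have h3 : ¬ X.Four (X.rot d) := fun h3 => h (four_rot.1 h3)
  have hs : ∀ {r : D → D → Prop}, (∀ x y, r x y → (x ∈ ({d, X.rot d} : Finset D) ↔
      y ∈ ({d, X.rot d} : Finset D))) → Quot.mk r (X.rot d) = Quot.mk r d →
      Nat.card {x // Quot.mk r x = Quot.mk r d} = 2 := by
    intro r hr hd
    rw [card_class_eq {d, X.rot d}, Finset.card_pair (rot_ne d).symm]
    intro x
    constructor
    · exact fun hx => (quot_invariant hr hx).2 (by simp)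
    · simp only [Finset.mem_insert, Finset.mem_singleton]
      rintro (rfl | rfl)
      exacts [rfl, hd]
  have iff_of_pair : ∀ {g : Perm D}, g d = X.rot d → g (X.rot d) = d → ∀ x,
      (x ∈ ({d, X.rot d} : Finset D) ↔ g x ∈ ({d, X.rot d} : Finset D)) := by
    intro g g1 g2 x
    simp only [Finset.mem_insert, Finset.mem_singleton]
    exact (perm_pair_iff g1 g2).symm
  have k1 : Nat.card {x // X.Conn x d} = 2 :=
    hs (by rintro x y (rfl | rfl); exacts [iff_of_pair h' e2 x, iff_of_pair rfl r2 x]) (conn_rot d)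
  have k2 : Nat.card {x // Quot.mk (orbRel X.opp X.edge) x = Quot.mk (orbRel X.opp X.edge) d} = 2 :=
    hs (by
      rintro x y (rfl | rfl)
      exacts [iff_of_pair h' e2 x,
        iff_of_pair (opp_of_not_four h) ((opp_of_not_four h3).trans r2) x])
      (by rw [← h']; exact orbRel_snd _ _ d)
  have k3 : Nat.card {x // cls (X.rot * X.edge) x = cls (X.rot * X.edge) d} = 1 := by
    refine (card_class_eq {d} fun x => ⟨fun hx => ?_, fun hx => ?_⟩).trans (Finset.card_singleton d)
    · refine (quot_invariant (P := fun u => u ∈ ({d} : Finset D)) ?_ hx).2 (by simp)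
      rintro x y rfl
      simp only [Finset.mem_singleton, Perm.mul_apply]
      constructor
      · rintro rfl; rw [h', r2]
      · intro hx
        have hx' : X.edge x = X.rot d := by rw [← rot_inj (X := X), r2]; exact hx
        exact X.edge.injective (hx'.trans h'.symm)
    · rw [Finset.mem_singleton.1 hx]
  unfold weight
  rw [if_neg h, k1, k2, k3]
  norm_num

/-- The excess does not see rings without vertices of degree 4. -/
theorem excess_of_embedding {D D' : Type*} [Finite D] {X : BMap D} {Y : BMap D'} {ι : D' → D}
    (hι : Function.Injective ι) (hr : ∀ d, ι (Y.rot d) = X.rot (ι d))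
    (he : ∀ d, ι (Y.edge d) = X.edge (ι d))
    (h : ∀ d, d ∉ Set.range ι → ¬ X.Four d ∧ X.edge d = X.rot d) : Y.excess = X.excess := by
  classical
  have : Finite D' := Finite.of_injective ι hι
  have : Fintype D' := Fintype.ofFinite D'
  have : Fintype D := Fintype.ofFinite D
  have h4 : ∀ d, Y.Four d ↔ X.Four (ι d) := fun d => by
    unfold Four
    rw [← hr, ← hr, hι.ne_iff]
  have ho : ∀ d, ι (Y.opp d) = X.opp (ι d) := fun d => by
    by_cases hd : Y.Four d
    · rw [opp_of_four hd, opp_of_four ((h4 d).1 hd), hr, hr]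
    · rw [opp_of_not_four hd, opp_of_not_four (fun h => hd ((h4 d).2 h)), hr]
  -- a permutation that is compatible with the embedding gives a compatible relation
  have key : ∀ {σ : Perm D} {σ' : Perm D'}, (∀ d, ι (σ' d) = σ (ι d)) →
      ∀ x, x ∈ Set.range ι ∨ σ x ∈ Set.range ι → ∃ u, ι u = x ∧ ι (σ' u) = σ x := by
    intro σ σ' hσ x hx
    rcases hx with ⟨u, rfl⟩ | ⟨v, hv⟩
    · exact ⟨u, rfl, hσ u⟩
    · have h1 : ι (σ'.symm v) = x := by
        apply σ.injective
        rw [← hσ, Equiv.apply_symm_apply, hv]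
      exact ⟨_, h1, by rw [hσ, h1]⟩
  have horb : ∀ {σ : Perm D} {σ' : Perm D'}, (∀ d, ι (σ' d) = σ (ι d)) → ∀ d,
      Nat.card {x // Quot.mk (orbRel σ X.edge) x = Quot.mk (orbRel σ X.edge) (ι d)} =
        Nat.card {x // Quot.mk (orbRel σ' Y.edge) x = Quot.mk (orbRel σ' Y.edge) d} := by
    intro σ σ' hσ d
    refine card_class_of_embedding hι ?_ ?_ d
    · rintro x y (rfl | rfl)
      exacts [Or.inl (he x), Or.inr (hσ x)]
    · rintro x y (rfl | rfl) hx
      · obtain ⟨u, hu, hu'⟩ := key he x hx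
        exact ⟨u, _, hu, hu', Or.inl rfl⟩
      · obtain ⟨u, hu, hu'⟩ := key hσ x hx
        exact ⟨u, _, hu, hu', Or.inr rfl⟩
  have hcyc : ∀ d, Nat.card {x // cls (X.rot * X.edge) x = cls (X.rot * X.edge) (ι d)} =
      Nat.card {x // cls (Y.rot * Y.edge) x = cls (Y.rot * Y.edge) d} := by
    intro d
    have hσ : ∀ d, ι ((Y.rot * Y.edge) d) = (X.rot * X.edge) (ι d) := fun d => by
      rw [Perm.mul_apply, Perm.mul_apply, hr, he]
    refine card_class_of_embedding hι ?_ ?_ d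
    · rintro x y rfl; exact hσ x
    · rintro x y rfl hx
      obtain ⟨u, hu, hu'⟩ := key hσ x hx
      exact ⟨u, _, hu, hu', rfl⟩
  have : (Y.excess : ℚ) = X.excess := by
    rw [excess_eq_sum, excess_eq_sum]
    refine Fintype.sum_of_injective ι hι _ _ (fun d hd => weight_of_ring (h d hd).1 (h d hd).2) ?_
    intro d
    have h1 : Nat.card {x // X.Conn x (ι d)} = Nat.card {x // Y.Conn x d} := horb hr d
    unfold weight
    rw [h1, horb ho, hcyc]
    simp only [h4]
  exact_mod_cast this

end BMap

namespace RootedMap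

variable {M N : RootedMap}

/-- The dipole formed by the first two edges of a melon. -/
def IsMelon.dip {p : M.Dart} (h : M.IsMelon p) : M.toBMap.Dip where
  p := p
  q := M.rot p
  a := M.rot (M.rot p)
  b := M.rot (M.rot (M.rot p))
  p' := M.edge p
  q' := M.edge (M.rot p)
  c := M.rot (M.edge p)
  d := M.rot (M.rot (M.edge p))
  white_p := h.1
  four_p := four_toBMap.2 h.2.1
  four_p' := four_toBMap.2 h.2.2.1
  edge_p := rfl
  edge_q := rfl
  shape := by
    refine Or.inl ⟨rfl, rfl, rfl, M.toBMap.rot_four p, h.2.2.2.1.symm, rfl, rfl, ?_⟩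
    have := M.toBMap.rot_four (M.edge (M.rot p))
    change M.rot (M.rot (M.rot (M.rot (M.edge (M.rot p))))) = _ at this
    rw [← h.2.2.2.1] at this
    exact this

theorem IsMelon.mem_darts {p : M.Dart} (h : M.IsMelon p) {u : M.Dart} :
    u ∈ h.dip.darts ↔ M.rot.SameCycle p u ∨ M.rot.SameCycle (M.edge p) u := by
  constructor
  · intro hu
    rw [BMap.Dip.mem_darts] at hu
    have h1 : M.rot.SameCycle (M.edge p) (M.edge (M.rot p)) := by
      rw [h.2.2.2.1, Perm.sameCycle_apply_left]
    simp only [dip] at hu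
    rcases hu with rfl | rfl | rfl | rfl | rfl | rfl | rfl | rfl <;>
      simp only [Perm.sameCycle_apply_right, Perm.SameCycle.refl, true_or, or_true, h1]
  · have key : ∀ (i : ℕ) x, x ∈ h.dip.darts → (M.rot ^ i) x ∈ h.dip.darts := by
      intro i x hx
      induction i with
      | zero => exact hx
      | succ i ih => rw [pow_succ', Perm.mul_apply]; exact h.dip.rot_mem.2 ih
    rintro (h1 | h1) <;> obtain ⟨i, -, rfl⟩ := h1.exists_pow_eq'
    · exact key i _ (h.dip.mem_darts.2 (Or.inl rfl))
    · exact key i _ (h.dip.mem_darts.2 (by simp [dip]))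

/-- To remove a melon is to remove the dipole formed by its first two edges, which disconnects the
side closed by the third edge, to forget one of the resulting vertices of degree 2, and to drop
the rings. -/
theorem MelonRemoval.excess_eq (h : M.MelonRemoval N) : N.toBMap.excess = M.toBMap.excess := by
  obtain ⟨p, hp, ι, hι, hran, -, -, hrot, hedge⟩ := h
  obtain ⟨δ, hδ⟩ : ∃ δ, δ = hp.dip := ⟨_, rfl⟩
  have hran' : ∀ u, u ∈ Set.range ι ↔ u ∉ δ.darts := by
    intro u
    rw [hran, hδ, hp.mem_darts, not_or]
    rfl
  have ha : M.toBMap.edge δ.a = δ.d := by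
    have h1 := hp.2.2.2.2
    have h2 := M.toBMap.rot_four (M.edge (M.rot (M.rot p)))
    change M.rot (M.rot (M.rot (M.rot _))) = _ at h2
    rw [← h1, ← hp.2.2.2.1] at h2
    rw [hδ]
    exact h2.symm
  have hd : M.toBMap.edge δ.d = δ.a := by rw [← ha, BMap.edge_edge]
  have hnd := δ.nodup
  simp only [List.nodup_cons, List.mem_cons, not_or, List.not_mem_nil, not_false_eq_true] at hnd
  obtain ⟨Y, hY, hY'⟩ := δ.exists_removal
  have hab : ¬ Y.Conn δ.a δ.b := by
    intro hab
    have := (hab.invariant (P := fun u => u = δ.a ∨ u = δ.d)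
      (fun u => BMap.perm_pair_iff hY.rot_a hY.rot_d)
      (fun u => BMap.perm_pair_iff (by rw [hY.edge, ha]) (by rw [hY.edge, hd]))).1 (Or.inl rfl)
    tauto
  have hex : Y.excess = M.toBMap.excess := by
    rcases hY' with h | h
    · exact h.2.2
    · exact (hab h.1).elim
  obtain ⟨Z, z1, z2, z3, z4, z5, z6, z7⟩ : ∃ Z : BMap M.Dart, Z.rot = Y.rot ∧
      Z.excess = Y.excess ∧ Z.edge δ.b = δ.c ∧ Z.edge δ.c = δ.b ∧
      Z.edge (Y.edge δ.b) = Y.edge δ.c ∧ Z.edge (Y.edge δ.c) = Y.edge δ.b ∧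
      ∀ u, u ≠ δ.b → u ≠ δ.c → u ≠ Y.edge δ.b → u ≠ Y.edge δ.c → Z.edge u = Y.edge u := by
    by_cases hbc : Y.edge δ.b = δ.c
    · exact ⟨Y, rfl, rfl, hbc, by rw [← hbc, Y.edge_edge], by rw [hbc],
        by rw [← hbc, Y.edge_edge], fun _ _ _ _ _ => rfl⟩
    · obtain ⟨Z, h1, -, h2, h3, h4, h5, h6, h7, -⟩ := BMap.exists_forget Y
        (hY.not_four (δ.mem_darts.2 (by simp))) hY.rot_b hbc
      exact ⟨Z, h1, h2, h3, h4, h5, h6, h7⟩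
  rw [← hex, ← z2]
  refine BMap.excess_of_embedding hι (fun u => ?_) (fun u => ?_) (fun u hu => ?_)
  · have h1 := (hran' (ι u)).1 ⟨u, rfl⟩
    rw [z1, hY.rot_of_notMem _ h1]
    exact hrot u
  · have h1 := (hran' (ι u)).1 ⟨u, rfl⟩
    have n1 : ι u ≠ δ.b := fun h => h1 (δ.mem_darts.2 (by simp [h]))
    have n2 : ι u ≠ δ.c := fun h => h1 (δ.mem_darts.2 (by simp [h]))
    obtain ⟨k1, k2, k3⟩ := hedge u
    have hb : δ.b = M.rot (M.rot (M.rot p)) := by rw [hδ]; rfl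
    have hc : δ.c = M.rot (M.edge p) := by rw [hδ]; rfl
    rw [← hb, ← hc] at k1 k2 k3
    by_cases g1 : M.edge (ι u) = δ.b
    · have g1' : ι u = Y.edge δ.b := by rw [hY.edge, ← g1]; exact (M.edge_edge _).symm
      rw [g1', z5, hY.edge]
      exact k1 g1
    by_cases g2 : M.edge (ι u) = δ.c
    · have g2' : ι u = Y.edge δ.c := by rw [hY.edge, ← g2]; exact (M.edge_edge _).symm
      rw [g2', z6, hY.edge]
      exact k2 g2
    have g1' : ι u ≠ Y.edge δ.b := fun h => g1 (by rw [h, hY.edge]; exact M.edge_edge _)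
    have g2' : ι u ≠ Y.edge δ.c := fun h => g2 (by rw [h, hY.edge]; exact M.edge_edge _)
    rw [z7 _ n1 n2 g1' g2', hY.edge]
    exact k3 g1 g2
  · have hu' : u ∈ δ.darts := by by_contra h; exact hu ((hran' u).2 h)
    refine ⟨by rw [BMap.four_congr z1]; exact hY.not_four hu', ?_⟩
    rw [z1]
    by_cases g1 : u = δ.b
    · rw [g1, z3, hY.rot_b]
    by_cases g2 : u = δ.c
    · rw [g2, z4, hY.rot_c]
    have e1 := δ.edge_p; have e2 := δ.edge_q; have e3 := δ.edge_p'; have e4 := δ.edge_q'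
    -- an inner half-edge is not joined to `b` or `c`
    have hne : ∀ v, v ≠ δ.b → v ≠ δ.c → M.toBMap.edge v = Y.rot v →
        Z.edge v = Y.rot v := by
      intro v v1 v2 hv'
      have hmem : Y.rot v ≠ δ.b ∧ Y.rot v ≠ δ.c :=
        ⟨fun h => v2 (Y.rot.injective (h.trans hY.rot_c.symm)),
          fun h => v1 (Y.rot.injective (h.trans hY.rot_b.symm))⟩
      rw [z7 v v1 v2, hY.edge, hv']
      · rw [Ne, ← BMap.edge_eq_iff, hY.edge, hv']; exact hmem.1
      · rw [Ne, ← BMap.edge_eq_iff, hY.edge, hv']; exact hmem.2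
    refine hne u g1 g2 ?_
    rw [BMap.Dip.mem_darts] at hu'
    rcases hu' with rfl | rfl | rfl | rfl | rfl | rfl | rfl | rfl
    · rw [e1, hY.rot_p]
    · rw [e2, hY.rot_q]
    · rw [ha, hY.rot_a]
    · exact (g1 rfl).elim
    · rw [e3, hY.rot_p']
    · rw [e4, hY.rot_q']
    · exact (g2 rfl).elim
    · rw [hd, hY.rot_d]

theorem MelonReduction.excess_eq (h : M.MelonReduction N) :
    N.toBMap.excess = M.toBMap.excess := by
  obtain ⟨h, -⟩ := h
  induction h with
  | refl => rfl
  | tail _ h ih => rw [h.excess_eq, ih]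

end RootedMap
end MatrixModel

namespace MatrixModel
open Equiv
namespace BMap

/-! ### Removal of disjoint dipoles -/

variable {D : Type*} {X : BMap D}

/-- `Y` is obtained from `X` by removing the dipoles in `S`, which are pairwise disjoint. -/
structure IsMultiRemoval (S : Finset X.Dip) (Y : BMap D) : Prop where
  disjoint : ∀ δ ∈ S, ∀ ε ∈ S, δ ≠ ε → Disjoint δ.darts ε.darts
  edge : Y.edge = X.edge
  white : Y.white = X.white
  rot_a : ∀ δ ∈ S, Y.rot δ.a = δ.d
  rot_d : ∀ δ ∈ S, Y.rot δ.d = δ.a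
  rot_b : ∀ δ ∈ S, Y.rot δ.b = δ.c
  rot_c : ∀ δ ∈ S, Y.rot δ.c = δ.b
  rot_p : ∀ δ ∈ S, Y.rot δ.p = δ.p'
  rot_p' : ∀ δ ∈ S, Y.rot δ.p' = δ.p
  rot_q : ∀ δ ∈ S, Y.rot δ.q = δ.q'
  rot_q' : ∀ δ ∈ S, Y.rot δ.q' = δ.q
  rot_of_notMem : ∀ u, (∀ δ ∈ S, u ∉ δ.darts) → Y.rot u = X.rot u

/-- Every removal of a dipole creates three components, or two components and a loss of `8` in the
excess.  The inequality counts a missing component as a loss of `8`. -/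
theorem exists_isMultiRemoval [Finite D] (S : Finset X.Dip)
    (hS : ∀ δ ∈ S, ∀ ε ∈ S, δ ≠ ε → Disjoint δ.darts ε.darts) :
    ∃ Y : BMap D, IsMultiRemoval S Y ∧ Y.excess ≤ X.excess ∧
      Y.excess + 24 * S.card + 8 * orb X.rot X.edge ≤ X.excess + 8 * orb Y.rot Y.edge := by
  classical
  induction S using Finset.induction_on with
  | empty => exact ⟨X, by constructor <;> simp, le_rfl, by simp⟩
  | insert δ S hδ ih =>
    obtain ⟨Y, hY, hle, hex⟩ := ih fun δ hδ ε hε =>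
      hS δ (Finset.mem_insert_of_mem hδ) ε (Finset.mem_insert_of_mem hε)
    have hdis : ∀ ε ∈ S, ∀ u ∈ δ.darts, u ∉ ε.darts := fun ε hε u hu hu' =>
      Set.disjoint_left.1 (hS δ (Finset.mem_insert_self _ _) ε (Finset.mem_insert_of_mem hε)
        (by rintro rfl; exact hδ hε)) hu hu'
    have hrot : ∀ u ∈ δ.darts, Y.rot u = X.rot u := fun u hu =>
      hY.rot_of_notMem u fun ε hε => hdis ε hε u hu
    have hfour : ∀ u ∈ δ.darts, Y.Four u := fun u hu => by
      unfold Four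
      rw [hrot u hu, hrot _ (δ.rot_mem.2 hu)]
      exact δ.fours hu
    let δ' : Y.Dip :=
      { p := δ.p, q := δ.q, a := δ.a, b := δ.b, p' := δ.p', q' := δ.q', c := δ.c, d := δ.d
        white_p := by rw [hY.white]; exact δ.white_p
        four_p := hfour _ (by simp [Dip.mem_darts])
        four_p' := hfour _ (by simp [Dip.mem_darts])
        edge_p := by rw [hY.edge]; exact δ.edge_p
        edge_q := by rw [hY.edge]; exact δ.edge_q
        shape := by
          have h := fun u hu => hrot u (δ.mem_darts.2 hu)
          rw [h δ.p (by simp), h δ.q (by simp), h δ.a (by simp), h δ.b (by simp),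
            h δ.p' (by simp), h δ.q' (by simp), h δ.c (by simp), h δ.d (by simp)]
          exact δ.shape }
    have hdarts : δ'.darts = δ.darts := rfl
    obtain ⟨Z, hZ, hex'⟩ := δ'.exists_removal
    have hSrot : ∀ ε ∈ S, ∀ u ∈ ε.darts, Z.rot u = Y.rot u := fun ε hε u hu =>
      hZ.rot_of_notMem u fun hu' => hdis ε hε u hu' hu
    have m := fun (ε : X.Dip) u hu => (ε.mem_darts (u := u)).2 hu
    refine ⟨Z, ?_, ?_, ?_⟩
    · constructor
      · exact hS
      · rw [hZ.edge, hY.edge]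
      · rw [hZ.white, hY.white]
      · rw [Finset.forall_mem_insert]
        exact ⟨hZ.rot_a, fun ε hε => by rw [hSrot ε hε _ (m ε _ (by simp)), hY.rot_a ε hε]⟩
      · rw [Finset.forall_mem_insert]
        exact ⟨hZ.rot_d, fun ε hε => by rw [hSrot ε hε _ (m ε _ (by simp)), hY.rot_d ε hε]⟩
      · rw [Finset.forall_mem_insert]
        exact ⟨hZ.rot_b, fun ε hε => by rw [hSrot ε hε _ (m ε _ (by simp)), hY.rot_b ε hε]⟩
      · rw [Finset.forall_mem_insert]
        exact ⟨hZ.rot_c, fun ε hε => by rw [hSrot ε hε _ (m ε _ (by simp)), hY.rot_c ε hε]⟩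
      · rw [Finset.forall_mem_insert]
        exact ⟨hZ.rot_p, fun ε hε => by rw [hSrot ε hε _ (m ε _ (by simp)), hY.rot_p ε hε]⟩
      · rw [Finset.forall_mem_insert]
        exact ⟨hZ.rot_p', fun ε hε => by rw [hSrot ε hε _ (m ε _ (by simp)), hY.rot_p' ε hε]⟩
      · rw [Finset.forall_mem_insert]
        exact ⟨hZ.rot_q, fun ε hε => by rw [hSrot ε hε _ (m ε _ (by simp)), hY.rot_q ε hε]⟩
      · rw [Finset.forall_mem_insert]
        exact ⟨hZ.rot_q', fun ε hε => by rw [hSrot ε hε _ (m ε _ (by simp)), hY.rot_q' ε hε]⟩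
      · intro u hu
        rw [Finset.forall_mem_insert] at hu
        rw [hZ.rot_of_notMem u hu.1, hY.rot_of_notMem u hu.2]
    · rcases hex' with h | h <;> omega
    · rw [Finset.card_insert_of_notMem hδ]
      push_cast
      rcases hex' with h | h
      · rw [h.2.1, h.2.2]; push_cast; linarith
      · rw [h.2.1]; push_cast; linarith [h.2.2]

instance [Finite D] : Finite X.Dip := by
  refine Finite.of_injective (fun δ : X.Dip => (δ.p, δ.q, δ.a, δ.b, δ.p', δ.q', δ.c, δ.d)) ?_
  rintro ⟨⟩ ⟨⟩ h
  simp only [Prod.mk.injEq] at h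
  obtain ⟨rfl, rfl, rfl, rfl, rfl, rfl, rfl, rfl⟩ := h
  rfl

/-- Every dipole shares a vertex with a member of a maximal family of disjoint dipoles. -/
theorem exists_maximal_disjoint [Finite D] (X : BMap D) : ∃ S : Finset X.Dip,
    (∀ δ ∈ S, ∀ ε ∈ S, δ ≠ ε → Disjoint δ.darts ε.darts) ∧
      ∀ ε : X.Dip, ∃ δ ∈ S, ¬ Disjoint ε.darts δ.darts := by
  classical
  have : Fintype X.Dip := Fintype.ofFinite _
  obtain ⟨S, hS⟩ := (Set.toFinite {S : Finset X.Dip |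
    ∀ δ ∈ S, ∀ ε ∈ S, δ ≠ ε → Disjoint δ.darts ε.darts}).exists_maximal ⟨∅, by simp⟩
  refine ⟨S, hS.prop, fun ε => ?_⟩
  by_contra hno
  push Not at hno
  have hmem : ε ∈ S := by
    refine hS.le_of_ge (y := insert ε S) ?_ (Finset.subset_insert _ _) (Finset.mem_insert_self _ _)
    intro δ₁ h₁ δ₂ h₂ hne
    rw [Finset.mem_insert] at h₁ h₂
    rcases h₁ with rfl | h₁ <;> rcases h₂ with rfl | h₂
    · exact (hne rfl).elim
    · exact hno _ h₂
    · exact (hno _ h₁).symm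
    · exact hS.prop _ h₁ _ h₂ hne
  have := hno ε hmem
  exact Set.disjoint_left.1 this (ε.mem_darts.2 (Or.inl rfl)) (ε.mem_darts.2 (Or.inl rfl))

/-- The dipole at a face of length 2. -/
def faceDip (X : BMap D) (p : D) (hw : X.white p) (hf : X.Four p) (hf' : X.Four (X.edge p))
    (hp : X.edge p = X.rot (X.edge (X.rot p))) : X.Dip where
  p := p
  q := X.rot p
  a := X.rot (X.rot p)
  b := X.rot (X.rot (X.rot p))
  p' := X.edge p
  q' := X.edge (X.rot p)
  c := X.rot (X.edge p)
  d := X.rot (X.rot (X.edge p))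
  white_p := hw
  four_p := hf
  four_p' := hf'
  edge_p := rfl
  edge_q := rfl
  shape := Or.inl ⟨rfl, rfl, rfl, X.rot_four p, hp.symm, rfl, rfl, by rw [hp, X.rot_four]⟩

/-- A property that is invariant under rotation is constant on each of the two vertices. -/
theorem Dip.rot_invariant (δ : X.Dip) {P : D → Prop} (hP : ∀ u, P (X.rot u) ↔ P u) :
    (P δ.q ↔ P δ.p) ∧ (P δ.a ↔ P δ.p) ∧ (P δ.b ↔ P δ.p) ∧ (P δ.q' ↔ P δ.p') ∧
      (P δ.c ↔ P δ.p') ∧ (P δ.d ↔ P δ.p') := by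
  rcases δ.shape with ⟨e1, e2, e3, -, e5, e6, e7, e8⟩ | ⟨e1, e2, e3, -, e5, e6, e7, e8⟩
  · have k1 := hP δ.p; have k2 := hP δ.q; have k3 := hP δ.a
    have k5 := hP δ.q'; have k6 := hP δ.p'; have k7 := hP δ.c
    rw [e1] at k1; rw [e2] at k2; rw [e3] at k3; rw [e5] at k5; rw [e6] at k6; rw [e7] at k7
    tauto
  · have k1 := hP δ.p; have k2 := hP δ.a; have k3 := hP δ.q
    have k5 := hP δ.p'; have k6 := hP δ.c; have k7 := hP δ.q'
    rw [e1] at k1; rw [e2] at k2; rw [e3] at k3; rw [e5] at k5; rw [e6] at k6; rw [e7] at k7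
    tauto

namespace IsMultiRemoval

variable {S : Finset X.Dip} {Y : BMap D}

theorem not_four (h : IsMultiRemoval S Y) {δ : X.Dip} (hδ : δ ∈ S) {u : D} (hu : u ∈ δ.darts) :
    ¬ Y.Four u := by
  rw [BMap.not_four]
  have h1 := h.rot_a δ hδ; have h2 := h.rot_d δ hδ; have h3 := h.rot_b δ hδ
  have h4 := h.rot_c δ hδ; have h5 := h.rot_p δ hδ; have h6 := h.rot_p' δ hδ
  have h7 := h.rot_q δ hδ; have h8 := h.rot_q' δ hδ
  rw [Dip.mem_darts] at hu
  rcases hu with rfl | rfl | rfl | rfl | rfl | rfl | rfl | rfl <;> simp [*]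

theorem four_iff (h : IsMultiRemoval S Y) {u : D} :
    Y.Four u ↔ X.Four u ∧ ∀ δ ∈ S, u ∉ δ.darts := by
  by_cases hu : ∀ δ ∈ S, u ∉ δ.darts
  · have hu' : ∀ δ ∈ S, X.rot u ∉ δ.darts := fun δ hδ h => hu δ hδ (δ.rot_mem.1 h)
    unfold Four
    rw [h.rot_of_notMem _ hu, h.rot_of_notMem _ hu']
    exact (and_iff_left hu).symm
  · refine iff_of_false ?_ (fun h => hu h.2)
    push Not at hu
    obtain ⟨δ, hδ, hu⟩ := hu
    exact h.not_four hδ hu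

theorem rot_of_four (h : IsMultiRemoval S Y) {u : D} (hu : Y.Four u) : Y.rot u = X.rot u :=
  h.rot_of_notMem u (h.four_iff.1 hu).2

/-- The two inner edges of a removed dipole are components on their own. -/
theorem conn_inner (h : IsMultiRemoval S Y) {δ : X.Dip} (hδ : δ ∈ S) {u : D} :
    (Y.Conn u δ.p → u = δ.p ∨ u = δ.p') ∧ (Y.Conn u δ.q → u = δ.q ∨ u = δ.q') := by
  constructor
  · intro hu
    refine (hu.invariant (P := fun u => u = δ.p ∨ u = δ.p')
      (fun u => perm_pair_iff (h.rot_p δ hδ) (h.rot_p' δ hδ)) fun u => perm_pair_iff ?_ ?_).2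
        (Or.inl rfl)
    · rw [h.edge, δ.edge_p]
    · rw [h.edge, δ.edge_p']
  · intro hu
    refine (hu.invariant (P := fun u => u = δ.q ∨ u = δ.q')
      (fun u => perm_pair_iff (h.rot_q δ hδ) (h.rot_q' δ hδ)) fun u => perm_pair_iff ?_ ?_).2
        (Or.inl rfl)
    · rw [h.edge, δ.edge_q]
    · rw [h.edge, δ.edge_q']

/-- When the family of removed dipoles is maximal, every dipole has lost a vertex. -/
theorem not_four_of_maximal (h : IsMultiRemoval S Y)
    (hS : ∀ ε : X.Dip, ∃ δ ∈ S, ¬ Disjoint ε.darts δ.darts) (ε : X.Dip) :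
    ¬ (Y.Four ε.p ∧ Y.Four ε.p') := by
  rintro ⟨h1, h2⟩
  obtain ⟨δ, hδ, hdis⟩ := hS ε
  apply hdis
  have n1 := (h.four_iff.1 h1).2 δ hδ
  have n2 := (h.four_iff.1 h2).2 δ hδ
  obtain ⟨k1, k2, k3, k4, k5, k6⟩ := ε.rot_invariant (P := fun u => u ∉ δ.darts)
    fun u => not_congr δ.rot_mem
  rw [Set.disjoint_left]
  intro u hu
  rw [Dip.mem_darts] at hu
  rcases hu with rfl | rfl | rfl | rfl | rfl | rfl | rfl | rfl
  exacts [n1, k1.2 n1, k2.2 n1, k3.2 n1, n2, k4.2 n2, k5.2 n2, k6.2 n2]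

end IsMultiRemoval
end BMap
end MatrixModel

namespace MatrixModel
open Equiv

/-! ### Components after the removal of a maximal family of dipoles -/

namespace RootedMap

variable {M : RootedMap}

/-- A nonempty set of half-edges that is mapped into itself by `rot` and `edge` contains all of
them. -/
theorem mem_of_mapsTo {P : M.Dart → Prop} (h₁ : ∀ u, P u → P (M.rot u))
    (h₂ : ∀ u, P u → P (M.edge u)) {u : M.Dart} (hu : P u) (v : M.Dart) : P v :=
  (conn_toBMap u v).mem_of_mapsTo h₁ h₂ hu

theorem not_four_root : ¬ M.toBMap.Four M.root := by
  rw [four_toBMap]; exact fun h => h.1 rfl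

theorem eq_root_of_not_four {u : M.Dart} (hu : ¬ M.toBMap.Four u) (hw : M.white u) :
    u = M.root := by
  rw [four_toBMap, Ordinary, not_and_or, not_not, not_not] at hu
  rcases hu with rfl | rfl
  exacts [rfl, (M.black_rot_root hw).elim]

end RootedMap

namespace BMap

variable {D : Type*} {X : BMap D}

theorem Dip.isMelon_of_edge_a (δ : X.Dip) (h : X.edge δ.a = δ.d) : X.IsMelon δ.p := by
  have hf : X.Four (X.edge δ.p) := by rw [δ.edge_p]; exact δ.four_p'
  rcases δ.shape with ⟨e1, e2, e3, e4, e5, e6, e7, e8⟩ | ⟨e1, e2, e3, e4, e5, e6, e7, e8⟩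
  · exact ⟨δ.white_p, δ.four_p, hf, by rw [e1, δ.edge_p, δ.edge_q, e5],
      by rw [e1, e2, h, δ.edge_q, e8]⟩
  · exact ⟨δ.white_p, δ.four_p, hf, by rw [e1, δ.edge_p, h, e8], by rw [e1, e2, h, δ.edge_q, e7]⟩

theorem Dip.isMelon_of_edge_b (δ : X.Dip) (h : X.edge δ.b = δ.c) : ∃ m, X.IsMelon m := by
  obtain ⟨w1, w2, w3, w4⟩ := δ.whites
  rcases δ.shape with ⟨e1, e2, e3, e4, e5, e6, e7, e8⟩ | ⟨e1, e2, e3, e4, e5, e6, e7, e8⟩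
  · exact ⟨δ.b, w4, δ.fours (by simp [mem_darts]),
      by rw [h]; exact δ.fours (by simp [mem_darts]), by rw [e4, h, δ.edge_p, e6],
      by rw [e4, e1, δ.edge_p, δ.edge_q, e5]⟩
  · exact ⟨δ.q, w2, δ.fours (by simp [mem_darts]),
      by rw [δ.edge_q]; exact δ.fours (by simp [mem_darts]), by rw [e3, h, δ.edge_q, e6],
      by rw [e3, e4, h, δ.edge_p, e5]⟩

namespace IsMultiRemoval

variable {S : Finset X.Dip} {Y : BMap D}

/-- After the removal of a maximal family of disjoint dipoles, a component with at most two white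
half-edges at vertices of degree 2 does not contain two melons.  Otherwise there is a melon at most
one of whose three edges has been cut, and the other two form a dipole that has not been removed. -/
theorem not_twoMelons (h : IsMultiRemoval S Y)
    (hS : ∀ ε : X.Dip, ∃ δ ∈ S, ¬ Disjoint ε.darts δ.darts) {Z : BMap D} (hZ : Z.Clean)
    (hr : Z.rot = Y.rot) (hw : Z.white = Y.white)
    (he : ∀ u, Y.Four u → Y.Four (Y.edge u) → Z.edge u = Y.edge u)
    (hc : ∀ u v, Y.Four u → Y.Four v → (Z.Conn u v ↔ Y.Conn u v)) {t : D} (ht : Y.Four t) {z₁ z₂ : D}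
    (hz : ∀ w, Y.white w → ¬ Y.Four w → Y.Conn w t → w = z₁ ∨ w = z₂) : ¬ Z.TwoMelons t := by
  intro hT
  have hF := four_congr (X := Y) hr
  -- the only white half-edges whose edges carry a forgotten vertex
  have hy : ∀ u, Y.white u → Y.Four u → Y.Conn u t → u ≠ Y.edge (Y.rot z₁) →
      u ≠ Y.edge (Y.rot z₂) → Y.Four (Y.edge u) := by
    intro u wu fu cu n1 n2
    by_contra hn
    have hn' : ¬ Y.Four (Y.rot (Y.edge u)) := by rwa [four_rot]
    have h1 : ∀ z, Y.rot (Y.edge u) = z → u = Y.edge (Y.rot z) := by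
      rintro z rfl
      rw [BMap.not_four.1 hn, Y.edge_edge]
    rcases hz (Y.rot (Y.edge u)) (by rw [white_rot' hn, Y.white_edge, not_not]; exact wu) hn'
      ((conn_rot _).trans ((conn_edge u).trans cu)) with h2 | h2
    exacts [n1 (h1 _ h2), n2 (h1 _ h2)]
  obtain ⟨m, cm, ⟨wm, fm, fe, e0, e1⟩, a0, a1, a2⟩ := hT.exists_avoiding (Y.edge (Y.rot z₁))
  rw [hF] at fm
  have cm' := (hc m t fm ht).1 cm
  rw [hr] at e0 e1 a1 a2
  rw [hw] at wm
  have f1 : Y.Four (Y.rot m) := four_rot.2 fm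
  have f2 : Y.Four (Y.rot (Y.rot m)) := four_rot.2 f1
  have w1 := (white_rot fm).2 wm
  have w2 := (white_rot f1).2 w1
  have g0 : Y.Four (Z.edge m) := (hF _).1 (hZ.four_edge.2 ((hF _).2 fm))
  have g1 : Y.Four (Z.edge (Y.rot m)) := (hF _).1 (hZ.four_edge.2 ((hF _).2 f1))
  have g2 : Y.Four (Z.edge (Y.rot (Y.rot m))) := (hF _).1 (hZ.four_edge.2 ((hF _).2 f2))
  have c1 : Y.Conn (Y.rot m) t := (conn_rot m).trans cm'
  have c2 : Y.Conn (Y.rot (Y.rot m)) t := (conn_rot _).trans c1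
  have ee : ∀ u, Y.white u → Y.Four u → Y.Conn u t → u ≠ Y.edge (Y.rot z₁) →
      u ≠ Y.edge (Y.rot z₂) → X.edge u = Z.edge u := fun u wu fu cu n1 n2 => by
    rw [he u fu (hy u wu fu cu n1 n2), h.edge]
  have rr := fun u hu => h.rot_of_four (u := u) hu
  have hX4 : ∀ u, Y.Four u → X.Four u := fun u hu => (h.four_iff.1 hu).1
  have hXw : Y.white = X.white := h.white
  -- the cut edge is the first, the second or none of the first two edges of the melon
  by_cases k0 : m = Y.edge (Y.rot z₂)
  · have n1 : Y.rot m ≠ Y.edge (Y.rot z₂) := by rw [← k0]; exact rot_ne m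
    have n2 : Y.rot (Y.rot m) ≠ Y.edge (Y.rot z₂) := by rw [← k0]; exact fm
    have E1 := ee _ w1 f1 c1 a1.symm n1
    have E2 := ee _ w2 f2 c2 a2.symm n2
    refine h.not_four_of_maximal hS (faceDip X (Y.rot m) (hXw ▸ w1) (hX4 _ f1)
      (by rw [E1]; exact hX4 _ g1) ?_) ⟨f1, by change Y.Four (X.edge _); rw [E1]; exact g1⟩
    rw [← rr _ f1, E1, E2, e1, rr _ g2]
  by_cases k1 : Y.rot m = Y.edge (Y.rot z₂)
  · have n2 : Y.rot (Y.rot m) ≠ Y.edge (Y.rot z₂) := by rw [← k1]; exact rot_ne _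
    have E0 := ee _ wm fm cm' a0.symm k0
    have E2 := ee _ w2 f2 c2 a2.symm n2
    have G2 : Y.Four (Y.rot (Z.edge (Y.rot (Y.rot m)))) := four_rot.2 g2
    refine h.not_four_of_maximal hS (straightDip X m (hXw ▸ wm) (hX4 _ fm)
      (by rw [E0]; exact hX4 _ g0) ?_) ⟨fm, by change Y.Four (X.edge _); rw [E0]; exact g0⟩
    rw [← rr _ fm, ← rr _ f1, E0, E2, e0, e1, rr _ G2, rr _ g2, X.rot_four]
  · have E0 := ee _ wm fm cm' a0.symm k0
    have E1 := ee _ w1 f1 c1 a1.symm k1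
    refine h.not_four_of_maximal hS (faceDip X m (hXw ▸ wm) (hX4 _ fm)
      (by rw [E0]; exact hX4 _ g0) ?_) ⟨fm, by change Y.Four (X.edge _); rw [E0]; exact g0⟩
    rw [← rr _ fm, E0, E1, e0, rr _ g1]

end IsMultiRemoval
end BMap

/-- The elementary count behind `exists_exceptional`.  The components `κ` contain `m κ` white
half-edges; `J` stands for the inner edges of the removed dipoles and `R` for the rings with two
white half-edges.  The inequality holds term by term. -/
theorem sum_add_card_le {Q : Type*} [Fintype Q] [DecidableEq Q] (m : Q → ℕ) (hm : ∀ κ, 1 ≤ m κ)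
    (J R : Finset Q) (hR : ∀ κ ∈ R, m κ = 2) :
    ∑ κ ∈ (J ∪ R)ᶜ, m κ + 6 * Fintype.card Q ≤
      3 * ∑ κ, m κ + 3 * J.card + 5 * ((J ∪ R)ᶜ.filter fun κ => m κ ≤ 2).card := by
  have h1 : ∑ κ ∈ (J ∪ R)ᶜ, m κ = ∑ κ, if κ ∈ (J ∪ R)ᶜ then m κ else 0 := by
    rw [Finset.sum_ite_mem, Finset.univ_inter]
  have h2 : J.card = ∑ κ, if κ ∈ J then 1 else 0 := by
    rw [Finset.sum_ite_mem, Finset.univ_inter, Finset.card_eq_sum_ones]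
  have h3 : ((J ∪ R)ᶜ.filter fun κ => m κ ≤ 2).card =
      ∑ κ, if κ ∈ (J ∪ R)ᶜ.filter fun κ => m κ ≤ 2 then 1 else 0 := by
    rw [Finset.sum_ite_mem, Finset.univ_inter, Finset.card_eq_sum_ones]
  rw [h1, h2, h3, Fintype.card_eq_sum_ones, Finset.mul_sum, Finset.mul_sum, Finset.mul_sum,
    Finset.mul_sum, ← Finset.sum_add_distrib, ← Finset.sum_add_distrib, ← Finset.sum_add_distrib]
  refine Finset.sum_le_sum fun κ _ => ?_
  have := hm κ
  have := hR κ
  simp only [Finset.mem_filter, Finset.mem_compl, Finset.mem_union]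
  split_ifs <;> grind

namespace RootedMap

open BMap

variable {M : RootedMap} {S : Finset M.toBMap.Dip} {Y : BMap M.Dart}

/-- Every component contains a vertex of degree 2, because the original map is connected and contains
the root. -/
theorem exists_white_not_four (h : IsMultiRemoval S Y) (d : M.Dart) :
    ∃ w, Y.Conn w d ∧ M.white w ∧ ¬ Y.Four w := by
  have h1 : ∃ u, Y.Conn u d ∧ ¬ Y.Four u := by
    by_contra hno
    push Not at hno
    have := mem_of_mapsTo (P := fun u => Y.Conn u d) (fun u hu => ?_) (fun u hu => ?_)
      (show Y.Conn d d from rfl) M.root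
    · exact not_four_root (h.four_iff.1 (hno _ this)).1
    · have h2 : Y.rot u = M.rot u := h.rot_of_four (hno u hu)
      rw [← h2]
      exact (conn_rot u).trans hu
    · have h2 : Y.edge u = M.edge u := by rw [h.edge]; rfl
      rw [← h2]
      exact (conn_edge u).trans hu
  obtain ⟨u, hu, hf⟩ := h1
  have hw : Y.white = M.white := h.white
  by_cases wu : M.white u
  · exact ⟨u, hu, wu, hf⟩
  · exact ⟨Y.rot u, (conn_rot u).trans hu, by rw [← hw, white_rot' hf, hw]; exact wu,
      by rwa [four_rot]⟩

/-- A white half-edge at a vertex of degree 2 is the root or belongs to a removed dipole. -/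
theorem eq_of_white_not_four (h : IsMultiRemoval S Y) {w : M.Dart} (hw : M.white w)
    (hf : ¬ Y.Four w) : w = M.root ∨ ∃ δ ∈ S, w = δ.p ∨ w = δ.q ∨ w = δ.a ∨ w = δ.b := by
  rw [h.four_iff, not_and_or] at hf
  rcases hf with hf | hf
  · exact Or.inl (eq_root_of_not_four hf hw)
  · right
    push Not at hf
    obtain ⟨δ, hδ, hf⟩ := hf
    refine ⟨δ, hδ, ?_⟩
    obtain ⟨b1, b2, b3, b4⟩ := δ.blacks
    rw [Dip.mem_darts] at hf
    rcases hf with rfl | rfl | rfl | rfl | rfl | rfl | rfl | rfl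
    exacts [Or.inl rfl, Or.inr (Or.inl rfl), Or.inr (Or.inr (Or.inl rfl)),
      Or.inr (Or.inr (Or.inr rfl)), (b1 hw).elim, (b2 hw).elim, (b3 hw).elim, (b4 hw).elim]

/-- A ring with a single white half-edge, other than the inner edges of the removed dipoles, contains
the root, for otherwise it closes a side of a dipole to a melon. -/
theorem eq_root_of_unique (hm : M.MelonFree) (h : IsMultiRemoval S Y) {w : M.Dart}
    (hw : M.white w) (hJ : ∀ δ ∈ S, w ≠ δ.p ∧ w ≠ δ.q) (hR : ∀ u, Y.Conn u w → ¬ Y.Four u)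
    (hu : ∀ v, M.white v → Y.Conn v w → v = w) : w = M.root := by
  have hYw : Y.white = M.white := h.white
  have f0 := hR w rfl
  have c1 : Y.Conn (Y.rot w) w := conn_rot w
  have c2 : Y.Conn (Y.edge (Y.rot w)) w := (conn_edge _).trans c1
  have e1 : Y.edge (Y.rot w) = w := by
    refine hu _ ?_ c2
    rw [← hYw, Y.white_edge, white_rot' f0, not_not, hYw]
    exact hw
  have e2 : M.toBMap.edge w = Y.rot w := by
    rw [← h.edge, ← e1, Y.edge_edge, e1]
  rcases eq_of_white_not_four h hw f0 with h1 | ⟨δ, hδ, rfl | rfl | rfl | rfl⟩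
  · exact h1
  · exact ((hJ δ hδ).1 rfl).elim
  · exact ((hJ δ hδ).2 rfl).elim
  · rw [h.rot_a δ hδ] at e2
    exact (hm _ (M.isMelon_toBMap.1 (δ.isMelon_of_edge_a e2))).elim
  · rw [h.rot_b δ hδ] at e2
    obtain ⟨m, hm'⟩ := δ.isMelon_of_edge_b e2
    exact (hm _ (M.isMelon_toBMap.1 hm')).elim

/-- The components after the removal of a maximal family are the inner edges of the removed dipoles
and rings with at most two white half-edges, up to components whose white half-edges at vertices of
degree 2 form a set `B` with a cardinality controlled by the excess. -/
theorem exists_exceptional (hm : M.MelonFree) (h : IsMultiRemoval S Y)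
    (hS : ∀ ε : M.toBMap.Dip, ∃ δ ∈ S, ¬ Disjoint ε.darts δ.darts)
    (hle : Y.excess ≤ M.toBMap.excess)
    (hex : Y.excess + 24 * S.card + 8 ≤ M.toBMap.excess + 8 * orb Y.rot Y.edge)
    {Z : BMap M.Dart} (hZ : Z.Clean) (hr : Z.rot = Y.rot) (hw : Z.white = Y.white)
    (hZex : Z.excess = Y.excess)
    (he : ∀ u, Y.Four u → Y.Four (Y.edge u) → Z.edge u = Y.edge u)
    (hc : ∀ u v, Y.Four u → Y.Four v → (Z.Conn u v ↔ Y.Conn u v)) :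
    ∃ B : Finset M.Dart, 4 * (B.card : ℤ) ≤ 5 * M.toBMap.excess + 8 ∧
      ∀ w, M.white w → ¬ Y.Four w → (∀ δ ∈ S, ¬ Y.Conn w δ.p ∧ ¬ Y.Conn w δ.q) →
        w ∈ B ∨ (∀ u, Y.Conn u w → ¬ Y.Four u) ∧
          ∃ z₁ z₂, ∀ v, M.white v → Y.Conn v w → v = z₁ ∨ v = z₂ := by
  classical
  have : Fintype M.Dart := Fintype.ofFinite _
  have : Fintype (Quot (orbRel Y.rot Y.edge)) := Fintype.ofFinite _
  set k : M.Dart → Quot (orbRel Y.rot Y.edge) := Quot.mk _ with hk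
  -- the white half-edges at vertices of degree 2; the component `κ` contains `m κ` of them
  set W : Finset M.Dart := Finset.univ.filter fun w => M.white w ∧ ¬ Y.Four w with hW
  have mW : ∀ w, w ∈ W ↔ M.white w ∧ ¬ Y.Four w := by simp [hW]
  set m : Quot (orbRel Y.rot Y.edge) → ℕ := fun κ => (W.filter fun w => k w = κ).card with hmdef
  have hm1 : ∀ κ, 1 ≤ m κ := by
    intro κ
    induction κ using Quot.ind with
    | mk d =>
      obtain ⟨w, h1, h2, h3⟩ := exists_white_not_four h d
      exact Finset.card_pos.2 ⟨w, Finset.mem_filter.2 ⟨(mW w).2 ⟨h2, h3⟩, h1⟩⟩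
  -- the inner edges of the removed dipoles, and the rings with two white half-edges
  set J : Finset (Quot (orbRel Y.rot Y.edge)) := S.biUnion fun δ => {k δ.p, k δ.q} with hJ
  set R : Finset (Quot (orbRel Y.rot Y.edge)) := Finset.univ.filter fun κ =>
    m κ = 2 ∧ ∀ u, k u = κ → ¬ Y.Four u with hRdef
  have key := sum_add_card_le m hm1 J R fun κ hκ => (Finset.mem_filter.1 hκ).2.1
  set B := W.filter fun w => k w ∈ (J ∪ R)ᶜ with hB
  have hBsum : B.card = ∑ κ ∈ (J ∪ R)ᶜ, m κ := by
    rw [Finset.card_eq_sum_card_fiberwise (s := B) (f := k) (t := (J ∪ R)ᶜ)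
      (fun w hw => (Finset.mem_filter.1 (Finset.mem_coe.1 hw)).2)]
    refine Finset.sum_congr rfl fun κ hκ => ?_
    rw [hmdef, hB, Finset.filter_filter]
    congr 1
    refine Finset.filter_congr fun w _ => ?_
    exact ⟨fun h => h.2, fun h => ⟨by rw [h]; exact hκ, h⟩⟩
  have hWsum : W.card = ∑ κ, m κ :=
    Finset.card_eq_sum_card_fiberwise (f := k) (t := Finset.univ) (fun w _ => Finset.mem_univ _)
  have hWcard : W.card ≤ 4 * S.card + 1 := by
    have hsub : W ⊆ insert M.root (S.biUnion fun δ => {δ.p, δ.q, δ.a, δ.b}) := by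
      intro w hw
      rw [mW] at hw
      rw [Finset.mem_insert, Finset.mem_biUnion]
      simpa using eq_of_white_not_four h hw.1 hw.2
    have h1 := (Finset.card_le_card hsub).trans (Finset.card_insert_le _ _)
    have h2 := Finset.card_biUnion_le_card_mul S
      (fun δ => ({δ.p, δ.q, δ.a, δ.b} : Finset M.Dart)) 4 fun δ _ => Finset.card_le_four
    omega
  have hJcard : J.card ≤ 2 * S.card := by
    have := Finset.card_biUnion_le_card_mul S
      (fun δ => ({k δ.p, k δ.q} : Finset (Quot (orbRel Y.rot Y.edge)))) 2
      fun δ _ => Finset.card_le_two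
    rw [hJ]
    omega
  have horb : orb Y.rot Y.edge = Fintype.card (Quot (orbRel Y.rot Y.edge)) :=
    Nat.card_eq_fintype_card
  have hnJ : ∀ {w}, k w ∉ J → ∀ δ ∈ S, w ≠ δ.p ∧ w ≠ δ.q := by
    intro w hw δ hδ
    constructor <;> rintro rfl <;> exact hw (Finset.mem_biUnion.2 ⟨δ, hδ, by simp⟩)
  -- Other components with at most two white half-edges: if they contain vertices of degree 4, then
  -- they do not contain two melons, and their number is bounded by the excess; the only other one
  -- may be the ring of the root.
  set T₀ := (J ∪ R)ᶜ.filter fun κ => m κ ≤ 2 with hT₀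
  have hT : (4 * T₀.card : ℤ) ≤ 4 + Y.excess := by
    set T₁ := T₀.filter fun κ => ∃ u, k u = κ ∧ Y.Four u with hT₁
    set T₂ := T₀.filter fun κ => ¬ ∃ u, k u = κ ∧ Y.Four u with hT₂
    have hsplit : T₁.card + T₂.card = T₀.card := Finset.card_filter_add_card_filter_not _
    have h2 : T₂.card ≤ 1 := by
      rw [← Finset.card_singleton (k M.root)]
      refine Finset.card_le_card fun κ hκ => ?_
      rw [hT₂, Finset.mem_filter, hT₀, Finset.mem_filter, Finset.mem_compl, Finset.mem_union,
        not_or] at hκ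
      obtain ⟨⟨⟨nJ, nR⟩, hle⟩, hno⟩ := hκ
      push Not at hno
      have hmκ : m κ = 1 := by
        have h1 := hm1 κ
        have h2 : m κ ≠ 2 := fun h2 => nR (Finset.mem_filter.2 ⟨Finset.mem_univ _, h2, hno⟩)
        omega
      obtain ⟨w, hw'⟩ := Finset.card_eq_one.1 hmκ
      have hwm : ∀ v, (v ∈ W ∧ k v = κ) ↔ v = w := fun v => by
        have h := Finset.ext_iff.1 hw' v
        rwa [Finset.mem_filter, Finset.mem_singleton] at h
      obtain ⟨w1, rfl⟩ := (hwm w).2 rfl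
      rw [mW] at w1
      rw [Finset.mem_singleton]
      congr 1
      exact eq_root_of_unique hm h w1.1 (hnJ nJ) (fun u hu => hno u hu)
        fun v hv hvw => (hwm v).1 ⟨(mW v).2 ⟨hv, hno v hvw⟩, hvw⟩
    have h1 : (4 * T₁.card : ℤ) ≤ Z.excess := by
      have hex : ∀ κ, ∃ u, κ ∈ T₁ → k u = κ ∧ Y.Four u := by
        intro κ
        by_cases hκ : κ ∈ T₁
        · obtain ⟨u, hu⟩ := (Finset.mem_filter.1 hκ).2
          exact ⟨u, fun _ => hu⟩
        · exact ⟨M.root, fun h => (hκ h).elim⟩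
      choose rep hrep using hex
      have hinj : Set.InjOn rep T₁ := fun κ hκ κ' hκ' h => by
        rw [← (hrep κ hκ).1, ← (hrep κ' hκ').1, h]
      have hF := four_congr (X := Y) hr
      rw [← Finset.card_image_of_injOn hinj]
      refine hZ.four_mul_card_le _ ?_ ?_ ?_
      · intro t ht
        obtain ⟨κ, hκ, rfl⟩ := Finset.mem_image.1 ht
        exact (hF _).2 (hrep κ hκ).2
      · intro s hs t ht hst
        obtain ⟨κ, hκ, rfl⟩ := Finset.mem_image.1 hs
        obtain ⟨κ', hκ', rfl⟩ := Finset.mem_image.1 ht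
        have := (hc _ _ (hrep κ hκ).2 (hrep κ' hκ').2).1 hst
        congr 1
        rw [← (hrep κ hκ).1, ← (hrep κ' hκ').1]
        exact this
      · intro t ht
        obtain ⟨κ, hκ, rfl⟩ := Finset.mem_image.1 ht
        have hle := (Finset.mem_filter.1 (Finset.mem_filter.1 hκ).1).2
        have hz : ∃ z₁ z₂, W.filter (fun w => k w = κ) ⊆ {z₁, z₂} := by
          have h1 := hm1 κ
          rcases (show m κ = 1 ∨ m κ = 2 by omega) with h2 | h2
          · obtain ⟨z, hz⟩ := Finset.card_eq_one.1 h2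
            exact ⟨z, z, by simp [hz]⟩
          · obtain ⟨z₁, z₂, -, hz⟩ := Finset.card_eq_two.1 h2
            exact ⟨z₁, z₂, by simp [hz]⟩
        obtain ⟨z₁, z₂, hz⟩ := hz
        refine h.not_twoMelons hS hZ hr hw he hc (hrep κ hκ).2 (z₁ := z₁) (z₂ := z₂) ?_
        intro w w1 w2 w3
        rw [h.white] at w1
        have := hz (Finset.mem_filter.2
          ⟨(mW w).2 ⟨w1, w2⟩, (show k w = _ from w3).trans (hrep κ hκ).1⟩)
        simpa using this
    rw [hZex] at h1
    omega
  refine ⟨B, ?_, ?_⟩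
  · rw [← hBsum, ← hWsum, ← horb] at key
    omega
  · intro w w1 w2 w3
    by_cases hwB : w ∈ B
    · exact Or.inl hwB
    right
    have hJR : k w ∈ J ∪ R := by
      by_contra hn
      exact hwB (Finset.mem_filter.2 ⟨(mW w).2 ⟨w1, w2⟩, Finset.mem_compl.2 hn⟩)
    rw [Finset.mem_union] at hJR
    rcases hJR with hJ' | hR'
    · exfalso
      obtain ⟨δ, hδ, hw⟩ := Finset.mem_biUnion.1 hJ'
      rw [Finset.mem_insert, Finset.mem_singleton] at hw
      rcases hw with hw | hw
      · exact (w3 δ hδ).1 hw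
      · exact (w3 δ hδ).2 hw
    · obtain ⟨-, h2, hno⟩ := Finset.mem_filter.1 hR'
      refine ⟨fun u hu => hno u hu, ?_⟩
      obtain ⟨z₁, z₂, -, hz⟩ := Finset.card_eq_two.1 h2
      refine ⟨z₁, z₂, fun v hv hvw => ?_⟩
      have : v ∈ W.filter (fun u => k u = k w) :=
        Finset.mem_filter.2 ⟨(mW v).2 ⟨hv, hno v hvw⟩, hvw⟩
      rw [hz] at this
      simpa using this

end RootedMap
end MatrixModel

namespace MatrixModel
open Equiv

/-! ### The half-edges of the scheme -/

namespace BMap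

variable {D : Type*} {X : BMap D}

/-- Two dipoles with the same inner edges have the same sides. -/
theorem Dip.sides_eq (δ η : X.Dip) (hp : η.p = δ.p ∨ η.p = δ.q) (hq : η.q = δ.p ∨ η.q = δ.q) :
    (η.a = δ.a ∧ η.d = δ.d ∧ η.b = δ.b ∧ η.c = δ.c) ∨
      (η.a = δ.b ∧ η.d = δ.c ∧ η.b = δ.a ∧ η.c = δ.d) := by
  have n1 := δ.nodup
  have n2 := η.nodup
  simp only [List.nodup_cons, List.mem_cons, not_or] at n1 n2
  have e1 := δ.edge_p; have e2 := δ.edge_q; have e3 := η.edge_p; have e4 := η.edge_q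
  have r := fun x => X.rot_four x
  rcases hp with hp | hp <;> rcases hq with hq | hq
  · exact (n2.1.1 (hp.trans hq.symm)).elim
  · rw [hp, e1] at e3
    rw [hq, e2] at e4
    rcases δ.shape with ⟨s1, s2, s3, s4, s5, s6, s7, s8⟩ | ⟨s1, s2, s3, s4, s5, s6, s7, s8⟩ <;>
      rcases η.shape with ⟨t1, t2, t3, t4, t5, t6, t7, t8⟩ | ⟨t1, t2, t3, t4, t5, t6, t7, t8⟩ <;>
      grind
  · rw [hp, e2] at e3
    rw [hq, e1] at e4
    rcases δ.shape with ⟨s1, s2, s3, s4, s5, s6, s7, s8⟩ | ⟨s1, s2, s3, s4, s5, s6, s7, s8⟩ <;>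
      rcases η.shape with ⟨t1, t2, t3, t4, t5, t6, t7, t8⟩ | ⟨t1, t2, t3, t4, t5, t6, t7, t8⟩ <;>
      grind
  · exact (n2.1.1 (hp.trans hq.symm)).elim

/-- The side of `δ` that contains the white half-edge `x` and the black half-edge `y` is glued to a
side of `ε`. -/
def Dip.GluedTo (ε : X.Dip) (x y : D) : Prop :=
  (X.edge x = ε.d ∧ X.edge y = ε.a) ∨ (X.edge x = ε.c ∧ X.edge y = ε.b)

theorem Dip.GluedTo.mem {ε : X.Dip} {x y : D} (h : ε.GluedTo x y) :
    X.edge x ∈ ε.darts ∧ X.edge y ∈ ε.darts := by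
  rcases h with ⟨h1, h2⟩ | ⟨h1, h2⟩ <;> rw [h1, h2] <;> simp [mem_darts]

/-- A dipole that shares a vertex with a dipole glued on both sides to two other dipoles has the
same inner edges: two edges that join the same two vertices cannot lead to different dipoles. -/
theorem Dip.inner_eq_of_glued (δ ε ε' η : X.Dip) (h1 : ε.GluedTo δ.a δ.d) (h2 : ε'.GluedTo δ.b δ.c)
    (d1 : Disjoint δ.darts ε.darts) (d2 : Disjoint δ.darts ε'.darts)
    (d3 : Disjoint ε.darts ε'.darts) {u : D} (hu : u ∈ δ.darts) (hu' : u ∈ η.darts) :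
    (η.p = δ.p ∨ η.p = δ.q) ∧ (η.q = δ.p ∨ η.q = δ.q) := by
  rw [Set.disjoint_left] at d1 d2 d3
  have ep : X.edge δ.p ∈ δ.darts := by rw [δ.edge_p]; simp [mem_darts]
  have eq : X.edge δ.q ∈ δ.darts := by rw [δ.edge_q]; simp [mem_darts]
  have ep' : X.edge δ.p' ∈ δ.darts := by rw [δ.edge_p']; simp [mem_darts]
  have eq' : X.edge δ.q' ∈ δ.darts := by rw [δ.edge_q']; simp [mem_darts]
  have hW : ∀ {x}, x ∈ δ.darts → X.white x →
      (x = δ.p ∨ x = δ.q) ∧ X.edge x ∉ ε.darts ∧ X.edge x ∉ ε'.darts ∨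
      x = δ.a ∧ X.edge x ∈ ε.darts ∧ X.edge x ∉ ε'.darts ∨
      x = δ.b ∧ X.edge x ∉ ε.darts ∧ X.edge x ∈ ε'.darts := by
    intro x hx hw
    obtain ⟨v1, v2, v3, v4⟩ := δ.blacks
    rw [mem_darts] at hx
    rcases hx with h | h | h | h | h | h | h | h <;> rw [h] at hw ⊢
    · exact Or.inl ⟨Or.inl rfl, d1 ep, d2 ep⟩
    · exact Or.inl ⟨Or.inr rfl, d1 eq, d2 eq⟩
    · exact Or.inr (Or.inl ⟨rfl, h1.mem.1, d3 h1.mem.1⟩)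
    · exact Or.inr (Or.inr ⟨rfl, fun h => d3 h h2.mem.1, h2.mem.1⟩)
    exacts [(v1 hw).elim, (v2 hw).elim, (v3 hw).elim, (v4 hw).elim]
  have hB : ∀ {x}, x ∈ δ.darts → ¬ X.white x →
      (x = δ.p' ∨ x = δ.q') ∧ X.edge x ∉ ε.darts ∧ X.edge x ∉ ε'.darts ∨
      x = δ.d ∧ X.edge x ∈ ε.darts ∧ X.edge x ∉ ε'.darts ∨
      x = δ.c ∧ X.edge x ∉ ε.darts ∧ X.edge x ∈ ε'.darts := by
    intro x hx hw
    obtain ⟨w1, w2, w3, w4⟩ := δ.whites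
    rw [mem_darts] at hx
    rcases hx with h | h | h | h | h | h | h | h <;> rw [h] at hw ⊢
    · exact (hw w1).elim
    · exact (hw w2).elim
    · exact (hw w3).elim
    · exact (hw w4).elim
    · exact Or.inl ⟨Or.inl rfl, d1 ep', d2 ep'⟩
    · exact Or.inl ⟨Or.inr rfl, d1 eq', d2 eq'⟩
    · exact Or.inr (Or.inr ⟨rfl, fun h => d3 h h2.mem.2, h2.mem.2⟩)
    · exact Or.inr (Or.inl ⟨rfl, h1.mem.2, d3 h1.mem.2⟩)
  obtain ⟨a1, a2, a3, a4, a5, a6⟩ := η.rot_invariant fun u => δ.rot_mem (u := u)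
  obtain ⟨b1, -, -, b4, -, -⟩ := η.rot_invariant fun u => ε.rot_mem (u := u)
  obtain ⟨c1, -, -, c4, -, -⟩ := η.rot_invariant fun u => ε'.rot_mem (u := u)
  have n2 := η.nodup
  simp only [List.nodup_cons, List.mem_cons, not_or] at n2
  have hcase : η.p ∈ δ.darts ∨ η.p' ∈ δ.darts := by
    rw [mem_darts] at hu'
    rcases hu' with h | h | h | h | h | h | h | h <;> rw [h] at hu
    exacts [Or.inl hu, Or.inl (a1.1 hu), Or.inl (a2.1 hu), Or.inl (a3.1 hu), Or.inr hu,
      Or.inr (a4.1 hu), Or.inr (a5.1 hu), Or.inr (a6.1 hu)]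
  rcases hcase with hp | hp
  · have n := n2.1.1
    have g := hW hp η.whites.1
    have g' := hW (a1.2 hp) η.whites.2.1
    rw [η.edge_p] at g
    rw [η.edge_q, b4, c4] at g'
    rcases g with ⟨g, k1, k2⟩ | ⟨g, k1, k2⟩ | ⟨g, k1, k2⟩ <;>
      rcases g' with ⟨g', k1', k2'⟩ | ⟨g', k1', k2'⟩ | ⟨g', k1', k2'⟩
    exacts [⟨g, g'⟩, (k1 k1').elim, (k2 k2').elim, (k1' k1).elim, (n (g.trans g'.symm)).elim,
      (k1' k1).elim, (k2' k2).elim, (k1 k1').elim, (n (g.trans g'.symm)).elim]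
  · have n := n2.2.2.2.2.1.1
    have g := hB hp η.blacks.1
    have g' := hB (a4.2 hp) η.blacks.2.1
    rw [η.edge_p'] at g
    rw [η.edge_q', b1, c1] at g'
    rcases g with ⟨g, k1, k2⟩ | ⟨g, k1, k2⟩ | ⟨g, k1, k2⟩ <;>
      rcases g' with ⟨g', k1', k2'⟩ | ⟨g', k1', k2'⟩ | ⟨g', k1', k2'⟩
    · rw [← η.edge_p', ← η.edge_q', ← δ.edge_p', ← δ.edge_q']
      exact ⟨g.imp (congrArg _) (congrArg _), g'.imp (congrArg _) (congrArg _)⟩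
    exacts [(k1 k1').elim, (k2 k2').elim, (k1' k1).elim, (n (g.trans g'.symm)).elim,
      (k1' k1).elim, (k2' k2).elim, (k1 k1').elim, (n (g.trans g'.symm)).elim]

end BMap

namespace RootedMap

open BMap

variable {M : RootedMap} {S : Finset M.toBMap.Dip} {Y : BMap M.Dart}

/-- The sides of a removed dipole are not connected to the inner edges of removed dipoles. -/
theorem not_conn_inner (h : IsMultiRemoval S Y) {δ ε : M.toBMap.Dip} (hδ : δ ∈ S) (hε : ε ∈ S)
    {w : M.Dart} (hw : w = δ.a ∨ w = δ.b) : ¬ Y.Conn w ε.p ∧ ¬ Y.Conn w ε.q := by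
  have hmem : w ∈ δ.darts := by rw [Dip.mem_darts]; tauto
  have hnd := δ.nodup
  simp only [List.nodup_cons, List.mem_cons, not_or] at hnd
  have key : w ≠ ε.p ∧ w ≠ ε.p' ∧ w ≠ ε.q ∧ w ≠ ε.q' := by
    by_cases hne : δ = ε
    · subst hne
      rcases hw with rfl | rfl <;> grind
    · have := Set.disjoint_left.1 (h.disjoint δ hδ ε hε hne) hmem
      rw [Dip.mem_darts] at this
      tauto
  have := h.conn_inner hε (u := w)
  tauto

/-- The half-edges of degree 4 that remain after the removal of a maximal family of dipoles.  Those
whose edge has been cut are marked; by maximality, every face and every straight cycle of length 2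
passes through a marked half-edge. -/
theorem card_four_le_of_exceptional (h : IsMultiRemoval S Y)
    (hS : ∀ ε : M.toBMap.Dip, ∃ δ ∈ S, ¬ Disjoint ε.darts δ.darts)
    {Z : BMap M.Dart} (hZ : Z.Clean) (hr : Z.rot = Y.rot)
    (he : ∀ u, Y.Four u → Y.Four (Y.edge u) → Z.edge u = Y.edge u)
    (hc : ∀ u v, Y.Four u → Y.Four v → (Z.Conn u v ↔ Y.Conn u v)) (B : Finset M.Dart)
    (hB : ∀ w, M.white w → ¬ Y.Four w → (∀ δ ∈ S, ¬ Y.Conn w δ.p ∧ ¬ Y.Conn w δ.q) →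
      w ∈ B ∨ ∀ u, Y.Conn u w → ¬ Y.Four u) :
    (Nat.card {d // Y.Four d} : ℤ) ≤ 64 * (170 * B.card + 9 * Z.excess) := by
  classical
  have : Fintype M.Dart := Fintype.ofFinite _
  have hF := four_congr (X := Y) hr
  have hYw : Y.white = M.white := h.white
  have rr := fun u hu => h.rot_of_four (u := u) hu
  have hX4 : ∀ u, Y.Four u → M.toBMap.Four u := fun u hu => (h.four_iff.1 hu).1
  set Mk : Finset M.Dart := Finset.univ.filter fun z => Y.Four z ∧ ¬ Y.Four (Y.edge z) with hMk
  have mMk : ∀ z, z ∈ Mk ↔ Y.Four z ∧ ¬ Y.Four (Y.edge z) := by simp [hMk]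
  have hBmem : ∀ w z, M.white w → ¬ Y.Four w → Y.Conn z w → Y.Four z → w ∈ B := by
    intro w z hw hf hz hzf
    refine (hB w hw hf fun δ hδ => ⟨fun hp => ?_, fun hq => ?_⟩).resolve_right fun hR => hR z hz hzf
    · rcases (h.conn_inner hδ).1 (hz.trans hp) with rfl | rfl <;>
        exact h.not_four hδ (by simp [Dip.mem_darts]) hzf
    · rcases (h.conn_inner hδ).2 (hz.trans hq) with rfl | rfl <;>
        exact h.not_four hδ (by simp [Dip.mem_darts]) hzf
  -- the cut edge of a marked half-edge starts with a vertex of degree 2, whose white half-edge is in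
  -- `B`
  have hMkcard : Mk.card ≤ 2 * B.card := by
    have hsub : Mk ⊆ B.image Y.edge ∪ B.image fun w => Y.edge (Y.rot w) := by
      intro z hz
      rw [mMk] at hz
      rw [Finset.mem_union, Finset.mem_image, Finset.mem_image]
      by_cases hw : M.white z
      · right
        refine ⟨Y.rot (Y.edge z), hBmem _ z ?_ ?_ ((conn_rot _).trans (conn_edge z)).symm hz.1, ?_⟩
        · rw [← hYw, white_rot' hz.2, Y.white_edge, not_not, hYw]; exact hw
        · rw [four_rot]; exact hz.2
        · rw [BMap.not_four.1 hz.2, Y.edge_edge]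
      · left
        refine ⟨Y.edge z, hBmem _ z ?_ hz.2 (conn_edge z).symm hz.1, Y.edge_edge z⟩
        rw [← hYw, Y.white_edge, hYw]; exact hw
    have h1 := Finset.card_le_card hsub
    have h2 := Finset.card_union_le (B.image Y.edge) (B.image fun w => Y.edge (Y.rot w))
    have h3 := Finset.card_image_le (s := B) (f := Y.edge)
    have h4 := Finset.card_image_le (s := B) (f := fun w => Y.edge (Y.rot w))
    omega
  -- the edge of an unmarked half-edge is an edge of the original map
  have hedge : ∀ z, Y.Four z → z ∉ Mk → Y.Four (Y.edge z) ∧ Z.edge z = M.edge z ∧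
      Y.edge z = M.edge z := by
    intro z hz hn
    rw [mMk] at hn
    have h1 : Y.Four (Y.edge z) := by tauto
    have h2 : Y.edge z = M.edge z := by rw [h.edge]; rfl
    exact ⟨h1, (he z hz h1).trans h2, h2⟩
  have hYX : ∀ z, Y.edge z = M.edge z := fun z => by rw [h.edge]; rfl
  have key := hZ.card_four_le Mk ?_ ?_ ?_
  · have h1 : Nat.card {d // Z.Four d} = Nat.card {d // Y.Four d} :=
      Nat.card_congr (Equiv.subtypeEquivRight hF)
    rw [h1] at key
    omega
  · intro x hx hface
    rw [hF] at hx
    by_contra hno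
    rw [not_or] at hno
    obtain ⟨f1, e1, -⟩ := hedge x hx hno.1
    obtain ⟨y, hy⟩ : ∃ y, y = Z.face x := ⟨_, rfl⟩
    have hy' : y = M.rot (M.edge x) := by
      rw [hy, face, Perm.mul_apply, hr, e1, ← hYX]
      exact rr _ f1
    have fy : Y.Four y := by
      rw [hy', ← hYX]
      change Y.Four (M.toBMap.rot _)
      rw [← rr _ f1, four_rot]
      exact f1
    rw [← hy] at hno hface
    obtain ⟨f2, e2, -⟩ := hedge y fy hno.2
    have hx' : M.rot (M.edge y) = x := by
      rw [face, Perm.mul_apply, hr, e2, ← hYX, rr _ f2, hYX] at hface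
      exact hface
    rw [hYX] at f1 f2
    by_cases hw : M.white x
    · have wp : M.white (M.edge y) := by
        have h1 : Y.rot (M.edge x) = M.rot (M.edge x) := rr _ f1
        rw [M.white_edge, hy', ← hYw, ← h1, BMap.white_rot f1, hYw, M.white_edge, not_not]
        exact hw
      refine h.not_four_of_maximal hS (faceDip M.toBMap (M.edge y) wp (hX4 _ f2) ?_ ?_) ⟨f2, ?_⟩
      · change M.toBMap.Four (M.edge (M.edge y))
        rw [M.edge_edge]; exact hX4 _ fy
      · change M.edge (M.edge y) = M.rot (M.edge (M.rot (M.edge y)))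
        rw [hx', M.edge_edge]; exact hy'
      · change Y.Four (M.edge (M.edge y))
        rw [M.edge_edge]; exact fy
    · have wp : M.white (M.edge x) := by rw [M.white_edge]; exact hw
      refine h.not_four_of_maximal hS (faceDip M.toBMap (M.edge x) wp (hX4 _ f1) ?_ ?_) ⟨f1, ?_⟩
      · change M.toBMap.Four (M.edge (M.edge x))
        rw [M.edge_edge]; exact hX4 _ hx
      · change M.edge (M.edge x) = M.rot (M.edge (M.rot (M.edge x)))
        rw [← hy', M.edge_edge]; exact hx'.symm
      · change Y.Four (M.edge (M.edge x))
        rw [M.edge_edge]; exact hx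
  · intro x hx hstr
    have hx' := hx
    rw [hF] at hx
    by_contra hno
    rw [not_or] at hno
    obtain ⟨f1, e1, -⟩ := hedge x hx hno.1
    have k1 : Z.edge (Z.opp x) = Z.opp (Z.edge x) := by
      have h1 : Z.opp (Z.edge (Z.opp (Z.edge x))) = x := hstr
      have h2 := congrArg Z.opp h1
      rw [opp_opp] at h2
      rw [← h2, Z.edge_edge]
    rw [opp_of_four hx'] at hno k1
    rw [opp_of_four (hZ.four_edge.2 hx'), e1, hr] at k1
    rw [hr] at hno
    have fr := four_rot.2 hx
    have fr' := four_rot.2 fr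
    obtain ⟨f2, e2, -⟩ := hedge _ fr' hno.2
    rw [hYX] at f1
    have fr1 := four_rot.2 f1
    rw [e2, rr _ fr, rr _ hx, rr _ fr1, rr _ f1] at k1
    rw [hYX, rr _ fr, rr _ hx] at f2
    by_cases hw : M.white x
    · exact h.not_four_of_maximal hS (straightDip M.toBMap x hw (hX4 _ hx) (hX4 _ f1) k1) ⟨hx, f1⟩
    · have wp : M.white (M.edge x) := by rw [M.white_edge]; exact hw
      refine h.not_four_of_maximal hS (straightDip M.toBMap (M.edge x) wp (hX4 _ f1) ?_ ?_) ⟨f1, ?_⟩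
      · change M.toBMap.Four (M.edge (M.edge x))
        rw [M.edge_edge]; exact hX4 _ hx
      · change M.edge (M.rot (M.rot (M.edge x))) = M.rot (M.rot (M.edge (M.edge x)))
        have k2 : M.edge (M.rot (M.rot x)) = M.rot (M.rot (M.edge x)) := k1
        rw [← k2, M.edge_edge, M.edge_edge]
      · change Y.Four (M.edge (M.edge x))
        rw [M.edge_edge]; exact hx
  · intro d hd
    rw [hF] at hd
    by_contra hno
    push Not at hno
    have hno' : ∀ u, Y.Four u → Y.Conn u d → u ∉ Mk := fun u hu hud hM =>
      hno u hM ((hc u d hu hd).2 hud)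
    -- a component without cut edges would be the whole original map, without the root
    refine not_four_root (hX4 _ (mem_of_mapsTo (P := fun u => Y.Four u ∧ Y.Conn u d)
      (fun u hu => ?_) (fun u hu => ?_) ⟨hd, rfl⟩ M.root).1)
    · change Y.Four (M.toBMap.rot u) ∧ Y.Conn (M.toBMap.rot u) d
      rw [← rr u hu.1, four_rot]
      exact ⟨hu.1, (conn_rot u).trans hu.2⟩
    · rw [← hYX]
      exact ⟨(hedge u hu.1 (hno' u hu.1 hu.2)).1, (conn_edge u).trans hu.2⟩

/-- A side whose half-edges lie in a ring with two white half-edges and without the root is glued to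
a side of another dipole. -/
theorem exists_glued (h : IsMultiRemoval S Y) {w : M.Dart} (hw : M.white w)
    (hJ : ∀ δ ∈ S, ¬ Y.Conn w δ.p ∧ ¬ Y.Conn w δ.q) (hroot : ¬ Y.Conn w M.root)
    (hR : ∀ u, Y.Conn u w → ¬ Y.Four u) {z₁ z₂ : M.Dart}
    (hz : ∀ v, M.white v → Y.Conn v w → v = z₁ ∨ v = z₂) (hne : M.edge w ≠ Y.rot w) :
    ∃ ε ∈ S, ε.GluedTo w (Y.rot w) := by
  have hYw : Y.white = M.white := h.white
  have hYX : ∀ z, Y.edge z = M.edge z := fun z => by rw [h.edge]; rfl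
  have f0 := hR w rfl
  have c1 : Y.Conn (Y.rot w) w := conn_rot w
  obtain ⟨w₁, hw₁⟩ : ∃ w₁, w₁ = M.edge (Y.rot w) := ⟨_, rfl⟩
  have c2 : Y.Conn w₁ w := by
    rw [hw₁, ← hYX]; exact (conn_edge _).trans c1
  have wh1 : M.white w₁ := by
    rw [hw₁, M.white_edge, ← hYw, white_rot' f0, not_not, hYw]; exact hw
  have f1 := hR w₁ c2
  have c3 : Y.Conn (M.edge (Y.rot w₁)) w := by
    rw [← hYX]; exact (conn_edge _).trans ((conn_rot _).trans c2)
  have wh2 : M.white (M.edge (Y.rot w₁)) := by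
    rw [M.white_edge, ← hYw, white_rot' f1, not_not, hYw]; exact wh1
  have n1 : w₁ ≠ w := fun h1 => hne (by rw [← h1, hw₁, M.edge_edge, ← hw₁, h1])
  have n2 : M.edge (Y.rot w₁) ≠ w₁ := fun h1 => n1 (Y.rot.injective (M.edge.injective (by
    rw [h1, hw₁])))
  have k : M.edge (Y.rot w₁) = w := by
    have h1 := hz w hw rfl
    have h2 := hz w₁ wh1 c2
    have h3 := hz _ wh2 c3
    generalize M.edge (Y.rot w₁) = w₂ at h3 n2
    clear hw₁ c2 wh1 f1 c3 wh2 hz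
    grind
  have k' : M.edge w = Y.rot w₁ := by rw [← k, M.edge_edge]
  rcases eq_of_white_not_four h wh1 f1 with h1 | ⟨ε, hε, h1 | h1 | h1 | h1⟩
  · exact (hroot (h1 ▸ c2.symm)).elim
  · exact ((hJ ε hε).1 (h1 ▸ c2.symm)).elim
  · exact ((hJ ε hε).2 (h1 ▸ c2.symm)).elim
  · exact ⟨ε, hε, Or.inl ⟨by rw [← h.rot_a ε hε, ← h1]; exact k', by rw [← h1]; exact hw₁.symm⟩⟩
  · exact ⟨ε, hε, Or.inr ⟨by rw [← h.rot_b ε hε, ← h1]; exact k', by rw [← h1]; exact hw₁.symm⟩⟩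

end RootedMap
end MatrixModel

namespace MatrixModel
open Equiv
namespace RootedMap

open BMap

variable {M : RootedMap}

/-- `η` gives names to the half-edges of the dipole `ζ`. -/
structure Dipole.IsLabelling (ζ : M.Dipole) (η : M.toBMap.Dip) : Prop where
  fst : η.p = ζ.fst
  snd : η.q = ζ.snd
  isSide : ∀ s, ζ.IsSide s ↔ s = {η.a, η.d} ∨ s = {η.b, η.c}
  darts : ζ.darts = η.darts

/-- The half-edges of a dipole can be named. -/
theorem Dipole.exists_isLabelling (ζ : M.Dipole) : ∃ η, ζ.IsLabelling η := by
  suffices h : ∃ η : M.toBMap.Dip, η.p = ζ.fst ∧ η.q = ζ.snd ∧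
      ζ.sideA = {η.a, η.d} ∧ ζ.sideB = {η.b, η.c} by
    obtain ⟨η, h1, h2, hA, hB⟩ := h
    refine ⟨η, h1, h2, fun s => by rw [IsSide, hA, hB], ?_⟩
    have e1 : M.edge η.p = η.p' := η.edge_p
    have e2 : M.edge η.q = η.q' := η.edge_q
    ext u
    rw [darts, inner, hA, hB, ← h1, ← h2, e1, e2, Dip.mem_darts]
    simp only [Set.mem_union, Set.mem_insert_iff, Set.mem_singleton_iff]
    tauto
  obtain ⟨k, p, hw, hf, hf', hp⟩ := ζ
  cases k with
  | U => exact ⟨faceDip M.toBMap p hw (four_toBMap.2 hf) (four_toBMap.2 hf') hp, rfl, rfl, rfl, by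
      change {M.rot (M.rot (M.rot p)), M.rot (M.rot (M.edge (M.rot p)))} =
        ({M.rot (M.rot (M.rot p)), M.rot (M.edge p)} : Set M.Dart)
      rw [show M.edge p = _ from hp]⟩
  | O =>
    have hp' : M.edge (M.rot (M.rot p)) = M.rot (M.rot (M.edge p)) := hp
    exact ⟨straightDip M.toBMap p hw (four_toBMap.2 hf) (four_toBMap.2 hf') hp, rfl, rfl, by
      change {M.rot p, M.rot (M.edge (M.rot (M.rot p)))} =
        ({M.rot p, M.rot (M.rot (M.rot (M.edge p)))} : Set M.Dart)
      rw [hp'], rfl⟩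

/-- A dipole with the same inner edges as `δ` has the same sides. -/
theorem Dipole.IsLabelling.isSide_iff {ζ : M.Dipole} {η δ : M.toBMap.Dip} (k : ζ.IsLabelling η)
    (hp : η.p = δ.p ∨ η.p = δ.q) (hq : η.q = δ.p ∨ η.q = δ.q) (s : Set M.Dart) :
    ζ.IsSide s ↔ s = {δ.a, δ.d} ∨ s = {δ.b, δ.c} := by
  rw [k.isSide]
  rcases δ.sides_eq η hp hq with ⟨g1, g2, g3, g4⟩ | ⟨g1, g2, g3, g4⟩
  · rw [g1, g2, g3, g4]
  · rw [g1, g2, g3, g4, or_comm]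

/-- A labelled dipole is the labelling of a dipole. -/
theorem exists_dipole (δ : M.toBMap.Dip) : ∃ ζ : M.Dipole, ζ.IsLabelling δ := by
  have e1 : M.edge δ.p = δ.p' := δ.edge_p
  have e2 : M.edge δ.q = δ.q' := δ.edge_q
  have hf := four_toBMap.1 δ.four_p
  have hf' : M.Ordinary (M.edge δ.p) := by rw [e1]; exact four_toBMap.1 δ.four_p'
  have key : ∃ ζ : M.Dipole, ζ.fst = δ.p ∧ ζ.snd = δ.q := by
    rcases δ.shape with ⟨s1, s2, s3, s4, s5, s6, s7, s8⟩ | ⟨s1, s2, s3, s4, s5, s6, s7, s8⟩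
    · refine ⟨⟨.U, δ.p, δ.white_p, hf, hf', ?_⟩, rfl, s1⟩
      change M.edge δ.p = M.rot (M.edge (M.rot δ.p))
      rw [show M.rot δ.p = δ.q from s1, e1, e2]
      exact s5.symm
    · have s : M.rot (M.rot δ.p) = δ.q := by
        rw [show M.rot δ.p = δ.a from s1]; exact s2
      refine ⟨⟨.O, δ.p, δ.white_p, hf, hf', ?_⟩, rfl, s⟩
      change M.edge (M.rot (M.rot δ.p)) = M.rot (M.rot (M.edge δ.p))
      rw [s, e1, e2, show M.rot δ.p' = δ.c from s5]
      exact s6.symm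
  obtain ⟨ζ, h1, h2⟩ := key
  obtain ⟨η, k⟩ := ζ.exists_isLabelling
  have hp := k.fst.trans h1
  have hq := k.snd.trans h2
  refine ⟨ζ, h1.symm, h2.symm, k.isSide_iff (Or.inl hp) (Or.inr hq), ?_⟩
  have hp' : η.p' = δ.p' := by rw [← η.edge_p, ← δ.edge_p, hp]
  have hq' : η.q' = δ.q' := by rw [← η.edge_q, ← δ.edge_q, hq]
  rw [k.darts]
  ext u
  rw [Dip.mem_darts, Dip.mem_darts, hp, hq, hp', hq']
  rcases δ.sides_eq η (Or.inl hp) (Or.inr hq) with ⟨g1, g2, g3, g4⟩ | ⟨g1, g2, g3, g4⟩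
  · rw [g1, g2, g3, g4]
  · rw [g1, g2, g3, g4]
    tauto

/-- No half-edge of a dipole that is glued to two other dipoles is kept. -/
theorem not_kept_of_glued {δ ε ε' : M.toBMap.Dip} (h1 : ε.GluedTo δ.a δ.d)
    (h2 : ε'.GluedTo δ.b δ.c) (d1 : Disjoint δ.darts ε.darts) (d2 : Disjoint δ.darts ε'.darts)
    (d3 : Disjoint ε.darts ε'.darts) {u : M.Dart} (hu : u ∈ δ.darts) : ¬ M.Kept u := by
  obtain ⟨δ₁, kδ⟩ := exists_dipole δ
  obtain ⟨ε₁, kε⟩ := exists_dipole ε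
  obtain ⟨ε₁', kε'⟩ := exists_dipole ε'
  -- a dipole with the same inner edges as `δ` is glued along both sides
  have key : ∀ ζ : M.Dipole, ∀ η, ζ.IsLabelling η → (η.p = δ.p ∨ η.p = δ.q) →
      (η.q = δ.p ∨ η.q = δ.q) → ∀ s, ζ.IsSide s → ∃ θ, ζ.GluedAlong s θ := by
    intro ζ η k hp hq s hs
    have hpm : ζ.fst ∈ δ.darts := by
      rw [← k.fst, Dip.mem_darts]; tauto
    have hns : ∀ (θ : M.Dipole) (τ : M.toBMap.Dip), θ.IsLabelling τ → Disjoint δ.darts τ.darts →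
        ¬ ζ.Same θ := by
      intro θ τ kθ hd hsame
      refine Set.disjoint_left.1 hd hpm ?_
      rw [← kθ.darts]
      have : ζ.fst ∈ ζ.inner := Or.inl rfl
      rw [hsame.2] at this
      exact Or.inl (Or.inl this)
    rcases (k.isSide_iff hp hq s).1 hs with rfl | rfl
    · refine ⟨ε₁, hns _ _ kε d1, hs, (kε.isSide _).2 ?_⟩
      rw [Set.image_pair]
      rcases h1 with ⟨g1, g2⟩ | ⟨g1, g2⟩
      · left
        rw [show M.edge δ.a = _ from g1, show M.edge δ.d = _ from g2, Set.pair_comm]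
      · right
        rw [show M.edge δ.a = _ from g1, show M.edge δ.d = _ from g2, Set.pair_comm]
    · refine ⟨ε₁', hns _ _ kε' d2, hs, (kε'.isSide _).2 ?_⟩
      rw [Set.image_pair]
      rcases h2 with ⟨g1, g2⟩ | ⟨g1, g2⟩
      · left
        rw [show M.edge δ.b = _ from g1, show M.edge δ.c = _ from g2, Set.pair_comm]
      · right
        rw [show M.edge δ.b = _ from g1, show M.edge δ.c = _ from g2, Set.pair_comm]
  have hin : δ₁.InChain := by
    obtain ⟨θ, hθ⟩ := key δ₁ δ kδ (Or.inl rfl) (Or.inr rfl) _ (Or.inl rfl)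
    exact Or.inr ⟨θ, _, hθ⟩
  rintro (hno | ⟨ζ, -, s, hs, hus, hno⟩)
  · exact hno ⟨δ₁, hin, by rw [kδ.darts]; exact hu⟩
  · obtain ⟨η, k⟩ := ζ.exists_isLabelling
    have hη : u ∈ η.darts := by
      rw [Dip.mem_darts]
      rcases (k.isSide s).1 hs with rfl | rfl <;> rcases hus with rfl | rfl <;> simp
    obtain ⟨hp, hq⟩ := δ.inner_eq_of_glued ε ε' η h1 h2 d1 d2 d3 hu hη
    exact hno (key ζ η k hp hq s hs)

variable {S : Finset M.toBMap.Dip} {Y : BMap M.Dart}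

/-- No half-edge of a removed dipole is kept if both sides are glued to removed dipoles.  These two
dipoles are distinct from each other and from `δ`, for otherwise the dipoles would form a component
without the root. -/
theorem not_kept_of_mem (hm : M.MelonFree) (h : IsMultiRemoval S Y) {δ ε ε' : M.toBMap.Dip}
    (hδ : δ ∈ S) (hε : ε ∈ S) (hε' : ε' ∈ S) (h1 : ε.GluedTo δ.a δ.d) (h2 : ε'.GluedTo δ.b δ.c)
    {u : M.Dart} (hu : u ∈ δ.darts) : ¬ M.Kept u := by
  have hnd := δ.nodup
  simp only [List.nodup_cons, List.mem_cons, not_or] at hnd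
  have ee : ∀ {x y}, M.toBMap.edge x = y → M.toBMap.edge y = x := fun h => by
    rw [← h, BMap.edge_edge]
  have na : M.toBMap.edge δ.a ≠ δ.d := fun h =>
    hm _ (M.isMelon_toBMap.1 (δ.isMelon_of_edge_a h))
  have nb : M.toBMap.edge δ.b ≠ δ.c := fun h => by
    obtain ⟨m, h⟩ := δ.isMelon_of_edge_b h
    exact hm _ (M.isMelon_toBMap.1 h)
  -- the half-edges of the dipoles do not form a component
  have hclosed : ∀ τ ∈ S, ¬ ∀ x ∈ ({δ.a, δ.b, δ.c, δ.d, τ.a, τ.b, τ.c, τ.d} : Set M.Dart),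
      M.toBMap.edge x ∈ δ.darts ∪ τ.darts := by
    intro τ hτ hall
    have hr : M.root ∈ δ.darts ∪ τ.darts := by
      refine mem_of_mapsTo (P := fun x => x ∈ δ.darts ∪ τ.darts) ?_ ?_
        (Or.inl (δ.mem_darts.2 (Or.inl rfl))) M.root
      · rintro x (hx | hx)
        · exact Or.inl (δ.rot_mem.2 hx)
        · exact Or.inr (τ.rot_mem.2 hx)
      · have key : ∀ ρ : M.toBMap.Dip, (∀ x ∈ ({ρ.a, ρ.b, ρ.c, ρ.d} : Set M.Dart),
            M.toBMap.edge x ∈ δ.darts ∪ τ.darts) → ρ.darts ⊆ δ.darts ∪ τ.darts →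
            ∀ x ∈ ρ.darts, M.toBMap.edge x ∈ δ.darts ∪ τ.darts := by
          intro ρ h1 h2 x hx
          rw [Dip.mem_darts] at hx
          rcases hx with rfl | rfl | rfl | rfl | rfl | rfl | rfl | rfl
          · rw [ρ.edge_p]; exact h2 (by simp [Dip.mem_darts])
          · rw [ρ.edge_q]; exact h2 (by simp [Dip.mem_darts])
          · exact h1 _ (by simp)
          · exact h1 _ (by simp)
          · rw [ρ.edge_p']; exact h2 (by simp [Dip.mem_darts])
          · rw [ρ.edge_q']; exact h2 (by simp [Dip.mem_darts])
          · exact h1 _ (by simp)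
          · exact h1 _ (by simp)
        rintro x (hx | hx)
        · exact key δ (fun y hy => hall y (by
            simp only [Set.mem_insert_iff, Set.mem_singleton_iff] at hy ⊢; tauto))
            Set.subset_union_left x hx
        · exact key τ (fun y hy => hall y (by
            simp only [Set.mem_insert_iff, Set.mem_singleton_iff] at hy ⊢; tauto))
            Set.subset_union_right x hx
    rcases hr with hr | hr
    · exact not_four_root (δ.fours hr)
    · exact not_four_root (τ.fours hr)
  have m := fun (τ : M.toBMap.Dip) u hu => (τ.mem_darts (u := u)).2 hu
  have hne1 : δ ≠ ε := by
    rintro rfl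
    rcases h1 with ⟨g1, g2⟩ | ⟨g1, g2⟩
    · exact na g1
    · refine hclosed δ hδ fun x hx => ?_
      rw [Set.union_self]
      simp only [Set.mem_insert_iff, Set.mem_singleton_iff] at hx
      rcases hx with rfl | rfl | rfl | rfl | rfl | rfl | rfl | rfl <;>
        simp [g1, g2, ee g1, ee g2, Dip.mem_darts]
  have hne2 : δ ≠ ε' := by
    rintro rfl
    rcases h2 with ⟨g1, g2⟩ | ⟨g1, g2⟩
    · refine hclosed δ hδ fun x hx => ?_
      rw [Set.union_self]
      simp only [Set.mem_insert_iff, Set.mem_singleton_iff] at hx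
      rcases hx with rfl | rfl | rfl | rfl | rfl | rfl | rfl | rfl <;>
        simp [g1, g2, ee g1, ee g2, Dip.mem_darts]
    · exact nb g1
  have hne3 : ε ≠ ε' := by
    rintro rfl
    have hcd : δ.d ≠ δ.c := fun h => hnd.2.2.2.2.2.2.1.1 h.symm
    rcases h1 with ⟨g1, g2⟩ | ⟨g1, g2⟩ <;> rcases h2 with ⟨k1, k2⟩ | ⟨k1, k2⟩
    · exact hcd (M.toBMap.edge.injective (g2.trans k2.symm))
    · refine hclosed ε hε fun x hx => ?_
      simp only [Set.mem_insert_iff, Set.mem_singleton_iff] at hx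
      rcases hx with rfl | rfl | rfl | rfl | rfl | rfl | rfl | rfl <;>
        simp [g1, g2, k1, k2, ee g1, ee g2, ee k1, ee k2, Dip.mem_darts]
    · refine hclosed ε hε fun x hx => ?_
      simp only [Set.mem_insert_iff, Set.mem_singleton_iff] at hx
      rcases hx with rfl | rfl | rfl | rfl | rfl | rfl | rfl | rfl <;>
        simp [g1, g2, k1, k2, ee g1, ee g2, ee k1, ee k2, Dip.mem_darts]
    · exact hcd (M.toBMap.edge.injective (g2.trans k2.symm))
  exact not_kept_of_glued h1 h2 (h.disjoint δ hδ ε hε hne1) (h.disjoint δ hδ ε' hε' hne2)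
    (h.disjoint ε hε ε' hε' hne3) hu

/-- The number of half-edges of the scheme of a map without melons is bounded in terms of the excess. -/
theorem card_kept_le (hm : M.MelonFree) :
    (Nat.card {d // M.Kept d} : ℤ) ≤ 14186 * M.toBMap.excess + 21794 := by
  classical
  have : Fintype M.Dart := Fintype.ofFinite _
  obtain ⟨S, hdis, hmax⟩ := M.toBMap.exists_maximal_disjoint
  obtain ⟨Y, hY, hle, hex⟩ := exists_isMultiRemoval S hdis
  obtain ⟨Z, hZ, hr, hw, hZex, he, hc⟩ := Y.exists_clean
  rw [M.orb_toBMap] at hex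
  obtain ⟨B, hBcard, hB⟩ := exists_exceptional hm hY hmax hle (by simpa using hex) hZ hr hw hZex
    he hc
  have h4 := card_four_le_of_exceptional hY hmax hZ hr he hc B
    fun w h1 h2 h3 => (hB w h1 h2 h3).imp id And.left
  -- add the white half-edges of the component of the root
  obtain ⟨B', hB'card, hB'⟩ : ∃ B' : Finset M.Dart, B'.card ≤ B.card + 2 ∧
      ∀ w, M.white w → ¬ Y.Four w → (∀ δ ∈ S, ¬ Y.Conn w δ.p ∧ ¬ Y.Conn w δ.q) →
        w ∈ B' ∨ ¬ Y.Conn w M.root ∧ (∀ u, Y.Conn u w → ¬ Y.Four u) ∧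
          ∃ z₁ z₂, ∀ v, M.white v → Y.Conn v w → v = z₁ ∨ v = z₂ := by
    by_cases hroot : ∃ w z₁ z₂, Y.Conn w M.root ∧
        ∀ v, M.white v → Y.Conn v w → v = z₁ ∨ v = z₂
    · obtain ⟨w, z₁, z₂, hw, hz⟩ := hroot
      refine ⟨insert z₁ (insert z₂ B), ?_, fun w' h1 h2 h3 => ?_⟩
      · have g1 := Finset.card_insert_le z₁ (insert z₂ B)
        have g2 := Finset.card_insert_le z₂ B
        omega
      · rcases hB w' h1 h2 h3 with h4 | h4
        · exact Or.inl (by simp [h4])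
        · by_cases h5 : Y.Conn w' M.root
          · left
            rcases hz w' h1 (h5.trans hw.symm) with h6 | h6 <;> simp [h6]
          · exact Or.inr ⟨h5, h4⟩
    · refine ⟨B, by omega, fun w h1 h2 h3 => (hB w h1 h2 h3).imp id fun h4 => ⟨fun h5 => ?_, h4⟩⟩
      obtain ⟨-, z₁, z₂, hz⟩ := h4
      exact hroot ⟨w, z₁, z₂, h5, hz⟩
  -- the removed dipoles that may have a half-edge that is kept
  set S' : Finset M.toBMap.Dip := S.filter fun δ => δ.a ∈ B' ∨ δ.b ∈ B' with hS'
  have hS'card : S'.card ≤ B'.card := by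
    refine Finset.card_le_card_of_injOn (fun δ => if δ.a ∈ B' then δ.a else δ.b) ?_ ?_
    · intro δ hδ
      have := (Finset.mem_filter.1 (Finset.mem_coe.1 hδ)).2
      dsimp only
      split_ifs with h1
      · exact h1
      · exact this.resolve_left h1
    · intro δ hδ ε hε heq
      by_contra hne
      have hd := hdis δ (Finset.mem_filter.1 (Finset.mem_coe.1 hδ)).1 ε
        (Finset.mem_filter.1 (Finset.mem_coe.1 hε)).1 hne
      have key : ∀ τ : M.toBMap.Dip, (if τ.a ∈ B' then τ.a else τ.b) ∈ τ.darts := by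
        intro τ; split_ifs <;> simp [Dip.mem_darts]
      refine Set.disjoint_left.1 hd (key δ) ?_
      have heq' : (if δ.a ∈ B' then δ.a else δ.b) = if ε.a ∈ B' then ε.a else ε.b := heq
      rw [heq']
      exact key ε
  -- the sides of every other removed dipole lie in rings with two white half-edges, so that they are
  -- glued to sides of removed dipoles
  have hgood : ∀ δ ∈ S, δ ∉ S' → ∀ u ∈ δ.darts, ¬ M.Kept u := by
    intro δ hδ hδ' u hu
    have hn : δ.a ∉ B' ∧ δ.b ∉ B' := by
      rw [← not_or]
      exact fun h => hδ' (Finset.mem_filter.2 ⟨hδ, h⟩)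
    obtain ⟨-, -, w3, w4⟩ := δ.whites
    obtain ⟨a1, a2, z₁, z₂, a3⟩ := (hB' δ.a w3 (hY.not_four hδ (by simp [Dip.mem_darts]))
      fun ε hε => not_conn_inner hY hδ hε (Or.inl rfl)).resolve_left hn.1
    obtain ⟨b1, b2, y₁, y₂, b3⟩ := (hB' δ.b w4 (hY.not_four hδ (by simp [Dip.mem_darts]))
      fun ε hε => not_conn_inner hY hδ hε (Or.inr rfl)).resolve_left hn.2
    obtain ⟨ε, hε, g1⟩ := exists_glued hY w3 (fun ε hε => not_conn_inner hY hδ hε (Or.inl rfl))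
      a1 a2 a3 (by
        rw [hY.rot_a δ hδ]
        exact fun h => hm _ (M.isMelon_toBMap.1 (δ.isMelon_of_edge_a h)))
    obtain ⟨ε', hε', g2⟩ := exists_glued hY w4 (fun ε hε => not_conn_inner hY hδ hε (Or.inr rfl))
      b1 b2 b3 (by
        rw [hY.rot_b δ hδ]
        intro h
        obtain ⟨m, h⟩ := δ.isMelon_of_edge_b h
        exact hm _ (M.isMelon_toBMap.1 h))
    rw [hY.rot_a δ hδ] at g1
    rw [hY.rot_b δ hδ] at g2
    exact not_kept_of_mem hm hY hδ hε hε' g1 g2 hu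
  have hsub : (Finset.univ.filter fun d => M.Kept d) ⊆
      (Finset.univ.filter fun d => Y.Four d) ∪ ({M.root, M.rot M.root} ∪
        S'.biUnion fun δ => Finset.univ.filter fun d => d ∈ δ.darts) := by
    intro d hd
    have hk := (Finset.mem_filter.1 hd).2
    simp only [Finset.mem_union, Finset.mem_filter, Finset.mem_univ, true_and, Finset.mem_insert,
      Finset.mem_singleton, Finset.mem_biUnion]
    by_cases h1 : Y.Four d
    · exact Or.inl h1
    right
    rw [hY.four_iff, not_and_or] at h1
    rcases h1 with h1 | h1
    · left
      rw [four_toBMap, Ordinary, not_and_or, not_not, not_not] at h1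
      exact h1
    · right
      push Not at h1
      obtain ⟨δ, hδ, hd⟩ := h1
      by_cases h2 : δ ∈ S'
      · exact ⟨δ, h2, hd⟩
      · exact (hgood δ hδ h2 d hd hk).elim
  have h8 : ∀ δ ∈ S', (Finset.univ.filter fun d => d ∈ δ.darts).card ≤ 8 := by
    intro δ _
    have hs : (Finset.univ.filter fun d => d ∈ δ.darts) ⊆
        [δ.p, δ.q, δ.a, δ.b, δ.p', δ.q', δ.c, δ.d].toFinset := by
      intro d hd
      have := (Finset.mem_filter.1 hd).2
      rw [Dip.mem_darts] at this
      simpa using this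
    exact (Finset.card_le_card hs).trans (List.toFinset_card_le _)
  have c1 := Finset.card_le_card hsub
  have c2 := Finset.card_union_le (Finset.univ.filter fun d => Y.Four d)
    ({M.root, M.rot M.root} ∪ S'.biUnion fun δ => Finset.univ.filter fun d => d ∈ δ.darts)
  have c3 := Finset.card_union_le ({M.root, M.rot M.root} : Finset M.Dart)
    (S'.biUnion fun δ => Finset.univ.filter fun d => d ∈ δ.darts)
  have c4 := Finset.card_biUnion_le_card_mul S' _ 8 h8
  have c5 : ({M.root, M.rot M.root} : Finset M.Dart).card ≤ 2 := Finset.card_le_two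
  have k1 : Nat.card {d // M.Kept d} = (Finset.univ.filter fun d => M.Kept d).card := by
    rw [Nat.card_eq_fintype_card, Fintype.card_subtype]
  have k2 : Nat.card {d // Y.Four d} = (Finset.univ.filter fun d => Y.Four d).card := by
    rw [Nat.card_eq_fintype_card, Fintype.card_subtype]
  -- `64 * 170 * 5 / 4 + 64 * 9 + 8 * 5 / 4 = 14186` and `64 * 170 * 2 + 8 * (2 + 2) + 2 = 21794`
  rw [k2] at h4
  rw [k1]
  omega

end RootedMap
end MatrixModel

namespace MatrixModel
open Equiv

/-! ### Finiteness -/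

instance : Finite ChainLabel :=
  Finite.of_injective (fun c : ChainLabel => match c with | .U => (0 : Fin 3) | .O => 1 | .B => 2)
    (by rintro ⟨⟩ ⟨⟩ <;> simp)

/-- There are finitely many maps with chain-vertices with a bounded number of half-edges. -/
theorem finite_setOf_card_le (n : ℕ) : {s : Quotient MapWithChains.setoid | ∃ S : MapWithChains,
    Finite S.Dart ∧ Nat.card S.Dart ≤ n ∧ s = Quotient.mk _ S}.Finite := by
  let T (k : ℕ) := (Fin k → Prop) × (Fin k → Prop) × (Fin k → Fin k → Prop) ×
    (Fin k → Fin k → Prop) × (Fin k → ChainLabel → Prop) × (Fin k → Fin k → Prop) ×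
    (Fin k → Fin k → Prop) × (Fin k → Fin k → Prop)
  let f (k : ℕ) (t : T k) : Quotient MapWithChains.setoid := Quotient.mk _
    ⟨Fin k, t.1, t.2.1, t.2.2.1, t.2.2.2.1, t.2.2.2.2.1, t.2.2.2.2.2.1, t.2.2.2.2.2.2.1,
      t.2.2.2.2.2.2.2⟩
  refine Set.Finite.subset (Set.Finite.biUnion (Set.finite_Iic n) fun k _ =>
    Set.finite_range (f k)) ?_
  rintro _ ⟨S, hS, hn, rfl⟩
  refine Set.mem_biUnion (x := Nat.card S.Dart) hn ?_
  let e := (Finite.equivFin S.Dart).symm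
  refine ⟨⟨fun x => S.white (e x), fun x => S.root (e x), fun x y => S.edge (e x) (e y),
    fun x y => S.vertex (e x) (e y), fun x c => S.label (e x) c, fun x y => S.side (e x) (e y),
    fun x y => S.corner (e x) (e y), fun x y => S.straight (e x) (e y)⟩, Quotient.sound ?_⟩
  exact ⟨e, fun _ => Iff.rfl, fun _ => Iff.rfl, fun _ _ => Iff.rfl, fun _ _ => Iff.rfl,
    fun _ _ => Iff.rfl, fun _ _ => Iff.rfl, fun _ _ => Iff.rfl, fun _ _ => Iff.rfl⟩

end MatrixModel

theorem mainTheorem2 (h l : ℕ) : (MatrixModel.MS h l).Finite := by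
  refine (MatrixModel.finite_setOf_card_le (14186 * (8 * h + 4 * l) + 21794)).subset ?_
  rintro s ⟨M, S, hg, hl, ⟨N, hN, hiso⟩, rfl⟩
  have h1 : N.toBMap.excess = 8 * h + 4 * l := by
    have h2 := M.excess_toBMap
    rw [hg, hl, ← hN.excess_eq] at h2
    exact_mod_cast h2
  have h2 := MatrixModel.RootedMap.card_kept_le hN.2
  rw [h1] at h2
  refine ⟨N.contractChains, ?_, ?_, (Quotient.sound hiso).symm⟩
  · change Finite {d // N.Kept d}
    infer_instance
  · change Nat.card {d // N.Kept d} ≤ _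
    exact_mod_cast h2
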